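/- Let $F'/F$ be a field extension. A \emph{tensor category over $F$} is an $F$-linear symmetric monoidal category whose tensor product is $F$-bilinear and right exact in each variable and for which the natural map $F\to\operatorname{End}(\mathbf 1)$ is an isomorphism. A \emph{pre-Tannakian category over $F$} is an abelian tensor category $\mathcal T$ over $F$ that is rigid (every object has a dual) and $F$-finite (every object has finite length and a finite-dimensional endomorphism algebra over $F$). Categories are small with respect to a fixed universe, and $F$, $F'$, $R'$ lie in it. For $\mathcal T$ pre-Tannakian over $F$, an $F'$-module in the category $\operatorname{ind}\mathcal T$ of ind-objects is an ind-object $X$ together with a homomorphism of $F$-algebras $F'\to\operatorname{End}(X)$. The \emph{scalar extension} $\mathcal T\otimes_F F'$ is the full subcategory, of the category of $F'$-modules in $\operatorname{ind}\mathcal T$, of the modules of finite length. Let $t(X)=F'\otimes_F X$ for $X\in\mathcal T$, with $F'$ acting on the factor $F'$. For a tensor category $\mathcal S$ over a field $K$ and a commutative $K$-algebra $R$, a \emph{fibre functor on $\mathcal S$ over $R$} is a $K$-linear, exact, faithful, symmetric (strong) monoidal functor from $\mathcal S$ to $R$-modules whose values are finitely generated projective $R$-modules. Morphisms of fibre functors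 are monoidal natural transformations. \textbf{Proposition.} Let $\mathcal T$ be a pre-Tannakian category over $F$ and $F'/F$ a field extension. Then $t$ takes values in $\mathcal T\otimes_F F'$, and $\mathcal T\otimes_F F'$ carries a structure of tensor category over $F'$ for which $t:\mathcal T\to\mathcal T\otimes_F F'$ is a symmetric monoidal functor. For every such structure and every commutative $F'$-algebra $R'$, if $\omega$ is a fibre functor on $\mathcal T\otimes_F F'$ over $R'$ then $\omega\circ t$ is a fibre functor on $\mathcal T$ over $R'$, and the restriction functor \[ \{\text{fibre functors on } \mathcal T\otimes_F F' \text{ over } R'\}\longrightarrow\{\text{fibre functors on }\mathcal T\text{ over }R'\},\qquad \omega\mapsto\omega\circ t, \] is an equivalence of categories. -/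

import Mathlib

open CategoryTheory Limits MonoidalCategory

universe v u w

noncomputable section

namespace ScalarExtension

/-! ### Objects of finite length, tensor categories, pre-Tannakian categories -/

/-- An object has finite length if its subobjects satisfy both chain conditions. -/
def finiteLength (C : Type u) [Category.{v} C] : ObjectProperty C :=
  fun X => IsNoetherianObject X ∧ IsArtinianObject X

/-- An `F`-finite abelian category: all objects have finite length and the endomorphism
algebra of each object is finite-dimensional over `F`. -/
structure IsFFinite (F : Type w) [Field F] (A : Type u) [Category.{v} A] [Abelian A]
    [Linear F A] : Prop where
  finite_length : ∀ X : A, finiteLength A X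
  finite_end : ∀ X : A, Module.Finite F (End X)

/-- A symmetric monoidal `F`-linear category is a tensor category over `F` if its tensor product
is `F`-bilinear and right exact in each variable, and `F → End(𝟙)` is bijective. -/
structure IsTensorCategory (F : Type w) [Field F] (A : Type u) [Category.{v} A] [Preadditive A]
    [Linear F A] [MonoidalCategory A] [SymmetricCategory A] : Prop
    extends MonoidalPreadditive A, MonoidalLinear F A where
  rightExact_left : ∀ X : A, PreservesFiniteColimits (tensorLeft X)
  rightExact_right : ∀ X : A, PreservesFiniteColimits (tensorRight X)
  end_unit : Function.Bijective (algebraMap F (End (𝟙_ A)))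

/-- A pre-Tannakian category over `F`: an `F`-finite rigid abelian tensor category over `F`. -/
structure IsPreTannakian (F : Type w) [Field F] (T : Type u) [Category.{v} T] [Abelian T]
    [Linear F T] [MonoidalCategory T] [SymmetricCategory T] : Prop
    extends IsTensorCategory F T, IsFFinite F T where
  rigid : ∀ X : T, ∃ Y : T, Nonempty (ExactPairing X Y)

/-! ### The `F`-linear structure on ind-objects -/

section IndLinear

/-- Two morphisms out of an ind-object agree if they agree on all its "elements". -/
lemma ind_hom_ext {A : Type v} [SmallCategory A] {X Y : Ind A} {f g : X ⟶ Y}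
    (h : ∀ (Z : A) (p : Ind.yoneda.obj Z ⟶ X), p ≫ f = p ≫ g) : f = g := by
  apply (Ind.inclusion A).map_injective
  ext ⟨Z⟩ x
  let q : yoneda.obj Z ⟶ (Ind.inclusion A).obj X := yonedaEquiv.symm x
  let p : Ind.yoneda.obj Z ⟶ X :=
    Ind.inclusion.fullyFaithful.preimage (Ind.yonedaCompInclusion.hom.app Z ≫ q)
  have hp : (Ind.inclusion A).map p = Ind.yonedaCompInclusion.hom.app Z ≫ q :=
    Ind.inclusion.fullyFaithful.map_preimage _
  have h1 := congrArg (Ind.inclusion A).map (h Z p)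
  rw [Functor.map_comp, Functor.map_comp, hp, Category.assoc, Category.assoc,
    cancel_epi] at h1
  have h2 := congrArg (fun t => yonedaEquiv t) h1
  simpa [q, yonedaEquiv_comp] using h2

variable {A : Type v} [SmallCategory A] [Abelian A]

instance indYoneda_additive : (Ind.yoneda (C := A)).Additive :=
  have : PreservesBinaryBiproducts (Ind.yoneda (C := A)) :=
    preservesBinaryBiproducts_of_preservesBinaryProducts _
  Functor.additive_of_preservesBinaryBiproducts _

variable {F : Type w} [Field F] [Linear F A]

/-- Multiplication by `r` on an ind-object `X`, induced by multiplication by `r` on `A`. -/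
def indScalar (r : F) (X : Ind A) : X ⟶ X :=
  Ind.inclusion.fullyFaithful.preimage
    { app := fun Z => ((Ind.inclusion A).obj X).map (r • 𝟙 Z.unop).op
      naturality := fun Z W f => by
        rw [← Functor.map_comp, ← Functor.map_comp]
        congr 1
        apply Quiver.Hom.unop_inj
        simp }

lemma inclusion_map_indScalar (r : F) (X : Ind A) (Z : Aᵒᵖ) :
    ((Ind.inclusion A).map (indScalar r X)).app Z =
      ((Ind.inclusion A).obj X).map (r • 𝟙 Z.unop).op := by
  simp [indScalar]

lemma indScalar_comm (r : F) {X Y : Ind A} (f : X ⟶ Y) :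
    indScalar r X ≫ f = f ≫ indScalar r Y := by
  apply (Ind.inclusion A).map_injective
  ext Z x
  rw [Functor.map_comp, Functor.map_comp, NatTrans.comp_app, NatTrans.comp_app,
    inclusion_map_indScalar, inclusion_map_indScalar, NatTrans.naturality]

lemma indScalar_yoneda (r : F) (Z : A) :
    indScalar r (Ind.yoneda.obj Z) = Ind.yoneda.map (r • 𝟙 Z) := by
  apply (Ind.inclusion A).map_injective
  rw [← cancel_mono (Ind.yonedaCompInclusion.hom.app Z)]
  ext W x
  have h1 := Ind.yonedaCompInclusion.hom.naturality (r • 𝟙 Z)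
  have h2 := (Ind.yonedaCompInclusion.hom.app Z).naturality (r • 𝟙 W.unop).op
  rw [Functor.comp_map] at h1
  rw [h1, NatTrans.comp_app, inclusion_map_indScalar]
  erw [h2]
  simp

lemma comp_indScalar (r : F) {X : Ind A} {Z : A} (p : Ind.yoneda.obj Z ⟶ X) :
    p ≫ indScalar r X = Ind.yoneda.map (r • 𝟙 Z) ≫ p := by
  rw [← indScalar_comm, indScalar_yoneda]

lemma indScalar_one (X : Ind A) : indScalar (1 : F) X = 𝟙 X :=
  ind_hom_ext fun Z p => by simp [comp_indScalar]

lemma indScalar_zero (X : Ind A) : indScalar (0 : F) X = 0 :=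
  ind_hom_ext fun Z p => by simp [comp_indScalar]

lemma indScalar_add (r s : F) (X : Ind A) :
    indScalar (r + s) X = indScalar r X + indScalar s X :=
  ind_hom_ext fun Z p => by simp [comp_indScalar, add_smul, Functor.map_add]

lemma indScalar_mul (r s : F) (X : Ind A) :
    indScalar (r * s) X = indScalar r X ≫ indScalar s X :=
  ind_hom_ext fun Z p => by
    rw [comp_indScalar, ← Category.assoc, comp_indScalar, comp_indScalar,
      ← Category.assoc, ← Functor.map_comp, mul_comm, mul_smul, Linear.smul_comp,
      Category.id_comp]

/-- The `F`-linear structure on `Ind A`: the scalar `r` acts on a morphism `f` out of `X` by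
composition with multiplication by `r` on `X`. -/
instance indLinear : Linear F (Ind A) where
  homModule X Y :=
    { smul := fun r f => indScalar r X ≫ f
      one_smul := fun f => by
        change indScalar (1 : F) X ≫ f = f
        rw [indScalar_one, Category.id_comp]
      mul_smul := fun r s f => by
        change indScalar (r * s) X ≫ f = indScalar r X ≫ indScalar s X ≫ f
        rw [indScalar_mul, Category.assoc]
      smul_zero := fun r => comp_zero
      smul_add := fun r f g => Preadditive.comp_add _ _ _ _ _ _
      add_smul := fun r s f => by
        change indScalar (r + s) X ≫ f = indScalar r X ≫ f + indScalar s X ≫ f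
        rw [indScalar_add, Preadditive.add_comp]
      zero_smul := fun f => by
        change indScalar (0 : F) X ≫ f = 0
        rw [indScalar_zero, zero_comp] }
  smul_comp _ _ _ r f g := Category.assoc _ _ _
  comp_smul X Y Z f r g := by
    change f ≫ indScalar r Y ≫ g = indScalar r X ≫ f ≫ g
    rw [← Category.assoc, ← Category.assoc, indScalar_comm]

/-- The embedding `A ⥤ Ind A` is `F`-linear. -/
instance indYoneda_linear : (Ind.yoneda (C := A)).Linear F where
  map_smul {X Y} f r := by
    change Ind.yoneda.map (r • f) = indScalar r _ ≫ Ind.yoneda.map f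
    rw [indScalar_yoneda, ← Functor.map_comp, Linear.smul_comp, Category.id_comp]

end IndLinear

/-! ### Modules over a field extension in a linear category -/

section LinModule

/-- An `F'`-module in an `F`-linear category `B`: an object together with a homomorphism of
`F`-algebras from `F'` to its endomorphism algebra. -/
structure LinModule (F F' : Type v) [Field F] [Field F'] [Algebra F F'] (B : Type u)
    [Category.{v} B] [Preadditive B] [Linear F B] where
  carrier : B
  act : F' →ₐ[F] End carrier

variable {F F' : Type v} [Field F] [Field F'] [Algebra F F'] {B : Type u}
    [Category.{v} B] [Preadditive B] [Linear F B]

namespace LinModule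

/-- The action of a scalar as a morphism of the underlying object. -/
def smulHom (M : LinModule F F' B) (a : F') : M.carrier ⟶ M.carrier := M.act a

lemma smulHom_one (M : LinModule F F' B) : M.smulHom 1 = 𝟙 _ := map_one M.act

lemma smulHom_zero (M : LinModule F F' B) : M.smulHom 0 = 0 := map_zero M.act

lemma smulHom_add (M : LinModule F F' B) (a b : F') :
    M.smulHom (a + b) = M.smulHom a + M.smulHom b := map_add M.act a b

lemma smulHom_mul (M : LinModule F F' B) (a b : F') :
    M.smulHom (a * b) = M.smulHom a ≫ M.smulHom b := by
  rw [mul_comm]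
  exact map_mul M.act b a

/-- A homomorphism of `F'`-modules is a morphism commuting with the actions of `F'`. -/
@[ext]
structure Hom (M N : LinModule F F' B) where
  hom : M.carrier ⟶ N.carrier
  comm : ∀ a : F', M.smulHom a ≫ hom = hom ≫ N.smulHom a

instance category : Category.{v} (LinModule F F' B) where
  Hom := Hom
  id M := ⟨𝟙 _, fun a => by rw [Category.comp_id, Category.id_comp]⟩
  comp f g := ⟨f.hom ≫ g.hom, fun a => by
    rw [← Category.assoc, f.comm, Category.assoc, g.comm, Category.assoc]⟩
  id_comp f := Hom.ext (Category.id_comp f.hom)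
  comp_id f := Hom.ext (Category.comp_id f.hom)
  assoc f g h := Hom.ext (Category.assoc f.hom g.hom h.hom)

@[ext]
lemma hom_ext {M N : LinModule F F' B} {f g : M ⟶ N} (h : f.hom = g.hom) : f = g :=
  Hom.ext h

@[simp]
lemma id_hom (M : LinModule F F' B) : Hom.hom (𝟙 M) = 𝟙 M.carrier := rfl

@[simp]
lemma comp_hom {M N P : LinModule F F' B} (f : M ⟶ N) (g : N ⟶ P) :
    (f ≫ g).hom = f.hom ≫ g.hom := rfl

/-- Morphisms of modules form an additive subgroup of the morphisms of the carriers. -/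
def homSubgroup (M N : LinModule F F' B) : AddSubgroup (M.carrier ⟶ N.carrier) where
  carrier := {f | ∀ a : F', M.smulHom a ≫ f = f ≫ N.smulHom a}
  zero_mem' := fun a => by rw [comp_zero, zero_comp]
  add_mem' := fun hf hg a => by
    rw [Preadditive.comp_add, Preadditive.add_comp, hf a, hg a]
  neg_mem' := fun hf a => by
    rw [Preadditive.comp_neg, Preadditive.neg_comp, hf a]

def homEquiv (M N : LinModule F F' B) : (M ⟶ N) ≃ homSubgroup M N where
  toFun f := ⟨f.hom, f.comm⟩
  invFun f := ⟨f.1, f.2⟩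
  left_inv _ := rfl
  right_inv _ := rfl

instance preadditive : Preadditive (LinModule F F' B) where
  homGroup M N := (homEquiv M N).addCommGroup
  add_comp _ _ _ f f' g := hom_ext (Preadditive.add_comp _ _ _ f.hom f'.hom g.hom)
  comp_add _ _ _ f g g' := hom_ext (Preadditive.comp_add _ _ _ f.hom g.hom g'.hom)

@[simp]
lemma add_hom {M N : LinModule F F' B} (f g : M ⟶ N) : (f + g).hom = f.hom + g.hom := rfl

@[simp]
lemma zero_hom {M N : LinModule F F' B} : (0 : M ⟶ N).hom = 0 := rfl

/-- The `F'`-linear structure on the category of `F'`-modules in `B`. -/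
instance linear : Linear F' (LinModule F F' B) where
  homModule M N :=
    { smul := fun a f => ⟨M.smulHom a ≫ f.hom, fun b => by
        rw [Category.assoc, ← f.comm, ← Category.assoc, ← Category.assoc, ← smulHom_mul,
          ← smulHom_mul, mul_comm]⟩
      one_smul := fun f => hom_ext (by
        change M.smulHom 1 ≫ f.hom = f.hom
        rw [smulHom_one, Category.id_comp])
      mul_smul := fun a b f => hom_ext (by
        change M.smulHom (a * b) ≫ f.hom = M.smulHom a ≫ M.smulHom b ≫ f.hom
        rw [smulHom_mul, Category.assoc])
      smul_zero := fun a => hom_ext comp_zero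
      smul_add := fun a f g => hom_ext (Preadditive.comp_add _ _ _ _ f.hom g.hom)
      add_smul := fun a b f => hom_ext (by
        change M.smulHom (a + b) ≫ f.hom = M.smulHom a ≫ f.hom + M.smulHom b ≫ f.hom
        rw [smulHom_add, Preadditive.add_comp])
      zero_smul := fun f => hom_ext (by
        change M.smulHom 0 ≫ f.hom = 0
        rw [smulHom_zero, zero_comp]) }
  smul_comp _ _ _ a f g := hom_ext (Category.assoc _ f.hom g.hom)
  comp_smul M N P f a g := hom_ext (by
    change f.hom ≫ N.smulHom a ≫ g.hom = M.smulHom a ≫ f.hom ≫ g.hom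
    rw [← Category.assoc, ← Category.assoc, f.comm])

end LinModule

/-! ### The external tensor product `F' ⊗ X` and the free module functor -/

variable [HasCoproducts.{v} B]

variable (F F') in
/-- The external tensor product `F' ⊗ X`: a direct sum of copies of `X` indexed by an
`F`-basis of `F'`. -/
def extTensor (X : B) : B := ∐ fun _ : Module.Basis.ofVectorSpaceIndex F F' => X

variable (F F') in
/-- The universal `F`-linear map `F' → Hom(X, F' ⊗ X)`. -/
def extTensorMk (X : B) : F' →ₗ[F] (X ⟶ extTensor F F' X) :=
  (Module.Basis.ofVectorSpace F F').constr F
    fun i => Sigma.ι (fun _ : Module.Basis.ofVectorSpaceIndex F F' => X) i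

lemma extTensorMk_basis (X : B) (i : Module.Basis.ofVectorSpaceIndex F F') :
    extTensorMk F F' X (Module.Basis.ofVectorSpace F F' i) =
      Sigma.ι (fun _ : Module.Basis.ofVectorSpaceIndex F F' => X) i :=
  Module.Basis.constr_basis _ _ _ _

/-- The morphism `F' ⊗ X ⟶ Y` corresponding to an `F`-linear map `F' → Hom(X, Y)`. -/
def extTensorDesc {X Y : B} (φ : F' →ₗ[F] (X ⟶ Y)) : extTensor F F' X ⟶ Y :=
  Sigma.desc fun i => φ (Module.Basis.ofVectorSpace F F' i)

lemma extTensorMk_desc {X Y : B} (φ : F' →ₗ[F] (X ⟶ Y)) (a : F') :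
    extTensorMk F F' X a ≫ extTensorDesc φ = φ a := by
  have h : (Linear.rightComp F X (extTensorDesc φ)).comp (extTensorMk F F' X) = φ := by
    refine (Module.Basis.ofVectorSpace F F').ext fun i => ?_
    rw [LinearMap.comp_apply, extTensorMk_basis]
    exact Sigma.ι_desc _ _
  exact LinearMap.congr_fun h a

lemma extTensor_hom_ext {X Y : B} {f g : extTensor F F' X ⟶ Y}
    (h : ∀ a : F', extTensorMk F F' X a ≫ f = extTensorMk F F' X a ≫ g) : f = g := by
  refine Sigma.hom_ext _ _ fun i => ?_
  have hi := h (Module.Basis.ofVectorSpace F F' i)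
  rwa [extTensorMk_basis] at hi

variable (F F') in
/-- Multiplication by `a` on `F' ⊗ X`, induced by multiplication by `a` on `F'`. -/
def extTensorMul (X : B) (a : F') : extTensor F F' X ⟶ extTensor F F' X :=
  extTensorDesc ((extTensorMk F F' X).comp (LinearMap.mulLeft F a))

lemma extTensorMk_mul (X : B) (a b : F') :
    extTensorMk F F' X b ≫ extTensorMul F F' X a = extTensorMk F F' X (a * b) :=
  extTensorMk_desc _ _

variable (F F') in
/-- The free module `F' ⊗ X`, on which `F'` acts by multiplication on itself. -/
def freeModuleObj (X : B) : LinModule F F' B where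
  carrier := extTensor F F' X
  act :=
    { toFun := fun a => extTensorMul F F' X a
      map_one' := extTensor_hom_ext fun b => by
        rw [extTensorMk_mul, one_mul]
        exact (Category.comp_id _).symm
      map_mul' := fun a a' => extTensor_hom_ext fun b => by
        rw [extTensorMk_mul, End.mul_def, ← Category.assoc, extTensorMk_mul, extTensorMk_mul,
          mul_assoc]
      map_zero' := extTensor_hom_ext fun b => by
        rw [extTensorMk_mul, zero_mul, map_zero, comp_zero]
      map_add' := fun a a' => extTensor_hom_ext fun b => by
        rw [extTensorMk_mul, Preadditive.comp_add, extTensorMk_mul, extTensorMk_mul, add_mul,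
          map_add]
      commutes' := fun r => extTensor_hom_ext fun b => by
        rw [extTensorMk_mul, ← Algebra.smul_def, map_smul, Algebra.algebraMap_eq_smul_one]
        exact ((Linear.comp_smul _ _ _ _ r (𝟙 _)).trans
          (congrArg (r • ·) (Category.comp_id _))).symm }

variable (F F') in
/-- The morphism `F' ⊗ X ⟶ F' ⊗ Y` induced by `f : X ⟶ Y`. -/
def extTensorMap {X Y : B} (f : X ⟶ Y) : extTensor F F' X ⟶ extTensor F F' Y :=
  extTensorDesc ((Linear.leftComp F _ f).comp (extTensorMk F F' Y))

lemma extTensorMk_map {X Y : B} (f : X ⟶ Y) (a : F') :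
    extTensorMk F F' X a ≫ extTensorMap F F' f = f ≫ extTensorMk F F' Y a :=
  extTensorMk_desc _ _

variable (F F') in
/-- The functor `X ↦ F' ⊗ X` from `B` to the category of `F'`-modules in `B`. -/
def freeModule : B ⥤ LinModule F F' B where
  obj X := freeModuleObj F F' X
  map {X Y} f :=
    { hom := extTensorMap F F' f
      comm := fun a => extTensor_hom_ext fun b => by
        change _ ≫ extTensorMul F F' X a ≫ extTensorMap F F' f =
          _ ≫ extTensorMap F F' f ≫ extTensorMul F F' Y a
        rw [← Category.assoc, ← Category.assoc, extTensorMk_mul, extTensorMk_map,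
          extTensorMk_map, Category.assoc, extTensorMk_mul] }
  map_id X := LinModule.hom_ext (extTensor_hom_ext fun a =>
    (extTensorMk_map _ _).trans ((Category.id_comp _).trans (Category.comp_id _).symm))
  map_comp {X Y Z} f g := LinModule.hom_ext (extTensor_hom_ext fun a =>
    (extTensorMk_map (f ≫ g) a).trans (by
      change _ = extTensorMk F F' X a ≫ extTensorMap F F' f ≫ extTensorMap F F' g
      rw [← Category.assoc (extTensorMk F F' X a), extTensorMk_map, Category.assoc,
        Category.assoc, extTensorMk_map]))

end LinModule

/-! ### Scalar extension of an `F`-finite abelian category -/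

section ScalarExtensionCategory

variable (F F' : Type v) [Field F] [Field F'] [Algebra F F']
  (A : Type v) [SmallCategory A] [Abelian A] [Linear F A]

/-- The scalar extension `A ⊗_F F'`: the full subcategory of the category of `F'`-modules in
`Ind A` consisting of the modules of finite length. -/
abbrev ScalarExt : Type (v + 1) :=
  (finiteLength (LinModule F F' (Ind A))).FullSubcategory

/-- The functor `X ↦ F' ⊗ X` from `A` to the category of `F'`-modules in `Ind A`. -/
def extFunctor : A ⥤ LinModule F F' (Ind A) := Ind.yoneda ⋙ freeModule F F'

variable {F F' A}

/-- The scalar extension functor `t : A ⥤ A ⊗_F F'`, given that `F' ⊗ X` has finite length for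
every `X`. -/
abbrev scalarExtFunctor (ht : ∀ X : A, finiteLength _ ((extFunctor F F' A).obj X)) :
    A ⥤ ScalarExt F F' A :=
  (finiteLength (LinModule F F' (Ind A))).lift (extFunctor F F' A) ht

end ScalarExtensionCategory

/-! ### Fibre functors -/

/-- A fibre functor over a commutative `F`-algebra `R`: a symmetric monoidal functor to
`R`-modules which is strong monoidal, `F`-linear, exact and faithful, and whose values are
finitely generated projective `R`-modules. -/
structure IsFibreFunctor (F : Type v) [Field F] (T : Type u) [Category.{v} T] [Preadditive T]
    [Linear F T] [MonoidalCategory T] [SymmetricCategory T]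
    (R : Type v) [CommRing R] [Algebra F R]
    (ω : LaxBraidedFunctor T (ModuleCat.{v} R)) : Prop where
  isIso_ε : IsIso (Functor.LaxMonoidal.ε ω.toFunctor)
  isIso_μ : ∀ X Y : T, IsIso (Functor.LaxMonoidal.μ ω.toFunctor X Y)
  additive : ω.toFunctor.Additive
  linear : ∀ {X Y : T} (a : F) (f : X ⟶ Y),
    ω.toFunctor.map (a • f) = algebraMap F R a • ω.toFunctor.map f
  leftExact : PreservesFiniteLimits ω.toFunctor
  rightExact : PreservesFiniteColimits ω.toFunctor
  faithful : ω.toFunctor.Faithful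
  finite : ∀ X : T, Module.Finite R (ω.toFunctor.obj X)
  projective : ∀ X : T, Module.Projective R (ω.toFunctor.obj X)

/-- The category of fibre functors over `R`; its morphisms are the morphisms of tensor functors,
that is, the monoidal natural transformations. -/
abbrev FibreFunctor (F : Type v) [Field F] (T : Type u) [Category.{v} T] [Preadditive T]
    [Linear F T] [MonoidalCategory T] [SymmetricCategory T]
    (R : Type v) [CommRing R] [Algebra F R] :=
  ObjectProperty.FullSubcategory (IsFibreFunctor F T R)

/-- Precomposition with a tensor functor `G`. -/
def precomp {C : Type*} [Category* C] [MonoidalCategory C] [SymmetricCategory C]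
    {D : Type*} [Category* D] [MonoidalCategory D] [SymmetricCategory D]
    {E : Type*} [Category* E] [MonoidalCategory E] [SymmetricCategory E]
    (G : C ⥤ D) [G.Braided] : LaxBraidedFunctor D E ⥤ LaxBraidedFunctor C E where
  obj ω := LaxBraidedFunctor.of (G ⋙ ω.toFunctor)
  map {ω ω'} η :=
    haveI h : NatTrans.IsMonoidal (F₁ := ω.toFunctor) (F₂ := ω'.toFunctor) η.hom.hom :=
      η.hom.isMonoidal
    haveI : NatTrans.IsMonoidal (F₁ := (LaxBraidedFunctor.of (G ⋙ ω.toFunctor)).toFunctor)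
        (F₂ := (LaxBraidedFunctor.of (G ⋙ ω'.toFunctor)).toFunctor)
        (Functor.whiskerLeft G η.hom.hom) :=
      NatTrans.IsMonoidal.whiskerLeft (F₁ := G) (G₁ := ω.toFunctor) (G₂ := ω'.toFunctor)
        η.hom.hom
    LaxBraidedFunctor.homMk (F := LaxBraidedFunctor.of (G ⋙ ω.toFunctor))
      (G := LaxBraidedFunctor.of (G ⋙ ω'.toFunctor)) (Functor.whiskerLeft G η.hom.hom)

end ScalarExtension
end

noncomputable section

namespace ScalarExtension

/-! ### The category of `F'`-modules is abelian -/

namespace LinModule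

variable {F F' : Type v} [Field F] [Field F'] [Algebra F F'] {B : Type u}
  [Category.{v} B]

section Preadditive

variable [Preadditive B] [Linear F B]

/-! Write `C` for the scalar extension. Everything about `t : T ⥤ C` that matters is collected in
`IsScalarExtension`: `t` is exact, `Hom(tX, tY)` is `F' ⊗ Hom(X, Y)`, every object of `C` is a
quotient of some `tX`, and every epimorphism onto `tX` is dominated by `t q` with `q` an epimorphism
of `T`. Hence every `M` in `C` has a presentation `tY ⟶ tX ⟶ M ⟶ 0`, and right exact constructions
on `C` are determined by, and can be built from, their restriction to the objects `tX`.

That `tX` has finite length reduces to simple `X`, where a subobject of `tX` is detected by the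
subspace of the finite-dimensional `F'`-algebra `End(tX)` consisting of the endomorphisms that
factor through it. The tensor product on `C` is a cokernel formed from presentations; its
constraints and their coherence are inherited from `T`, since they can be tested after the
epimorphisms `tmk` from objects `t(A ⊗ B)`.

Restriction of fibre functors is fully faithful because a transformation on the objects `tX` is
automatically natural for all morphisms `tX ⟶ tY` by `F'`-linearity, and extends uniquely along
presentations.

For essential surjectivity, a fibre functor `ω` over `R` is extended right exactly: the value at `M`
is the cokernel of `ω(Y) ⟶ ω(X)`. The difficulty is left exactness and projectivity of the values. A
morphism `u : tX ⟶ tY` has a matrix `Φ` of coefficients in `A = R ⊗ F'`. Its `n`-minors are again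
matrix coefficients, of a single morphism between `n`-th tensor powers (`coeff_minorHom`). The unit
of `T` is simple (`epi_of_mono_unit`), so by duality the coefficients of a nonzero morphism generate
the unit ideal of `A` (`span_coeff`). Thus every ideal of minors is `0` or `A`, and Laplace
expansion produces a generalized inverse, `Φ = Φ m Φ` (`exists_regular`). Specialized along `A → R`
this makes the cokernel of `ω(u)` a direct summand of `ω(Y)`, hence projective. Used over `A` itself
it shows that an element killed by `ω(u)` comes from some `tZ ⟶ tX` killed by `u`
(`exists_of_mapExt_eq_zero`), which is exactness. Faithfulness follows by a further duality argument
(`epi_of_map_surjective`). -/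

lemma smulHom_algebraMap (M : LinModule F F' B) (r : F) :
    M.smulHom (algebraMap F F' r) = r • 𝟙 M.carrier := by
  have := M.act.commutes r
  rw [Algebra.algebraMap_eq_smul_one (A := End M.carrier)] at this
  exact this

/-- A family of endomorphisms of `K` satisfying the axioms of a module structure. -/
def mk' (K : B) (s : F' → (K ⟶ K)) (h1 : s 1 = 𝟙 K) (hm : ∀ a b, s (a * b) = s a ≫ s b)
    (ha : ∀ a b, s (a + b) = s a + s b) (hr : ∀ r : F, s (algebraMap F F' r) = r • 𝟙 K) :
    LinModule F F' B where
  carrier := K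
  act :=
    { toFun := s
      map_one' := h1
      map_mul' := fun a b => by rw [mul_comm, hm]; rfl
      map_zero' := by simpa using hr 0
      map_add' := ha
      commutes' := fun r => by rw [hr, Algebra.algebraMap_eq_smul_one]; rfl }

/-- The module structure on a subobject of `M` stable under the action. -/
def ofMono {K : B} (M : LinModule F F' B) (i : K ⟶ M.carrier) [Mono i] (s : F' → (K ⟶ K))
    (h : ∀ a, s a ≫ i = i ≫ M.smulHom a) : LinModule F F' B :=
  mk' K s (by rw [← cancel_mono i, h]; simp [smulHom_one])
    (fun a b => by rw [← cancel_mono i]; simp [h, smulHom_mul, reassoc_of% (h a)])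
    (fun a b => by rw [← cancel_mono i]; simp [h, smulHom_add])
    (fun r => by rw [← cancel_mono i]; simp [h, smulHom_algebraMap])

/-- The module structure on a quotient of `M` by a stable subobject. -/
def ofEpi {Q : B} (M : LinModule F F' B) (p : M.carrier ⟶ Q) [Epi p] (s : F' → (Q ⟶ Q))
    (h : ∀ a, p ≫ s a = M.smulHom a ≫ p) : LinModule F F' B :=
  mk' Q s (by rw [← cancel_epi p, h]; simp [smulHom_one])
    (fun a b => by rw [← cancel_epi p]; simp [h, smulHom_mul, reassoc_of% (h a)])
    (fun a b => by rw [← cancel_epi p]; simp [h, smulHom_add])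
    (fun r => by rw [← cancel_epi p]; simp [h, smulHom_algebraMap])

/-- The functor sending a module to its underlying object. -/
@[simps]
def forget : LinModule F F' B ⥤ B where
  obj M := M.carrier
  map f := f.hom

instance : (forget (F := F) (F' := F') (B := B)).Additive where

instance : (forget (F := F) (F' := F') (B := B)).Faithful where
  map_injective h := hom_ext h

end Preadditive

variable [Abelian B] [Linear F B]

/-- The kernel of a homomorphism of modules. -/
def kerObj {M N : LinModule F F' B} (f : M ⟶ N) : LinModule F F' B :=
  ofMono M (kernel.ι f.hom)
    (fun a => kernel.map f.hom f.hom (M.smulHom a) (N.smulHom a) (f.comm a).symm)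
    (fun a => kernel.lift_ι _ _ _)

/-- The inclusion of the kernel. -/
def kerι {M N : LinModule F F' B} (f : M ⟶ N) : kerObj f ⟶ M :=
  ⟨kernel.ι f.hom, fun a => kernel.lift_ι _ _ _⟩

/-- The cokernel of a homomorphism of modules. -/
def cokerObj {M N : LinModule F F' B} (f : M ⟶ N) : LinModule F F' B :=
  ofEpi N (cokernel.π f.hom)
    (fun a => cokernel.map f.hom f.hom (M.smulHom a) (N.smulHom a) (f.comm a).symm)
    (fun a => cokernel.π_desc _ _ _)

/-- The projection onto the cokernel. -/
def cokerπ {M N : LinModule F F' B} (f : M ⟶ N) : N ⟶ cokerObj f :=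
  ⟨cokernel.π f.hom, fun a => (cokernel.π_desc _ _ _).symm⟩

/-- A morphism of modules whose underlying morphism is a kernel is a kernel. -/
def isLimitOfForget {K M N : LinModule F F' B} (f : M ⟶ N) (i : K ⟶ M) (w : i ≫ f = 0)
    [Mono i.hom] (l : ∀ {Z : B} (g : Z ⟶ M.carrier), g ≫ f.hom = 0 →
      { g' : Z ⟶ K.carrier // g' ≫ i.hom = g }) : IsLimit (KernelFork.ofι i w) :=
  haveI : Mono i := (forget (F := F) (F' := F') (B := B)).mono_of_mono_map ‹Mono i.hom›
  KernelFork.IsLimit.ofι' _ _ fun {Z} k hk =>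
    ⟨⟨(l k.hom (congrArg Hom.hom hk)).1, fun a => by
      have h := (l k.hom (congrArg Hom.hom hk)).2
      rw [← cancel_mono i.hom, Category.assoc, h, Category.assoc, i.comm, reassoc_of% h, k.comm]⟩,
    hom_ext (l k.hom (congrArg Hom.hom hk)).2⟩

/-- A morphism of modules whose underlying morphism is a cokernel is a cokernel. -/
def isColimitOfForget {M N Q : LinModule F F' B} (f : M ⟶ N) (p : N ⟶ Q) (w : f ≫ p = 0)
    [Epi p.hom] (l : ∀ {Z : B} (g : N.carrier ⟶ Z), f.hom ≫ g = 0 →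
      { g' : Q.carrier ⟶ Z // p.hom ≫ g' = g }) : IsColimit (CokernelCofork.ofπ p w) :=
  haveI : Epi p := (forget (F := F) (F' := F') (B := B)).epi_of_epi_map ‹Epi p.hom›
  CokernelCofork.IsColimit.ofπ' _ _ fun {Z} k hk =>
    ⟨⟨(l k.hom (congrArg Hom.hom hk)).1, fun a => by
      have h := (l k.hom (congrArg Hom.hom hk)).2
      rw [← cancel_epi p.hom, ← Category.assoc, ← p.comm, Category.assoc, h, reassoc_of% h,
        k.comm]⟩,
    hom_ext (l k.hom (congrArg Hom.hom hk)).2⟩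

instance {M N : LinModule F F' B} (f : M ⟶ N) : Mono (kerι f).hom :=
  inferInstanceAs (Mono (kernel.ι f.hom))

instance {M N : LinModule F F' B} (f : M ⟶ N) : Epi (cokerπ f).hom :=
  inferInstanceAs (Epi (cokernel.π f.hom))

/-- `kerι f` is a kernel of `f`. -/
def kerIsLimit {M N : LinModule F F' B} (f : M ⟶ N) :
    IsLimit (KernelFork.ofι (kerι f) (hom_ext (kernel.condition f.hom))) :=
  isLimitOfForget f _ _ fun g hg => ⟨kernel.lift _ g hg, kernel.lift_ι _ _ _⟩

/-- `cokerπ f` is a cokernel of `f`. -/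
def cokerIsColimit {M N : LinModule F F' B} (f : M ⟶ N) :
    IsColimit (CokernelCofork.ofπ (cokerπ f) (hom_ext (cokernel.condition f.hom))) :=
  isColimitOfForget f _ _ fun g hg => ⟨cokernel.desc _ g hg, cokernel.π_desc _ _ _⟩

instance : HasKernels (LinModule F F' B) where
  has_limit f := ⟨_, kerIsLimit f⟩

instance : HasCokernels (LinModule F F' B) where
  has_colimit f := ⟨_, cokerIsColimit f⟩

/-- The direct sum of two modules. -/
def biprodObj (M N : LinModule F F' B) : LinModule F F' B :=
  mk' (M.carrier ⊞ N.carrier) (fun a => biprod.map (M.smulHom a) (N.smulHom a))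
    (by ext <;> simp [smulHom_one])
    (fun a b => by ext <;> simp [smulHom_mul])
    (fun a b => by ext <;> simp [smulHom_add])
    (fun r => by ext <;> simp [smulHom_algebraMap])

instance : HasBinaryBiproducts (LinModule F F' B) where
  has_binary_biproduct M N := hasBinaryBiproduct_of_total
    { pt := biprodObj M N
      fst := ⟨biprod.fst, fun a => biprod.map_fst _ _⟩
      snd := ⟨biprod.snd, fun a => biprod.map_snd _ _⟩
      inl := ⟨biprod.inl, fun a => (biprod.inl_map _ _).symm⟩
      inr := ⟨biprod.inr, fun a => (biprod.inr_map _ _).symm⟩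
      inl_fst := hom_ext biprod.inl_fst
      inl_snd := hom_ext biprod.inl_snd
      inr_fst := hom_ext biprod.inr_fst
      inr_snd := hom_ext biprod.inr_snd } (hom_ext biprod.total)

open ZeroObject in
instance : HasZeroObject (LinModule F F' B) := by
  let Z : LinModule F F' B := mk' (0 : B) (fun _ => 0)
    ((isZero_zero B).eq_of_src _ _) (by simp) (by simp) (fun r => (isZero_zero B).eq_of_src _ _)
  refine ⟨Z, (IsZero.iff_id_eq_zero _).2 (hom_ext ?_)⟩
  exact (isZero_zero B).eq_of_src _ _

instance : HasFiniteProducts (LinModule F F' B) :=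
  hasFiniteProducts_of_has_binary_and_terminal

/-- Kernels of modules are computed in `B`, so a monomorphism of modules has zero kernel in `B`. -/
instance : (forget (F := F) (F' := F') (B := B)).PreservesMonomorphisms where
  preserves {M N} f _ := by
    have h : kerι f = 0 := by
      rw [← cancel_mono f, zero_comp]
      exact hom_ext (kernel.condition f.hom)
    exact Preadditive.mono_of_kernel_zero (congrArg Hom.hom h)

instance : (forget (F := F) (F' := F') (B := B)).PreservesEpimorphisms where
  preserves {M N} f _ := by
    have h : cokerπ f = 0 := by
      rw [← cancel_epi f, comp_zero]
      exact hom_ext (cokernel.condition f.hom)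
    exact Preadditive.epi_of_cokernel_zero (congrArg Hom.hom h)

instance {M N : LinModule F F' B} (f : M ⟶ N) [Mono f] : Mono f.hom :=
  inferInstanceAs (Mono ((forget (F := F) (F' := F') (B := B)).map f))

instance {M N : LinModule F F' B} (f : M ⟶ N) [Epi f] : Epi f.hom :=
  inferInstanceAs (Epi ((forget (F := F) (F' := F') (B := B)).map f))

instance abelian : Abelian (LinModule F F' B) where
  normalMonoOfMono {M N} f _ :=
    ⟨{  Z := cokerObj f
        g := cokerπ f
        w := hom_ext (cokernel.condition f.hom)
        isLimit := isLimitOfForget _ _ _ fun g hg =>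
          ⟨Abelian.monoLift f.hom g hg, Abelian.monoLift_comp f.hom g hg⟩ }⟩
  normalEpiOfEpi {M N} f _ :=
    ⟨{  W := kerObj f
        g := kerι f
        w := hom_ext (kernel.condition f.hom)
        isColimit := isColimitOfForget _ _ _ fun g hg =>
          ⟨Abelian.epiDesc f.hom g hg, Abelian.comp_epiDesc f.hom g hg⟩ }⟩

end LinModule

/-! ### Objects of finite length in an abelian category -/

section FiniteLength

open ZeroObject

variable {A : Type u} [Category.{v} A] [Abelian A]

lemma finiteLength_iff (X : A) : finiteLength A X ↔
    WellFoundedGT (Subobject X) ∧ WellFoundedLT (Subobject X) := by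
  unfold finiteLength IsNoetherianObject IsArtinianObject
  rw [ObjectProperty.is_iff, ObjectProperty.is_iff]
  rfl

/-- Strictly monotone maps reflect both chain conditions. Finite length is therefore proved below by
attaching to each subobject an invariant that grows strictly. -/
lemma finiteLength_of_strictMono {X : A} {α : Type*} [PartialOrder α] [WellFoundedGT α]
    [WellFoundedLT α] (f : Subobject X → α) (hf : StrictMono f) : finiteLength A X :=
  (finiteLength_iff X).2 ⟨hf.wellFoundedGT, hf.wellFoundedLT⟩

/-- Subobjects `N ≤ N'` of the middle term of an exact sequence agree if they have the same
preimage on the left and the same image on the right. -/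
lemma subobject_le_of_exact {S : ShortComplex A} (hS : S.Exact) {N N' : Subobject S.X₂}
    (hle : N ≤ N') (h1 : (Subobject.pullback S.f).obj N' ≤ (Subobject.pullback S.f).obj N)
    (h2 : imageSubobject (N'.arrow ≫ S.g) ≤ imageSubobject (N.arrow ≫ S.g)) : N' ≤ N := by
  -- On generalized elements: an element `y` of `N'` has, locally, the same image in `S.X₃` as an
  -- element `x` of `N`. The difference lies in `N'` and comes from `S.X₁`, so it lies in `N` by
  -- `h1`.
  have hepi : Epi (Subobject.ofLE N N' hle) := by
    rw [epi_iff_surjective_up_to_refinements]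
    intro Z y
    have hy : (imageSubobject (N.arrow ≫ S.g)).Factors (y ≫ N'.arrow ≫ S.g) :=
      Subobject.factors_of_le _ h2 (Subobject.factors_of_factors_right _
        (by simpa using imageSubobject_factors_comp_self (f := N'.arrow ≫ S.g) (𝟙 _)))
    obtain ⟨Z₁, π₁, _, x, hx⟩ := surjective_up_to_refinements_of_epi
      (factorThruImageSubobject (N.arrow ≫ S.g)) (Subobject.factorThru _ _ hy)
    have hx' : π₁ ≫ y ≫ N'.arrow ≫ S.g = x ≫ N.arrow ≫ S.g := by
      have := congrArg (· ≫ (imageSubobject (N.arrow ≫ S.g)).arrow) hx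
      simpa using this
    obtain ⟨Z₂, π₂, _, w, hw⟩ := hS.exact_up_to_refinements
      (π₁ ≫ y ≫ N'.arrow - x ≫ N.arrow) (by simp [hx'])
    have hwN' : N'.Factors (w ≫ S.f) := by
      rw [← hw, ← Subobject.ofLE_arrow hle]
      exact (Subobject.factors_iff _ _).2 ⟨π₂ ≫ (π₁ ≫ y - x ≫ Subobject.ofLE N N' hle), by
        simp [Preadditive.comp_sub, Preadditive.sub_comp]⟩
    have hwN : N.Factors (w ≫ S.f) := by
      have hP := Subobject.isPullback S.f N'
      have hw' : ((Subobject.pullback S.f).obj N').Factors w := by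
        refine (Subobject.factors_iff _ _).2 ⟨hP.lift (N'.factorThru _ hwN') w (by simp), ?_⟩
        exact hP.lift_snd _ _ _
      have := Subobject.factors_of_le w h1 hw'
      have e : w ≫ S.f = (((Subobject.pullback S.f).obj N).factorThru w this ≫
          Subobject.pullbackπ S.f N) ≫ N.arrow := by
        rw [Category.assoc, (Subobject.isPullback S.f N).w, Subobject.factorThru_arrow_assoc]
      rw [e]
      exact Subobject.factors_comp_arrow _
    refine ⟨Z₂, π₂ ≫ π₁, inferInstance, N.factorThru _ hwN + π₂ ≫ x, ?_⟩
    rw [← cancel_mono N'.arrow]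
    simp only [Category.assoc, Subobject.ofLE_arrow, Preadditive.add_comp,
      Subobject.factorThru_arrow, ← hw, Preadditive.comp_sub]
    abel
  have := isIso_of_mono_of_epi (Subobject.ofLE N N' hle)
  exact Subobject.le_of_comm (inv (Subobject.ofLE N N' hle)) (by simp)

/-- The invariant of a subobject of `S.X₂` is the pair formed by its preimage in `S.X₁` and its
image in `S.X₃`. Only exactness in the middle is needed. -/
lemma finiteLength_of_exact {S : ShortComplex A} (hS : S.Exact) (h1 : finiteLength A S.X₁)
    (h3 : finiteLength A S.X₃) : finiteLength A S.X₂ := by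
  obtain ⟨_, _⟩ := (finiteLength_iff _).1 h1
  obtain ⟨_, _⟩ := (finiteLength_iff _).1 h3
  refine finiteLength_of_strictMono (fun N => ((Subobject.pullback S.f).obj N,
    imageSubobject (N.arrow ≫ S.g))) ?_
  intro N N' h
  have hle : ((Subobject.pullback S.f).obj N, imageSubobject (N.arrow ≫ S.g)) ≤
      ((Subobject.pullback S.f).obj N', imageSubobject (N'.arrow ≫ S.g)) := by
    refine ⟨(Subobject.pullback S.f).monotone h.le, ?_⟩
    dsimp only
    rw [← Subobject.ofLE_arrow h.le, Category.assoc]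
    exact imageSubobject_comp_le _ _
  exact lt_of_le_not_ge hle fun h' => h.not_ge (subobject_le_of_exact hS h.le h'.1 h'.2)

lemma finiteLength_of_isZero {X : A} (h : IsZero X) : finiteLength A X := by
  have := Subobject.subsingleton_of_isZero h
  exact (finiteLength_iff _).2 ⟨inferInstance, inferInstance⟩

lemma finiteLength_of_mono {X Y : A} (f : X ⟶ Y) [Mono f] (h : finiteLength A Y) :
    finiteLength A X :=
  finiteLength_of_exact (S := ShortComplex.mk (0 : (0 : A) ⟶ X) f zero_comp)
    ((ShortComplex.exact_iff_mono _ rfl).2 ‹_›) (finiteLength_of_isZero (isZero_zero A)) h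

/-- Taking preimages under an epimorphism is strictly monotone, because the preimage of `N'` still
maps onto `N'`. -/
lemma finiteLength_of_epi {X Y : A} (f : X ⟶ Y) [Epi f] (h : finiteLength A X) :
    finiteLength A Y := by
  obtain ⟨_, _⟩ := (finiteLength_iff _).1 h
  refine finiteLength_of_strictMono (Subobject.pullback f).obj ?_
  intro N N' hN
  refine lt_of_le_not_ge ((Subobject.pullback f).monotone hN.le) fun h' => hN.not_ge ?_
  have hepi : Epi (Subobject.pullbackπ f N') := by
    exact Abelian.epi_fst_of_isLimit _ _ (Subobject.isPullback f N').isLimit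
  have hfac : Subobject.ofLE _ _ h' ≫ Subobject.pullbackπ f N ≫ Subobject.ofLE N N' hN.le =
      Subobject.pullbackπ f N' := by
    rw [← cancel_mono N'.arrow]
    simp only [Category.assoc, Subobject.ofLE_arrow]
    rw [(Subobject.isPullback f N).w, (Subobject.isPullback f N').w, Subobject.ofLE_arrow_assoc]
  have : Epi (Subobject.ofLE N N' hN.le) := by
    rw [← Category.assoc] at hfac
    exact epi_of_epi_fac hfac
  have := isIso_of_mono_of_epi (Subobject.ofLE N N' hN.le)
  exact Subobject.le_of_comm (inv (Subobject.ofLE N N' hN.le)) (by simp)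

/-- This and the following closure properties make the full subcategory of objects of finite length
abelian, with exact inclusion. -/
instance : (finiteLength A).ContainsZero where
  exists_zero := ⟨0, isZero_zero A, finiteLength_of_isZero (isZero_zero A)⟩

instance : (finiteLength A).IsClosedUnderKernels where
  kernels_le := by
    rintro _ ⟨f, k, hk, hX, -⟩
    have : Mono k.ι := mono_of_isLimit_fork hk
    exact finiteLength_of_mono k.ι hX

instance : (finiteLength A).IsClosedUnderCokernels where
  cokernels_le := by
    rintro _ ⟨f, k, hk, -, hY⟩
    have : Epi k.π := epi_of_isColimit_cofork hk
    exact finiteLength_of_epi k.π hY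

instance : (finiteLength A).IsClosedUnderIsomorphisms where
  of_iso e h := finiteLength_of_mono e.inv h

lemma finiteLength_biprod {X Y : A} (hX : finiteLength A X) (hY : finiteLength A Y) :
    finiteLength A (X ⊞ Y) :=
  finiteLength_of_exact (S := ShortComplex.mk (biprod.inl : X ⟶ X ⊞ Y) biprod.snd (by simp))
    (ShortComplex.Splitting.mk biprod.fst biprod.inr (by simp) (by simp) (by simp)).exact hX hY

instance : (finiteLength A).IsClosedUnderBinaryProducts where
  limitsOfShape_le := by
    rintro X ⟨p⟩
    have e : X ≅ p.diag.obj ⟨.left⟩ ⊞ p.diag.obj ⟨.right⟩ :=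
      (p.isLimit.conePointUniqueUpToIso (limit.isLimit _)) ≪≫
        HasLimit.isoOfNatIso (diagramIsoPair _) ≪≫ (biprod.isoProd _ _).symm
    exact (finiteLength A).prop_of_iso e.symm
      (finiteLength_biprod (p.prop_diag_obj _) (p.prop_diag_obj _))

instance : (finiteLength A).IsClosedUnderFiniteProducts :=
  ObjectProperty.IsClosedUnderFiniteProducts.mk'

end FiniteLength

/-! ### The free module functor is left adjoint to the forgetful functor -/

section FreeModule

variable {F F' : Type v} [Field F] [Field F'] [Algebra F F'] {B : Type u}
  [Category.{v} B] [Preadditive B] [Linear F B] [HasCoproducts.{v} B]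

variable (F F') in
/-- The morphism `X ⟶ F' ⊗ X` given by an element of `F'`. -/
def freeMk (X : B) (a : F') : X ⟶ ((freeModule F F').obj X).carrier := extTensorMk F F' X a

variable (F F') in
/-- The unit `X ⟶ F' ⊗ X`. -/
def freeUnit (X : B) : X ⟶ ((freeModule F F').obj X).carrier := freeMk F F' X 1

lemma freeMk_smulHom (X : B) (a b : F') :
    freeMk F F' X b ≫ ((freeModule F F').obj X).smulHom a = freeMk F F' X (a * b) :=
  extTensorMk_mul X a b

lemma freeUnit_smulHom (X : B) (a : F') :
    freeUnit F F' X ≫ ((freeModule F F').obj X).smulHom a = freeMk F F' X a := by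
  rw [freeUnit, freeMk_smulHom, mul_one]

lemma freeMk_algebraMap (X : B) (r : F) :
    freeMk F F' X (algebraMap F F' r) = r • freeUnit F F' X := by
  rw [Algebra.algebraMap_eq_smul_one]
  exact map_smul (extTensorMk F F' X) r 1

lemma free_carrier_ext {X Y : B} {f g : ((freeModule F F').obj X).carrier ⟶ Y}
    (h : ∀ a, freeMk F F' X a ≫ f = freeMk F F' X a ≫ g) : f = g :=
  extTensor_hom_ext h

/-- The homomorphism `F' ⊗ X ⟶ M` induced by a morphism `X ⟶ M`, on carriers. -/
def freeLiftHom {X : B} {M : LinModule F F' B} (f : X ⟶ M.carrier) :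
    ((freeModule F F').obj X).carrier ⟶ M.carrier :=
  extTensorDesc
    { toFun := fun a => f ≫ M.smulHom a
      map_add' := fun a b => by rw [M.smulHom_add, Preadditive.comp_add]
      map_smul' := fun r a => by
        rw [Algebra.smul_def, M.smulHom_mul, M.smulHom_algebraMap]
        simp }

lemma freeMk_liftHom {X : B} {M : LinModule F F' B} (f : X ⟶ M.carrier) (a : F') :
    freeMk F F' X a ≫ freeLiftHom f = f ≫ M.smulHom a :=
  extTensorMk_desc _ _

/-- The homomorphism `F' ⊗ X ⟶ M` induced by a morphism `X ⟶ M`. -/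
def freeLift {X : B} {M : LinModule F F' B} (f : X ⟶ M.carrier) :
    (freeModule F F').obj X ⟶ M where
  hom := freeLiftHom f
  comm a := free_carrier_ext fun b => by
    rw [← Category.assoc, freeMk_smulHom, freeMk_liftHom, ← Category.assoc, freeMk_liftHom,
      Category.assoc, ← M.smulHom_mul, mul_comm]

lemma freeUnit_lift {X : B} {M : LinModule F F' B} (f : X ⟶ M.carrier) :
    freeUnit F F' X ≫ (freeLift f).hom = f := by
  refine (freeMk_liftHom _ _).trans ?_
  rw [M.smulHom_one, Category.comp_id]

lemma free_hom_ext {X : B} {M : LinModule F F' B} {g h : (freeModule F F').obj X ⟶ M}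
    (e : freeUnit F F' X ≫ g.hom = freeUnit F F' X ≫ h.hom) : g = h := by
  refine LinModule.hom_ext (free_carrier_ext fun a => ?_)
  rw [← freeUnit_smulHom, Category.assoc, Category.assoc, g.comm, h.comm, reassoc_of% e]

lemma freeUnit_map {X Y : B} (f : X ⟶ Y) :
    freeUnit F F' X ≫ ((freeModule F F').map f).hom = f ≫ freeUnit F F' Y :=
  extTensorMk_map f 1

lemma smul_hom {M N : LinModule F F' B} (a : F') (f : M ⟶ N) :
    (a • f).hom = M.smulHom a ≫ f.hom := rfl

lemma freeUnit_smul_map {X Y : B} (a : F') (f : X ⟶ Y) :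
    freeUnit F F' X ≫ (a • (freeModule F F').map f).hom = f ≫ freeMk F F' Y a := by
  rw [smul_hom, ((freeModule F F').map f).comm,
    reassoc_of% freeUnit_map (F := F) (F' := F') f, freeUnit_smulHom]

instance : (freeModule F F' (B := B)).Additive where
  map_add {X Y f g} := free_hom_ext (by
    rw [freeUnit_map, LinModule.add_hom, Preadditive.comp_add, freeUnit_map, freeUnit_map,
      Preadditive.add_comp])

lemma freeModule_map_smul {X Y : B} (r : F) (f : X ⟶ Y) :
    (freeModule F F').map (r • f) = algebraMap F F' r • (freeModule F F').map f :=
  free_hom_ext (by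
    rw [freeUnit_smul_map, freeUnit_map, freeMk_algebraMap, Linear.smul_comp, Linear.comp_smul])

/-- The free module functor is left adjoint to the forgetful functor. -/
def freeForgetAdj : freeModule F F' (B := B) ⊣ LinModule.forget :=
  Adjunction.mkOfHomEquiv
    { homEquiv := fun X M =>
        { toFun := fun g => freeUnit F F' X ≫ g.hom
          invFun := fun f => freeLift f
          left_inv := fun g => free_hom_ext (freeUnit_lift _)
          right_inv := fun f => freeUnit_lift f }
      homEquiv_naturality_left_symm := fun {X X' M} f (g : X' ⟶ M.carrier) => free_hom_ext (by
        change freeUnit F F' _ ≫ (freeLift (f ≫ g)).hom = freeUnit F F' _ ≫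
          ((freeModule F F').map f ≫ freeLift g).hom
        rw [freeUnit_lift, LinModule.comp_hom,
          reassoc_of% freeUnit_map (F := F) (F' := F') f, freeUnit_lift])
      homEquiv_naturality_right := fun f g => (Category.assoc _ _ _).symm }

lemma extTensorMap_eq {X Y : B} (f : X ⟶ Y) :
    extTensorMap F F' f = Limits.Sigma.map (fun _ => f) :=
  Sigma.hom_ext _ _ fun i => by
    exact ((congrArg (· ≫ extTensorMap F F' f) (extTensorMk_basis X i).symm).trans
      (extTensorMk_map f _)).trans ((congrArg (f ≫ ·) (extTensorMk_basis Y i)).trans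
        (Limits.Sigma.ι_map (fun _ => f) i).symm)

end FreeModule

/-! ### Ind-objects of a small abelian category -/

section Ind

variable {T : Type v} [SmallCategory T] [Abelian T]

/-- A morphism from an object of `T` to a filtered colimit of ind-objects factors through one of
them. -/
lemma ind_exists_hom_of_isColimit {J : Type v} [SmallCategory J] [IsFiltered J] {D : J ⥤ Ind T}
    {c : Cocone D} (hc : IsColimit c) {Z : T} (f : Ind.yoneda.obj Z ⟶ c.pt) :
    ∃ (j : J) (g : Ind.yoneda.obj Z ⟶ D.obj j), g ≫ c.ι.app j = f := by
  let G : Ind T ⥤ Type v := Ind.inclusion T ⋙ (evaluation _ _).obj (Opposite.op Z)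
  -- Filtered colimits of ind-objects are computed pointwise as presheaves, and evaluation at `Z` is
  -- `Hom(Z, -)` by Yoneda.
  have hG : IsColimit (G.mapCocone c) := isColimitOfPreserves G hc
  let q : yoneda.obj Z ⟶ (Ind.inclusion T).obj c.pt :=
    Ind.yonedaCompInclusion.inv.app Z ≫ (Ind.inclusion T).map f
  obtain ⟨j, y, hy⟩ := Types.jointly_surjective _ hG (yonedaEquiv q)
  let q' : yoneda.obj Z ⟶ (Ind.inclusion T).obj (D.obj j) := yonedaEquiv.symm y
  have hq : q' ≫ (Ind.inclusion T).map (c.ι.app j) = q := by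
    apply yonedaEquiv.injective
    rw [yonedaEquiv_comp, ← hy]
    simp [q', G]
  refine ⟨j, Ind.inclusion.fullyFaithful.preimage (Ind.yonedaCompInclusion.hom.app Z ≫ q'), ?_⟩
  apply (Ind.inclusion T).map_injective
  rw [Functor.map_comp, Ind.inclusion.fullyFaithful.map_preimage, Category.assoc, hq]
  simp [q]

/-- A morphism from an object of `T` to a coproduct of ind-objects is a finite sum. -/
lemma ind_exists_sum {J : Type v} (Y : J → Ind T) {Z : T} (f : Ind.yoneda.obj Z ⟶ ∐ Y) :
    ∃ (S : Finset J) (g : ∀ j, Ind.yoneda.obj Z ⟶ Y j), f = ∑ j ∈ S, g j ≫ Sigma.ι Y j := by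
  classical
  -- A coproduct is the filtered colimit of its finite subcoproducts, so `f` factors through one of
  -- them. Decomposing the identity of that finite coproduct then writes `f` as a sum.
  obtain ⟨S, g, hg⟩ := ind_exists_hom_of_isColimit
    (CoproductsFromFiniteFiltered.isColimitFiniteSubproductsCocone Y) f
  let g' : Ind.yoneda.obj Z ⟶ ∐ fun x : S => Y x.1.as := g
  have hg' : g' ≫ Sigma.desc (fun x : S => Sigma.ι Y x.1.as) = f := hg
  have hid : 𝟙 (∐ fun x : S => Y x.1.as) = ∑ x : S,
      (Sigma.desc fun y : S => if h : y = x then eqToHom (by rw [h]) else 0) ≫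
        Sigma.ι (fun x : S => Y x.1.as) x := by
    refine Sigma.hom_ext _ _ fun y => ?_
    rw [Preadditive.comp_sum, Finset.sum_eq_single y]
    · simp
    · intro x _ hx
      simp [Ne.symm hx]
    · simp
  refine ⟨S.image Discrete.as, fun j => if h : (⟨j⟩ : Discrete J) ∈ S then
    g' ≫ Sigma.desc (fun y : S => if h' : y = ⟨⟨j⟩, h⟩ then eqToHom (by rw [h']) else 0) else 0, ?_⟩
  have hf : f = g' ≫ 𝟙 _ ≫ Sigma.desc (fun x : S => Sigma.ι Y x.1.as) := by
    rw [Category.id_comp, hg']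
  rw [hid, Preadditive.sum_comp, Preadditive.comp_sum] at hf
  rw [hf, Finset.sum_image (fun x _ y _ h => Discrete.ext h), ← Finset.sum_coe_sort S]
  refine Finset.sum_congr rfl fun x _ => ?_
  simp

/-- Epimorphisms onto an object of `T` are refined by epimorphisms in `T`. -/
lemma ind_exists_lift {X : T} [IsNoetherianObject X] {P : Ind T} (p : P ⟶ Ind.yoneda.obj X) [Epi p] :
    ∃ (X' : T) (q : X' ⟶ X) (_ : Epi q) (l : Ind.yoneda.obj X' ⟶ P), l ≫ p = Ind.yoneda.map q := by
  -- The images in `X` of morphisms of `T` that lift to `P` have a maximal member, since `X` is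
  -- noetherian. By maximality every morphism from an object of `T` to `X` that lifts to `P` lands
  -- in it. So the cokernel of `q` is killed by `p`, and it vanishes since `p` is an epimorphism.
  let s : Set (Subobject X) := {N | ∃ (X' : T) (q : X' ⟶ X) (l : Ind.yoneda.obj X' ⟶ P),
    l ≫ p = Ind.yoneda.map q ∧ imageSubobject q = N}
  have hs : s.Nonempty := ⟨_, (X : T), 0, 0, by simp, rfl⟩
  obtain ⟨N, ⟨X', q, l, hl, rfl⟩, hmax⟩ := WellFounded.has_min
    (inferInstance : WellFoundedGT (Subobject X)).wf s hs
  refine ⟨X', q, ?_, l, hl⟩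
  have key : ∀ {Z : T} (z : Ind.yoneda.obj Z ⟶ P), z ≫ p ≫ Ind.yoneda.map (cokernel.π q) = 0 := by
    intro Z z
    let r : Z ⟶ X := Ind.yoneda.preimage (z ≫ p)
    have hr : Ind.yoneda.map r = z ≫ p := Ind.yoneda.map_preimage _
    let l' : Ind.yoneda.obj (X' ⊞ Z) ⟶ P :=
      Ind.yoneda.map biprod.fst ≫ l + Ind.yoneda.map biprod.snd ≫ z
    have hl' : l' ≫ p = Ind.yoneda.map (biprod.desc q r) := by
      rw [biprod.desc_eq, Functor.map_add, Functor.map_comp, Functor.map_comp, hr, ← hl]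
      simp [l']
    have hle : imageSubobject q ≤ imageSubobject (biprod.desc q r) := by
      conv_lhs => rw [← biprod.inl_desc q r]
      exact imageSubobject_comp_le _ _
    have heq : imageSubobject q = imageSubobject (biprod.desc q r) := by
      by_contra hne
      exact hmax _ ⟨_, _, l', hl', rfl⟩ (gt_iff_lt.2 (lt_of_le_of_ne hle hne))
    have hfac : (imageSubobject q).Factors r := by
      rw [heq]
      simpa using imageSubobject_factors_comp_self (f := biprod.desc q r) biprod.inr
    rw [← Category.assoc, ← hr, ← Functor.map_comp, ← Subobject.factorThru_arrow _ _ hfac,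
      Category.assoc]
    have : (imageSubobject q).arrow ≫ cokernel.π q = 0 := by
      rw [← cancel_epi (factorThruImageSubobject q)]
      simp
    rw [this]
    simp
  have h0 : p ≫ Ind.yoneda.map (cokernel.π q) = 0 := ind_hom_ext fun Z z => by
    rw [key, comp_zero]
  have h1 : Ind.yoneda.map (cokernel.π q) = 0 := by
    rw [← cancel_epi p, h0, comp_zero]
  exact Preadditive.epi_of_cokernel_zero (Ind.yoneda.map_injective (by rw [h1, Functor.map_zero]))

end Ind

/-! ### Exactness, morphisms and lifting for `X ↦ F' ⊗ X` -/

section ExtFunctor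

variable {F F' T : Type v} [Field F] [Field F'] [Algebra F F'] [SmallCategory T] [Abelian T]
  [Linear F T]

instance : (extFunctor F F' T).Additive :=
  inferInstanceAs (Ind.yoneda ⋙ freeModule F F').Additive

lemma extFunctor_map_smul {X Y : T} (r : F) (f : X ⟶ Y) :
    (extFunctor F F' T).map (r • f) = algebraMap F F' r • (extFunctor F F' T).map f := by
  change (freeModule F F').map (Ind.yoneda.map (r • f)) = _
  rw [Functor.map_smul, freeModule_map_smul]
  rfl

instance : PreservesFiniteColimits (extFunctor F F' T) :=
  have : PreservesColimits (freeModule F F' (B := Ind T)) := freeForgetAdj.leftAdjoint_preservesColimits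
  inferInstanceAs (PreservesFiniteColimits (Ind.yoneda ⋙ freeModule F F'))

/-- On underlying objects `F' ⊗ f` is a direct sum of copies of `f`, and direct sums in `Ind T`
preserve monomorphisms. Together with right exactness this gives the left exactness below. -/
instance : (extFunctor F F' T).PreservesMonomorphisms where
  preserves {X Y} f _ := by
    have : Mono (Limits.Sigma.map fun (_ : Module.Basis.ofVectorSpaceIndex F F') =>
      Ind.yoneda.map f) := inferInstance
    rw [← extTensorMap_eq] at this
    exact (LinModule.forget (F := F) (F' := F') (B := Ind T)).mono_of_mono_map this

instance : PreservesFiniteLimits (extFunctor F F' T) := by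
  have h := ((extFunctor F F' T).exact_tfae.out 0 3).1 fun S hS => by
    have e := (extFunctor F F' T).preservesFiniteColimits_tfae.out 3 0
    have h1 : (S.map (extFunctor F F' T)).Exact := (e.1 inferInstance S hS).1
    have := hS.mono_f
    have := hS.epi_g
    exact { exact := h1, mono_f := inferInstanceAs (Mono ((extFunctor F F' T).map S.f)), epi_g := inferInstanceAs (Epi ((extFunctor F F' T).map S.g)) }
  exact h.1

lemma exists_dual_basis {F V : Type*} [Field F] [AddCommGroup V] [Module F V] {n : ℕ}
    {a : Fin n → V} (ha : LinearIndependent F a) (i : Fin n) :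
    ∃ l : V →ₗ[F] F, ∀ j, l (a j) = if i = j then 1 else 0 := by
  obtain ⟨g, hg⟩ := (Fintype.linearCombination F a).exists_leftInverse_of_injective
    (by rwa [LinearMap.ker_eq_bot, ← linearIndependent_iff_injective_fintypeLinearCombination])
  refine ⟨LinearMap.proj i ∘ₗ g, fun j => ?_⟩
  have := congrFun (LinearMap.congr_fun hg (Pi.single j 1)) i
  simpa [Fintype.linearCombination_apply_single, Pi.single_apply] using this

lemma freeUnit_sum_smul_map {X Y : T} {n : ℕ} (a : Fin n → F') (f : Fin n → (X ⟶ Y)) :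
    freeUnit F F' (Ind.yoneda.obj X) ≫
      (∑ i, a i • (extFunctor F F' T).map (f i) :
        (extFunctor F F' T).obj X ⟶ (extFunctor F F' T).obj Y).hom =
      ∑ i, Ind.yoneda.map (f i) ≫ freeMk F F' (Ind.yoneda.obj Y) (a i) := by
  have h : (∑ i, a i • (extFunctor F F' T).map (f i) :
        (extFunctor F F' T).obj X ⟶ (extFunctor F F' T).obj Y).hom =
      ∑ i, (a i • (extFunctor F F' T).map (f i) :
        (extFunctor F F' T).obj X ⟶ (extFunctor F F' T).obj Y).hom :=
    Functor.map_sum LinModule.forget _ _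
  exact (congrArg (freeUnit F F' _ ≫ ·) h).trans ((Preadditive.comp_sum _ _ _).trans
    (Finset.sum_congr rfl fun i _ => freeUnit_smul_map (a i) (Ind.yoneda.map (f i))))

/-- Morphisms between free modules come from scalars and morphisms of `T`. -/
lemma extFunctor_exists_sum {X Y : T} (g : (extFunctor F F' T).obj X ⟶ (extFunctor F F' T).obj Y) :
    ∃ (n : ℕ) (a : Fin n → F') (f : Fin n → (X ⟶ Y)),
      g = ∑ i, a i • (extFunctor F F' T).map (f i) := by
  -- The morphism adjoint to `g` goes to a direct sum of copies of `Y` indexed by a basis of `F'`,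
  -- so it is a finite sum. The basis elements occurring in it are the scalars.
  let u : Ind.yoneda.obj X ⟶
    ∐ fun _ : Module.Basis.ofVectorSpaceIndex F F' => Ind.yoneda.obj Y :=
    freeUnit F F' (Ind.yoneda.obj X) ≫ g.hom
  obtain ⟨S, h, hu⟩ := ind_exists_sum _ u
  let e := S.equivFin.symm
  refine ⟨_, fun i => Module.Basis.ofVectorSpace F F' (e i), fun i => Ind.yoneda.preimage (h (e i)),
    free_hom_ext ?_⟩
  refine Eq.trans ?_ (freeUnit_sum_smul_map _ _).symm
  refine hu.trans ?_
  rw [← Finset.sum_coe_sort S, ← e.sum_comp]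
  refine Finset.sum_congr rfl fun i _ => ?_
  rw [Functor.map_preimage]
  exact congrArg (h (e i) ≫ ·) (extTensorMk_basis _ _).symm

/-- A functional `l` on `F'` dual to `a i` induces a morphism `F' ⊗ Y ⟶ Y` that extracts `f i` from
the sum. With `extFunctor_exists_sum` this identifies the morphisms of free modules with `F' ⊗
Hom(X, Y)`. -/
lemma extFunctor_eq_zero {X Y : T} {n : ℕ} {a : Fin n → F'} (ha : LinearIndependent F a)
    (f : Fin n → (X ⟶ Y)) (h : ∑ i, a i • (extFunctor F F' T).map (f i) = 0) (i : Fin n) :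
    f i = 0 := by
  obtain ⟨l, hl⟩ := exists_dual_basis ha i
  let d : ((freeModule F F').obj (Ind.yoneda.obj Y)).carrier ⟶ Ind.yoneda.obj Y :=
    extTensorDesc (l.smulRight (𝟙 (Ind.yoneda.obj Y)))
  have hd : ∀ b, freeMk F F' (Ind.yoneda.obj Y) b ≫ d = l b • 𝟙 (Ind.yoneda.obj Y) :=
    fun b => extTensorMk_desc _ _
  have h1 : (0 : Ind.yoneda.obj X ⟶ ((freeModule F F').obj (Ind.yoneda.obj Y)).carrier) =
      ∑ i, Ind.yoneda.map (f i) ≫ freeMk F F' (Ind.yoneda.obj Y) (a i) := by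
    rw [← freeUnit_sum_smul_map, h]
    exact comp_zero.symm
  have h2 := congrArg (· ≫ d) h1
  simp only [zero_comp, Preadditive.sum_comp, Category.assoc,
    hd, hl] at h2
  rw [Finset.sum_eq_single i (fun j _ hj => by simp [Ne.symm hj]) (by simp)] at h2
  apply Ind.yoneda.map_injective
  simpa using h2.symm

/-- Epimorphisms onto free modules are refined by epimorphisms in `T`. -/
lemma extFunctor_exists_lift {X : T} [IsNoetherianObject X] {M : LinModule F F' (Ind T)}
    (p : M ⟶ (extFunctor F F' T).obj X) [Epi p] :
    ∃ (X' : T) (q : X' ⟶ X) (_ : Epi q) (l : (extFunctor F F' T).obj X' ⟶ M),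
      l ≫ p = (extFunctor F F' T).map q := by
  let p' : M ⟶ (freeModule F F').obj (Ind.yoneda.obj X) := p
  have : Epi p' := ‹Epi p›
  -- The pullback of `p` along the unit `X ⟶ F' ⊗ X` is an epimorphism of ind-objects onto `X`. A
  -- lift to this pullback becomes a module homomorphism by freeness.
  obtain ⟨X', q, hq, l, hl⟩ := ind_exists_lift
    (pullback.snd p'.hom (freeUnit F F' (Ind.yoneda.obj X)))
  refine ⟨X', q, hq, freeLift (l ≫ pullback.fst _ _), free_hom_ext ?_⟩
  refine Eq.trans ?_ (freeUnit_map (Ind.yoneda.map q)).symm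
  change freeUnit F F' _ ≫ (freeLift _).hom ≫ p'.hom = _
  rw [← Category.assoc, freeUnit_lift, Category.assoc]
  exact (congrArg (l ≫ ·) pullback.condition).trans (by rw [reassoc_of% hl])

/-- Morphisms `F' ⊗ X ⟶ M` are jointly epimorphic. -/
lemma extFunctor_hom_ext {M N : LinModule F F' (Ind T)} {f g : M ⟶ N}
    (h : ∀ (X : T) (x : (extFunctor F F' T).obj X ⟶ M), x ≫ f = x ≫ g) : f = g := by
  refine LinModule.hom_ext (ind_hom_ext fun Z p => ?_)
  have := congrArg (fun k => freeUnit F F' _ ≫ k.hom) (h Z (freeLift p))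
  calc p ≫ f.hom = (freeUnit F F' _ ≫ (freeLift p).hom) ≫ f.hom := by rw [freeUnit_lift]
    _ = (freeUnit F F' _ ≫ (freeLift p).hom) ≫ g.hom := by
      rw [Category.assoc, Category.assoc]
      exact this
    _ = p ≫ g.hom := by rw [freeUnit_lift]

end ExtFunctor

/-! ### Finite length of free modules -/

section Powers

open ZeroObject

variable {T : Type u} [Category.{v} T] [Abelian T]

/-- Finite direct sums of copies of `X`. -/
inductive IsPower (X : T) : T → Prop
  | zero : IsPower X 0
  | succ {Q : T} : IsPower X Q → IsPower X (Q ⊞ X)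

/-- Only the inclusions of the summands `X` into `Q` need to be tested; quantifying over all `x : X
⟶ Q` avoids naming them. -/
lemma IsPower.eq_zero {C : Type*} [Category* C] [Preadditive C] (t : T ⥤ C) [t.Additive] {X Q : T}
    (hQ : IsPower X Q) {M : C} (f : t.obj Q ⟶ M) (h : ∀ x : X ⟶ Q, t.map x ≫ f = 0) : f = 0 := by
  induction hQ with
  | zero =>
    rw [← Category.id_comp f, ← t.map_id, (isZero_zero T).eq_of_src (𝟙 (0 : T)) 0, t.map_zero,
      zero_comp]
  | @succ Q _ ih =>
    have h1 : t.map (biprod.inl : Q ⟶ Q ⊞ X) ≫ f = 0 := ih _ fun x => by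
      rw [← Category.assoc, ← t.map_comp, h]
    rw [← Category.id_comp f, ← t.map_id, ← biprod.total, t.map_add, Preadditive.add_comp,
      t.map_comp, t.map_comp, Category.assoc, Category.assoc, h1, h, comp_zero, comp_zero, add_zero]

/-- A finite family of morphisms to a simple object factors through an epimorphism onto a power of
that object. -/
lemma exists_epi_isPower {X : T} [Simple X] {Z : T} : ∀ {n : ℕ} (f : Fin n → (Z ⟶ X)),
    ∃ (Q : T) (_ : IsPower X Q) (u : Z ⟶ Q) (_ : Epi u) (m : Fin n → (Q ⟶ X)),
      ∀ i, f i = u ≫ m i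
  | 0, _ => ⟨0, .zero, 0, inferInstance, fun _ => 0, fun i => i.elim0⟩
  | n + 1, f => by
    obtain ⟨Q, hQ, u, _, m, hm⟩ := exists_epi_isPower (fun i : Fin n => f i.castSucc)
    -- If the last morphism kills the kernel of `u`, it factors through `u` and `Q` is kept.
    -- Otherwise it maps that kernel onto the simple object `X`, so `u` and the last morphism
    -- together map `Z` onto `Q ⊞ X`.
    by_cases hv : kernel.ι u ≫ f (Fin.last n) = 0
    · refine ⟨Q, hQ, u, ‹_›, Fin.snoc m (Abelian.epiDesc u _ hv), fun i => ?_⟩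
      induction i using Fin.lastCases with
      | last => simp [Abelian.comp_epiDesc]
      | cast i => simpa using hm i
    · have : Epi (kernel.ι u ≫ f (Fin.last n)) := epi_of_nonzero_to_simple hv
      refine ⟨Q ⊞ X, hQ.succ, biprod.lift u (f (Fin.last n)), ?_,
        Fin.snoc (fun i => biprod.fst ≫ m i) biprod.snd, fun i => ?_⟩
      · refine Preadditive.epi_of_cancel_zero _ fun {G} g hg => ?_
        have h2 : biprod.inr ≫ g = 0 := by
          rw [← cancel_epi (kernel.ι u ≫ f (Fin.last n)), comp_zero]
          have := kernel.ι u ≫= hg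
          rw [biprod.lift_eq] at this
          simpa using this
        have h1 : biprod.inl ≫ g = 0 := by
          rw [← cancel_epi u, comp_zero]
          rw [biprod.lift_eq] at hg
          simpa [h2] using hg
        exact biprod.hom_ext' _ _ (by simpa using h1) (by simpa using h2)
      · induction i using Fin.lastCases with
        | last => simp
        | cast i => simpa using hm i

lemma subobject_factors_iff {X Z : T} (N : Subobject X) (f : Z ⟶ X) :
    N.Factors f ↔ f ≫ cokernel.π N.arrow = 0 := by
  refine ⟨fun h => ?_, fun h => ?_⟩
  · rw [← N.factorThru_arrow f h, Category.assoc, cokernel.condition, comp_zero]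
  · exact (Subobject.factors_iff _ _).2 ⟨Abelian.monoLift N.arrow f h, Abelian.monoLift_comp _ _ h⟩

end Powers

/-! ### From simple objects to objects of finite length -/

section FiniteLengthFree

variable {F F' T : Type v} [Field F] [Field F'] [Algebra F F'] [SmallCategory T] [Abelian T]
  [Linear F T]

lemma extFunctor_end_finite (X : T) [Module.Finite F (End X)] :
    Module.Finite F' (End ((extFunctor F F' T).obj X)) := by
  obtain ⟨S, hS⟩ := Module.Finite.fg_top (R := F) (M := End X)
  classical
  refine ⟨⟨S.image (fun f => (extFunctor F F' T).map f), ?_⟩⟩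
  rw [Finset.coe_image, eq_top_iff]
  rintro g -
  have key : ∀ f : End X, (extFunctor F F' T).map f ∈
      Submodule.span F' ((fun f : End X => ((extFunctor F F' T).map f :
        End ((extFunctor F F' T).obj X))) '' (S : Set (End X))) := by
    intro f
    have hf : f ∈ Submodule.span F (S : Set (End X)) := by rw [hS]; trivial
    induction hf using Submodule.span_induction with
    | mem f hf => exact Submodule.subset_span ⟨f, hf, rfl⟩
    | zero => rw [Functor.map_zero]; exact Submodule.zero_mem _
    | add f g _ _ h1 h2 => rw [Functor.map_add]; exact Submodule.add_mem _ h1 h2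
    | smul r f _ h => rw [extFunctor_map_smul]; exact Submodule.smul_mem _ _ h
  obtain ⟨n, a, f, hg⟩ := extFunctor_exists_sum g
  rw [hg]
  exact Submodule.sum_mem _ fun i _ => Submodule.smul_mem _ _ (key (f i))

/-- The invariant of a subobject `N` of `tX` is the subspace of `End(tX)` of endomorphisms factoring
through `N`, inside a finite-dimensional `F'`-space. It determines inclusions: for `X` simple, any
`tZ ⟶ tX` factors through `t` of an epimorphism onto a power of `X`, so each subobject of `tX` is
generated by images of endomorphisms of `tX`. -/
lemma extFunctor_finiteLength_of_simple (X : T) [Simple X] [Module.Finite F (End X)] :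
    finiteLength _ ((extFunctor F F' T).obj X) := by
  have := extFunctor_end_finite (F := F) (F' := F') X
  let t := extFunctor F F' T
  let f : Subobject (t.obj X) → Submodule F' (t.obj X ⟶ t.obj X) := fun N =>
    { carrier := {h | h ≫ cokernel.π N.arrow = 0}
      zero_mem' := zero_comp
      add_mem' := fun {a b} ha hb => by
        change (a + b) ≫ _ = 0
        rw [Preadditive.add_comp, show a ≫ _ = 0 from ha, show b ≫ _ = 0 from hb, add_zero]
      smul_mem' := fun r a ha => by
        change (r • a) ≫ _ = 0
        rw [Linear.smul_comp, show a ≫ _ = 0 from ha, smul_zero] }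
  have : Module.Finite F' (t.obj X ⟶ t.obj X) := this
  refine finiteLength_of_strictMono f fun N N' h => ?_
  refine lt_of_le_not_ge (fun a ha => (subobject_factors_iff _ _).1
    (Subobject.factors_of_le _ h.le ((subobject_factors_iff _ _).2 ha))) fun hge => h.not_ge ?_
  suffices h0 : N'.arrow ≫ cokernel.π N.arrow = 0 from
    (Subobject.le_of_comm _ (Abelian.monoLift_comp _ _ h0))
  refine extFunctor_hom_ext fun Z z => ?_
  obtain ⟨n, a, g, hg⟩ := extFunctor_exists_sum (z ≫ N'.arrow)
  -- Since `t u` is an epimorphism, the induced `w : tQ ⟶ tX` also lands in `N'`. Its components `tX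
  -- ⟶ tX` then factor through `N'`, hence through `N`.
  obtain ⟨Q, hQ, u, _, m, hm⟩ := exists_epi_isPower g
  let w : t.obj Q ⟶ t.obj X := ∑ i, a i • t.map (m i)
  have hw : z ≫ N'.arrow = t.map u ≫ w := by
    rw [hg, Preadditive.comp_sum]
    refine Finset.sum_congr rfl fun i _ => ?_
    rw [hm i, Functor.map_comp, Linear.comp_smul]
  have hw' : w ≫ cokernel.π N'.arrow = 0 := by
    rw [← cancel_epi (t.map u), ← Category.assoc, ← hw, Category.assoc, cokernel.condition,
      comp_zero, comp_zero]
  have : w ≫ cokernel.π N.arrow = 0 := hQ.eq_zero t _ fun x => by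
    rw [← Category.assoc]
    refine hge ?_
    change (t.map x ≫ w) ≫ _ = 0
    rw [Category.assoc, hw', comp_zero]
  rw [reassoc_of% hw, this, comp_zero, comp_zero]

/-- If `X` has finite length, then so does `F' ⊗ X`. -/
lemma extFunctor_finiteLength (hT : IsFFinite F T) (X : T) :
    finiteLength _ ((extFunctor F F' T).obj X) := by
  let t := extFunctor F F' T
  -- Take `N` maximal with `tN` of finite length. If `N` is not all of `X`, the preimage `N'` of a
  -- simple subobject `Y` of the quotient is strictly larger, and `tN'` is an extension of `tY` by
  -- `tN`, contradicting maximality.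
  let s : Set (Subobject X) := {N | finiteLength _ (t.obj (N : T))}
  have hs : s.Nonempty := ⟨⊥, finiteLength_of_isZero (by
    rw [IsZero.iff_id_eq_zero, ← t.map_id, (show 𝟙 ((⊥ : Subobject X) : T) = 0 from by
      rw [← cancel_mono (⊥ : Subobject X).arrow]; simp), t.map_zero])⟩
  have hX := hT.finite_length X
  obtain ⟨_, _⟩ := (finiteLength_iff _).1 hX
  obtain ⟨N, hN, hmax⟩ := WellFounded.has_min
    (inferInstance : WellFoundedGT (Subobject X)).wf s hs
  by_cases hπ : cokernel.π N.arrow = 0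
  · have := Preadditive.epi_of_cokernel_zero hπ
    exact finiteLength_of_epi (t.map N.arrow) hN
  exfalso
  have hnz : ¬ IsZero (cokernel N.arrow) := fun h => hπ (h.eq_of_tgt _ _)
  have := (hT.finite_length (cokernel N.arrow)).2
  obtain ⟨Y, hY⟩ := exists_simple_subobject hnz
  have := hT.finite_end (Y : T)
  let N' := (Subobject.pullback (cokernel.π N.arrow)).obj Y
  let g : (N' : T) ⟶ Y := Subobject.pullbackπ _ _
  have hg : g ≫ Y.arrow = N'.arrow ≫ cokernel.π N.arrow := (Subobject.isPullback _ _).w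
  have hle : N ≤ N' := Subobject.le_of_comm
    ((Subobject.isPullback (cokernel.π N.arrow) Y).lift 0 N.arrow (by simp))
    (IsPullback.lift_snd _ _ _ _)
  have hepi : Epi g := Abelian.epi_fst_of_isLimit _ _ (Subobject.isPullback _ _).isLimit
  have hzero : Subobject.ofLE N N' hle ≫ g = 0 := by
    rw [← cancel_mono Y.arrow, Category.assoc, hg, Subobject.ofLE_arrow_assoc,
      cokernel.condition, zero_comp]
  have hexact : (ShortComplex.mk _ g hzero).Exact := by
    rw [ShortComplex.exact_iff_exact_up_to_refinements]
    intro Z z hz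
    have hz' : (z ≫ N'.arrow) ≫ cokernel.π N.arrow = 0 := by
      rw [Category.assoc, ← hg, reassoc_of% hz, zero_comp]
    refine ⟨Z, 𝟙 _, inferInstance, Abelian.monoLift N.arrow _ hz', ?_⟩
    rw [← cancel_mono N'.arrow]
    simp [Abelian.monoLift_comp]
  have hN' : N' ∈ s := finiteLength_of_exact (hexact.map t) hN
    (extFunctor_finiteLength_of_simple (Y : T))
  refine hmax N' hN' (lt_of_le_not_ge hle fun h => ?_)
  have : g ≫ Y.arrow = 0 := by
    rw [hg, ← subobject_factors_iff]
    exact Subobject.factors_of_le _ h (Subobject.factors_self _)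
  have hY0 : Y.arrow = 0 := by rw [← cancel_epi g, this, comp_zero]
  apply Simple.not_isZero (Y : T)
  rw [IsZero.iff_id_eq_zero, ← cancel_mono Y.arrow, hY0, comp_zero, comp_zero]

end FiniteLengthFree

/-! ### The properties of the scalar extension functor -/

/-- The properties of the functor from `T` to its scalar extension which determine the scalar
extension. -/
structure IsScalarExtension (F : Type w) {F' : Type w} [Field F] [Field F'] [Algebra F F']
    {T : Type*} [Category.{v} T] [Abelian T] [Linear F T] {C : Type*} [Category.{v} C] [Abelian C]
    [Linear F' C] (t : T ⥤ C) : Prop where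
  additive : t.Additive
  map_smul : ∀ {X Y : T} (r : F) (f : X ⟶ Y), t.map (r • f) = algebraMap F F' r • t.map f
  preservesFiniteLimits : PreservesFiniteLimits t
  preservesFiniteColimits : PreservesFiniteColimits t
  exists_sum : ∀ {X Y : T} (g : t.obj X ⟶ t.obj Y),
    ∃ (n : ℕ) (a : Fin n → F') (f : Fin n → (X ⟶ Y)), g = ∑ i, a i • t.map (f i)
  eq_zero : ∀ {X Y : T} {n : ℕ} {a : Fin n → F'} (_ : LinearIndependent F a)
    (f : Fin n → (X ⟶ Y)) (_ : ∑ i, a i • t.map (f i) = 0) (i : Fin n), f i = 0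
  exists_cover : ∀ M : C, ∃ (X : T) (p : t.obj X ⟶ M), Epi p
  exists_lift : ∀ {X : T} {M : C} (p : M ⟶ t.obj X) (_ : Epi p),
    ∃ (X' : T) (q : X' ⟶ X) (_ : Epi q) (l : t.obj X' ⟶ M), l ≫ p = t.map q

section

variable {F F' T : Type v} [Field F] [Field F'] [Algebra F F'] [SmallCategory T] [Abelian T]
  [Linear F T]

instance (A : Type u) [Category.{v} A] [Abelian A] :
    PreservesFiniteLimits (finiteLength A).ι := by
  have := (finiteLength A).preservesKernels_ι
  exact Functor.preservesFiniteLimits_of_preservesKernels _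

instance (A : Type u) [Category.{v} A] [Abelian A] :
    PreservesFiniteColimits (finiteLength A).ι := by
  have := (finiteLength A).preservesCokernels_ι
  exact Functor.preservesFiniteColimits_of_preservesCokernels _

open ZeroObject in
/-- A finitely generated module is a quotient of a free module. -/
lemma exists_cover_of_noetherian (M : LinModule F F' (Ind T)) [IsNoetherianObject M] :
    ∃ (X : T) (p : (extFunctor F F' T).obj X ⟶ M), Epi p := by
  let t := extFunctor F F' T
  -- A maximal image of a free module contains the image of every other one, because two free
  -- modules can be added. Morphisms from free modules are jointly epimorphic, so this image is all
  -- of `M`.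
  let s : Set (Subobject M) := {N | ∃ (X : T) (p : t.obj X ⟶ M), imageSubobject p = N}
  obtain ⟨N, ⟨X, p, rfl⟩, hmax⟩ := WellFounded.has_min
    (inferInstance : WellFoundedGT (Subobject M)).wf s ⟨_, (0 : T), 0, rfl⟩
  refine ⟨X, p, Preadditive.epi_of_cokernel_zero (extFunctor_hom_ext fun Z z => ?_)⟩
  let l : t.obj (X ⊞ Z) ⟶ M := t.map biprod.fst ≫ p + t.map biprod.snd ≫ z
  have h1 : t.map biprod.inl ≫ l = p := by
    simp only [l, Preadditive.comp_add, ← Category.assoc, ← t.map_comp]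
    simp
  have h2 : t.map biprod.inr ≫ l = z := by
    simp only [l, Preadditive.comp_add, ← Category.assoc, ← t.map_comp]
    simp
  have hle : imageSubobject p ≤ imageSubobject l := by
    conv_lhs => rw [← h1]
    exact imageSubobject_comp_le _ _
  have heq : imageSubobject p = imageSubobject l := by
    by_contra hne
    exact hmax _ ⟨_, l, rfl⟩ (gt_iff_lt.2 (lt_of_le_of_ne hle hne))
  have hz : (imageSubobject p).Factors z := by
    rw [heq, ← h2]
    exact imageSubobject_factors_comp_self (f := l) _
  rw [← Subobject.factorThru_arrow _ _ hz, Category.assoc, comp_zero]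
  have : (imageSubobject p).arrow ≫ cokernel.π p = 0 := by
    rw [← cancel_epi (factorThruImageSubobject p)]
    simp
  rw [this, comp_zero]

/-- The inclusion of the modules of finite length is exact and fully faithful, so the properties
descend from `extFunctor`. From here on only these properties are used, not the realization by
ind-objects. -/
theorem isScalarExtension_scalarExtFunctor (hT : IsFFinite F T)
    (ht : ∀ X : T, finiteLength (LinModule F F' (Ind T)) ((extFunctor F F' T).obj X)) :
    IsScalarExtension F (F' := F') (scalarExtFunctor ht) where
  additive := { map_add := (finiteLength _).ι.map_injective (extFunctor F F' T).map_add }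
  map_smul r f := (finiteLength _).ι.map_injective (extFunctor_map_smul r f)
  preservesFiniteLimits :=
    have : PreservesFiniteLimits (scalarExtFunctor ht ⋙ (finiteLength _).ι) :=
      inferInstanceAs (PreservesFiniteLimits (extFunctor F F' T))
    ⟨fun J _ _ => preservesLimitsOfShape_of_reflects_of_preserves _ (finiteLength _).ι⟩
  preservesFiniteColimits :=
    have : PreservesFiniteColimits (scalarExtFunctor ht ⋙ (finiteLength _).ι) :=
      inferInstanceAs (PreservesFiniteColimits (extFunctor F F' T))
    ⟨fun J _ _ => preservesColimitsOfShape_of_reflects_of_preserves _ (finiteLength _).ι⟩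
  exists_sum {X Y} g := by
    obtain ⟨n, a, f, h⟩ := extFunctor_exists_sum ((finiteLength _).ι.map g)
    refine ⟨n, a, f, (finiteLength _).ι.map_injective ?_⟩
    rw [h, Functor.map_sum]
    rfl
  eq_zero {X Y n a} ha f h := by
    refine extFunctor_eq_zero ha f ?_
    have := congrArg (finiteLength _).ι.map h
    rw [Functor.map_sum, Functor.map_zero] at this
    exact this
  exists_cover M := by
    have : IsNoetherianObject ((finiteLength _).ι.obj M) := M.property.1
    obtain ⟨X, p, hp⟩ := exists_cover_of_noetherian ((finiteLength _).ι.obj M)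
    let p' : (scalarExtFunctor ht).obj X ⟶ M := (finiteLength _).ι.preimage p
    refine ⟨X, p', (finiteLength _).ι.epi_of_epi_map ?_⟩
    rwa [Functor.map_preimage]
  exists_lift {X M} p hp := by
    have := (hT.finite_length X).1
    have : Epi ((finiteLength _).ι.map p) := inferInstance
    obtain ⟨X', q, hq, l, h⟩ := extFunctor_exists_lift ((finiteLength _).ι.map p)
    let l' : (scalarExtFunctor ht).obj X' ⟶ M := (finiteLength _).ι.preimage l
    refine ⟨X', q, hq, l', (finiteLength _).ι.map_injective ?_⟩
    rw [Functor.map_comp, Functor.map_preimage, h]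
    rfl

end

/-! ### Morphisms between objects in the image of the scalar extension functor -/

namespace IsScalarExtension

open TensorProduct in
section

variable {F F' : Type w} [Field F] [Field F'] [Algebra F F']
  {T : Type*} [Category.{v} T] [Abelian T] [Linear F T] {C : Type*} [Category.{v} C] [Abelian C]
  [Linear F' C] {t : T ⥤ C} (h : IsScalarExtension F (F' := F') t)

-- Reduces an identity additive in a morphism between objects of the image to scalar multiples of
-- morphisms of `T`.
@[elab_as_elim]
theorem hom_induction (h : IsScalarExtension F (F' := F') t) {X Y : T} {P : (t.obj X ⟶ t.obj Y) → Prop}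
    (smul : ∀ (a : F') (f : X ⟶ Y), P (a • t.map f)) (add : ∀ f g, P f → P g → P (f + g))
    (g : t.obj X ⟶ t.obj Y) : P g := by
  obtain ⟨n, a, f, rfl⟩ := h.exists_sum g
  induction n with
  | zero => simpa using smul 0 0
  | succ n ih =>
    rw [Fin.sum_univ_succ]
    exact add _ _ (smul _ _) (ih _ _)

def tensorHomToHom (X Y : T) : F' ⊗[F] (X ⟶ Y) →+ (t.obj X ⟶ t.obj Y) :=
  TensorProduct.liftAddHom
    { toFun := fun a =>
        { toFun := fun f => a • t.map f
          map_zero' := by have := h.additive; simp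
          map_add' := fun f g => by have := h.additive; simp }
      map_zero' := by ext; simp
      map_add' := fun a b => by ext; simp [add_smul] }
    (fun r a f => by
      change (r • a) • t.map f = a • t.map (r • f)
      rw [h.map_smul, smul_smul, Algebra.smul_def, mul_comm])

/-- For injectivity, an element of the tensor product is expanded in a basis of `F'`; the linear
independence property `eq_zero` kills each coefficient. The inverse makes maps out of `Hom(tX, tY)`
well defined when prescribed on `a • t f`. -/
lemma tensorHomToHom_bijective (X Y : T) : Function.Bijective (h.tensorHomToHom X Y) := by
  constructor
  · classical
    rw [injective_iff_map_eq_zero]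
    intro x hx
    let b := Module.Basis.ofVectorSpace F F'
    obtain ⟨c, rfl⟩ : ∃ c : _ →₀ (X ⟶ Y), x = c.sum fun i f => b i ⊗ₜ f :=
      ⟨TensorProduct.equivFinsuppOfBasisLeft b x, by
        conv_lhs => rw [← (TensorProduct.equivFinsuppOfBasisLeft b).symm_apply_apply x]
        exact TensorProduct.equivFinsuppOfBasisLeft_symm_apply _ _⟩
    rw [Finsupp.sum, map_sum] at hx
    let e := c.support.equivFin.symm
    have hli : LinearIndependent F (fun i => b (e i)) :=
      b.linearIndependent.comp _ (Subtype.val_injective.comp e.injective)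
    have h0 := h.eq_zero hli (fun i => c (e i)) (by
      rw [← hx, ← Finset.sum_coe_sort c.support]
      exact Equiv.sum_comp e (fun i : c.support => (b i) • t.map (c i)))
    refine Finset.sum_eq_zero fun i hi => ?_
    have := h0 (e.symm ⟨i, hi⟩)
    rw [Equiv.apply_symm_apply] at this
    change b i ⊗ₜ c i = 0
    rw [show c i = 0 from this, TensorProduct.tmul_zero]
  · intro g
    refine h.hom_induction (fun a f => ⟨a ⊗ₜ f, rfl⟩) ?_ g
    rintro _ _ ⟨x, rfl⟩ ⟨y, rfl⟩
    exact ⟨x + y, map_add _ _ _⟩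

def homEquiv (X Y : T) : F' ⊗[F] (X ⟶ Y) ≃+ (t.obj X ⟶ t.obj Y) :=
  AddEquiv.ofBijective (h.tensorHomToHom X Y) (h.tensorHomToHom_bijective X Y)

lemma homEquiv_symm_smul {X Y : T} (a : F') (f : X ⟶ Y) :
    (h.homEquiv X Y).symm (a • t.map f) = a ⊗ₜ f :=
  (AddEquiv.symm_apply_eq _).2 rfl

variable [MonoidalCategory T] [MonoidalPreadditive T] [MonoidalLinear F T]

variable (F) in
def tensorHomBilin (A X B Y : T) : (A ⟶ X) →ₗ[F] (B ⟶ Y) →ₗ[F] (A ⊗ B ⟶ X ⊗ Y) :=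
  LinearMap.mk₂ F (fun f g => f ⊗ₘ g)
    (fun f f' g => by simp [MonoidalCategory.tensorHom_def])
    (fun r f g => by simp [MonoidalCategory.tensorHom_def])
    (fun f g g' => by simp [MonoidalCategory.tensorHom_def])
    (fun r f g => by simp [MonoidalCategory.tensorHom_def])

/-- The `F'`-bilinear extension of the tensor product of morphisms of `T`. -/
def box {A X B Y : T} (f : t.obj A ⟶ t.obj X) (g : t.obj B ⟶ t.obj Y) :
    t.obj (A ⊗ B) ⟶ t.obj (X ⊗ Y) :=
  h.homEquiv _ _ (TensorProduct.map₂ (LinearMap.mul F F') (tensorHomBilin F A X B Y)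
    ((h.homEquiv _ _).symm f) ((h.homEquiv _ _).symm g))

lemma box_smul_smul {A X B Y : T} (a b : F') (f : A ⟶ X) (g : B ⟶ Y) :
    h.box (a • t.map f) (b • t.map g) = (a * b) • t.map (f ⊗ₘ g) := by
  rw [box, homEquiv_symm_smul, homEquiv_symm_smul]
  rfl

lemma box_add {A X B Y : T} (f : t.obj A ⟶ t.obj X) (g g' : t.obj B ⟶ t.obj Y) :
    h.box f (g + g') = h.box f g + h.box f g' := by
  simp [box]

lemma add_box {A X B Y : T} (f f' : t.obj A ⟶ t.obj X) (g : t.obj B ⟶ t.obj Y) :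
    h.box (f + f') g = h.box f g + h.box f' g := by
  simp [box]

lemma box_map {A X B Y : T} (f : A ⟶ X) (g : B ⟶ Y) :
    h.box (t.map f) (t.map g) = t.map (f ⊗ₘ g) := by
  have := h.box_smul_smul 1 1 f g
  rwa [one_smul, one_smul, one_mul, one_smul] at this

/-- To prove an identity between biadditive expressions, it suffices to prove it for morphisms of
`T` and their scalar multiples. -/
lemma box_smul {A X B Y : T} (a : F') (f : t.obj A ⟶ t.obj X) (g : t.obj B ⟶ t.obj Y) :
    h.box f (a • g) = a • h.box f g := by
  refine h.hom_induction (fun b f => ?_) (fun f f' hf hf' => ?_) f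
  · refine h.hom_induction (fun c g => ?_) (fun g g' hg hg' => ?_) g
    · rw [smul_smul, box_smul_smul, box_smul_smul, smul_smul]
      congr 1
      ring
    · rw [smul_add, box_add, box_add, smul_add, hg, hg']
  · rw [add_box, add_box, hf, hf', smul_add]

lemma smul_box {A X B Y : T} (a : F') (f : t.obj A ⟶ t.obj X) (g : t.obj B ⟶ t.obj Y) :
    h.box (a • f) g = a • h.box f g := by
  refine h.hom_induction (fun b f => ?_) (fun f f' hf hf' => ?_) f
  · refine h.hom_induction (fun c g => ?_) (fun g g' hg hg' => ?_) g
    · rw [smul_smul, box_smul_smul, box_smul_smul, smul_smul]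
      congr 1
      ring
    · rw [box_add, box_add, smul_add, hg, hg']
  · rw [smul_add, add_box, add_box, hf, hf', smul_add]

lemma box_comp {A X X' B Y Y' : T} (f : t.obj A ⟶ t.obj X) (f' : t.obj X ⟶ t.obj X')
    (g : t.obj B ⟶ t.obj Y) (g' : t.obj Y ⟶ t.obj Y') :
    h.box (f ≫ f') (g ≫ g') = h.box f g ≫ h.box f' g' := by
  refine h.hom_induction (fun a f => ?_) (fun f₁ f₂ h₁ h₂ => ?_) f
  · refine h.hom_induction (fun b f' => ?_) (fun f₁ f₂ h₁ h₂ => ?_) f'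
    · refine h.hom_induction (fun c g => ?_) (fun f₁ f₂ h₁ h₂ => ?_) g
      · refine h.hom_induction (fun d g' => ?_) (fun f₁ f₂ h₁ h₂ => ?_) g'
        · simp only [Linear.smul_comp, Linear.comp_smul, ← t.map_comp, box_smul, smul_box,
            box_map, MonoidalCategory.tensorHom_comp_tensorHom]
          rw [smul_comm c b]
        · rw [Preadditive.comp_add, box_add, box_add, Preadditive.comp_add, h₁, h₂]
      · rw [Preadditive.add_comp, box_add, box_add, Preadditive.add_comp, h₁, h₂]
    · rw [Preadditive.comp_add, add_box, add_box, Preadditive.comp_add, h₁, h₂]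
  · rw [Preadditive.add_comp, add_box, add_box, Preadditive.add_comp, h₁, h₂]

@[simp]
lemma box_id (A B : T) : h.box (𝟙 (t.obj A)) (𝟙 (t.obj B)) = 𝟙 _ := by
  rw [← t.map_id, ← t.map_id, box_map, id_tensorHom_id, t.map_id]

@[simp]
lemma zero_box {A X B Y : T} (g : t.obj B ⟶ t.obj Y) :
    h.box (0 : t.obj A ⟶ t.obj X) g = 0 := by
  simp [box]

lemma box_associator {A X B Y D Z : T} (f : t.obj A ⟶ t.obj X) (g : t.obj B ⟶ t.obj Y)
    (k : t.obj D ⟶ t.obj Z) :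
    h.box (h.box f g) k ≫ t.map (α_ X Y Z).hom =
      t.map (α_ A B D).hom ≫ h.box f (h.box g k) := by
  refine h.hom_induction (fun a f => ?_) (fun f₁ f₂ h₁ h₂ => ?_) f
  · refine h.hom_induction (fun b g => ?_) (fun f₁ f₂ h₁ h₂ => ?_) g
    · refine h.hom_induction (fun c k => ?_) (fun f₁ f₂ h₁ h₂ => ?_) k
      · simp only [box_smul, smul_box, box_map, Linear.smul_comp, Linear.comp_smul,
          ← t.map_comp, associator_naturality]
      · simp only [box_add, Preadditive.add_comp, Preadditive.comp_add, h₁, h₂]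
    · simp only [box_add, add_box, Preadditive.add_comp, Preadditive.comp_add, h₁, h₂]
  · simp only [add_box, Preadditive.add_comp, Preadditive.comp_add, h₁, h₂]

lemma box_associator_inv {A X B Y D Z : T} (f : t.obj A ⟶ t.obj X) (g : t.obj B ⟶ t.obj Y)
    (k : t.obj D ⟶ t.obj Z) :
    h.box f (h.box g k) ≫ t.map (α_ X Y Z).inv =
      t.map (α_ A B D).inv ≫ h.box (h.box f g) k := by
  rw [← cancel_mono (t.map (α_ X Y Z).hom), Category.assoc, Category.assoc, h.box_associator,
    ← t.map_comp, Iso.inv_hom_id, ← Category.assoc, ← t.map_comp, Iso.inv_hom_id, t.map_id,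
    t.map_id, Category.comp_id, Category.id_comp]

lemma box_leftUnitor {B Y : T} (g : t.obj B ⟶ t.obj Y) :
    h.box (𝟙 (t.obj (𝟙_ T))) g ≫ t.map (λ_ Y).hom = t.map (λ_ B).hom ≫ g := by
  refine h.hom_induction (fun a g => ?_) (fun f₁ f₂ h₁ h₂ => ?_) g
  · rw [← t.map_id]
    simp only [box_smul, box_map, Linear.smul_comp, Linear.comp_smul, ← t.map_comp,
      id_tensorHom, leftUnitor_naturality]
  · simp only [box_add, Preadditive.add_comp, Preadditive.comp_add, h₁, h₂]

lemma box_braiding [BraidedCategory T] {A X B Y : T} (f : t.obj A ⟶ t.obj X)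
    (g : t.obj B ⟶ t.obj Y) :
    h.box f g ≫ t.map (β_ X Y).hom = t.map (β_ A B).hom ≫ h.box g f := by
  refine h.hom_induction (fun a f => ?_) (fun f₁ f₂ h₁ h₂ => ?_) f
  · refine h.hom_induction (fun b g => ?_) (fun f₁ f₂ h₁ h₂ => ?_) g
    · simp only [box_smul, smul_box, box_map, Linear.smul_comp, Linear.comp_smul,
          ← t.map_comp, BraidedCategory.braiding_naturality]
      rw [smul_comm]
    · simp only [box_add, add_box, Preadditive.add_comp, Preadditive.comp_add, h₁, h₂]
  · simp only [box_add, add_box, Preadditive.add_comp, Preadditive.comp_add, h₁, h₂]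

end

end IsScalarExtension

/-! ### Extending functors along the scalar extension functor -/

section Extension

variable {F F' : Type w} [Field F] [Field F'] [Algebra F F']
  {T : Type*} [Category.{v} T] [Abelian T] [Linear F T] {C : Type*} [Category.{v} C] [Abelian C]
  [Linear F' C] {t : T ⥤ C}

namespace IsScalarExtension

/-- The objects `tA` are projective up to refinement by epimorphisms of `T`. The lift is a lift of
`t q` to the pullback of `p` along `x`, which is an epimorphism onto `tA`. -/
lemma exists_lift_of_epi (h : IsScalarExtension F (F' := F') t) {B M : C} (p : B ⟶ M) [Epi p]
    {A : T} (x : t.obj A ⟶ M) :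
    ∃ (A' : T) (q : A' ⟶ A) (_ : Epi q) (l : t.obj A' ⟶ B), l ≫ p = t.map q ≫ x := by
  obtain ⟨A', q, hq, l, hl⟩ := h.exists_lift (pullback.snd p x) inferInstance
  exact ⟨A', q, hq, l ≫ pullback.fst p x, by
    rw [Category.assoc, pullback.condition, reassoc_of% hl]⟩

lemma exists_lift_of_exact (h : IsScalarExtension F (F' := F') t) {S : ShortComplex C}
    (hS : S.Exact) {A : T} (x : t.obj A ⟶ S.X₂) (hx : x ≫ S.g = 0) :
    ∃ (A' : T) (q : A' ⟶ A) (_ : Epi q) (l : t.obj A' ⟶ S.X₁), l ≫ S.f = t.map q ≫ x := by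
  have : Epi (kernel.lift S.g S.f S.zero) := hS.epi_kernelLift
  obtain ⟨A', q, hq, l, hl⟩ := h.exists_lift_of_epi (kernel.lift S.g S.f S.zero)
    (kernel.lift S.g x hx)
  refine ⟨A', q, hq, l, ?_⟩
  have := congrArg (· ≫ kernel.ι S.g) hl
  simpa using this

end IsScalarExtension

/-- A functor from the full subcategory of `C` on the objects of `T` which is right exact
on `T`. -/
structure ExtFun (t : T ⥤ C) (D : Type*) [Category* D] [Preadditive D] where
  obj : T → D
  map {A B : T} (f : t.obj A ⟶ t.obj B) : obj A ⟶ obj B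
  map_id (A : T) : map (𝟙 (t.obj A)) = 𝟙 _
  map_comp {A B A' : T} (f : t.obj A ⟶ t.obj B) (g : t.obj B ⟶ t.obj A') :
    map (f ≫ g) = map f ≫ map g
  map_add {A B : T} (f g : t.obj A ⟶ t.obj B) : map (f + g) = map f + map g
  epi_map {A B : T} (q : A ⟶ B) (_ : Epi q) : Epi (map (t.map q))
  exists_desc {A B : T} (q : A ⟶ B) (_ : Epi q) {P : D} (g : obj A ⟶ P)
    (_ : map (t.map (kernel.ι q)) ≫ g = 0) : ∃ g', map (t.map q) ≫ g' = g

variable {D : Type*} [Category* D] [Preadditive D]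

namespace ExtFun

lemma map_sub (H : ExtFun t D) {A B : T} (f g : t.obj A ⟶ t.obj B) :
    H.map (f - g) = H.map f - H.map g := by
  rw [eq_sub_iff_add_eq, ← H.map_add, sub_add_cancel]

/-- A natural family of maps `H A ⟶ P` indexed by the morphisms `t A ⟶ M`. -/
@[ext]
structure Family (H : ExtFun t D) (M : C) (P : D) where
  app {A : T} (x : t.obj A ⟶ M) : H.obj A ⟶ P
  naturality {A B : T} (f : t.obj A ⟶ t.obj B) (x : t.obj B ⟶ M) :
    app (f ≫ x) = H.map f ≫ app x

variable {H : ExtFun t D} {M : C} {P : D}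

/-- After composition with some `t q` every `x` factors through `e`, and `H` sends `t q` to an
epimorphism. -/
lemma Family.ext_of_epi (h : IsScalarExtension F (F' := F') t) {β γ : H.Family M P} {X : T}
    (e : t.obj X ⟶ M) [Epi e] (hβ : β.app e = γ.app e) : β = γ := by
  ext A x
  obtain ⟨A', q, hq, l, hl⟩ := h.exists_lift_of_epi e x
  have := H.epi_map q hq
  rw [← cancel_epi (H.map (t.map q)), ← β.naturality, ← γ.naturality, ← hl, β.naturality,
    γ.naturality, hβ]

lemma Family.app_eq_of_epi (h : IsScalarExtension F (F' := F') t) (β γ : H.Family M P) {X : T}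
    (e : t.obj X ⟶ M) [Epi e] (hβ : β.app e = γ.app e) {A : T} (x : t.obj A ⟶ M) :
    β.app x = γ.app x := by
  rw [Family.ext_of_epi h e hβ]

/-- The value at `x` is found by lifting `x` locally to `l` through `e` and descending `H(l) ≫ g`
along `q`; on the kernel of `q`, `l` lands in the kernel of `e`, which `g` kills. The quantification
over all `r` and `f` records independence of the lift and yields naturality. -/
lemma exists_family_app (h : IsScalarExtension F (F' := F') t) {X : T} (e : t.obj X ⟶ M) [Epi e]
    (g : H.obj X ⟶ P) (hg : ∀ (Z : T) (z : t.obj Z ⟶ t.obj X), z ≫ e = 0 → H.map z ≫ g = 0)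
    {A : T} (x : t.obj A ⟶ M) :
    ∃ y : H.obj A ⟶ P, ∀ (A' : T) (r : t.obj A' ⟶ t.obj A) (f : t.obj A' ⟶ t.obj X),
      f ≫ e = r ≫ x → H.map f ≫ g = H.map r ≫ y := by
  obtain ⟨B, q, hq, l, hl⟩ := h.exists_lift_of_epi e x
  obtain ⟨y, hy⟩ := H.exists_desc q hq (H.map l ≫ g) (by
    rw [← Category.assoc, ← H.map_comp]
    refine hg _ _ ?_
    have := h.additive
    rw [Category.assoc, hl, ← t.map_comp_assoc, kernel.condition, t.map_zero, zero_comp])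
  refine ⟨y, fun A' r f hf => ?_⟩
  have := h.additive
  have := h.preservesFiniteColimits
  obtain ⟨A'', q', hq', l', hl'⟩ := h.exists_lift_of_epi (t.map q) r
  have := H.epi_map q' hq'
  rw [← cancel_epi (H.map (t.map q')), ← Category.assoc, ← Category.assoc, ← H.map_comp,
    ← H.map_comp, ← hl', H.map_comp l', Category.assoc, hy, ← Category.assoc, ← H.map_comp,
    ← sub_eq_zero, ← Preadditive.sub_comp, ← H.map_sub]
  refine hg _ _ ?_
  rw [Preadditive.sub_comp, Category.assoc, Category.assoc, hf, hl, reassoc_of% hl', sub_self]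

section

variable (h : IsScalarExtension F (F' := F') t) {X : T} (e : t.obj X ⟶ M) [Epi e]
  (g : H.obj X ⟶ P) (hg : ∀ (Z : T) (z : t.obj Z ⟶ t.obj X), z ≫ e = 0 → H.map z ≫ g = 0)

/-- A natural family is determined by its value at an epimorphism `e`, which may be any
morphism killing the kernel of `e`. -/
def Family.ofEpi : H.Family M P where
  app x := (exists_family_app h e g hg x).choose
  naturality {A B} f x := by
    have h1 := (exists_family_app h e g hg (f ≫ x)).choose_spec
    have h2 := (exists_family_app h e g hg x).choose_spec
    obtain ⟨A', q, hq, l, hl⟩ := h.exists_lift_of_epi e (f ≫ x)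
    have := H.epi_map q hq
    rw [← cancel_epi (H.map (t.map q)), ← h1 _ _ _ hl, ← Category.assoc, ← H.map_comp]
    exact h2 _ _ _ (by rw [hl, Category.assoc])

lemma Family.ofEpi_app : (Family.ofEpi h e g hg).app e = g := by
  have := (exists_family_app h e g hg e).choose_spec X (𝟙 _) (𝟙 _) rfl
  rw [H.map_id, Category.id_comp, Category.id_comp] at this
  exact this.symm

end

/-- A natural family can be composed with a morphism. -/
def Family.comp (β : H.Family M P) {Q : D} (g : P ⟶ Q) : H.Family M Q where
  app x := β.app x ≫ g
  naturality f x := by rw [β.naturality, Category.assoc]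

/-- A natural family can be pulled back along a morphism. -/
def Family.precomp (β : H.Family M P) {N : C} (g : N ⟶ M) : H.Family N P where
  app x := β.app (x ≫ g)
  naturality f x := by rw [Category.assoc, β.naturality]

/-- Additivity is forced by naturality: both `x` and `y` are restrictions of one morphism on `t(A ⊞
A)`. -/
lemma Family.app_add (h : IsScalarExtension F (F' := F') t) (β : H.Family M P) {A : T}
    (x y : t.obj A ⟶ M) : β.app (x + y) = β.app x + β.app y := by
  have := h.additive
  let l : t.obj (A ⊞ A) ⟶ M := t.map biprod.fst ≫ x + t.map biprod.snd ≫ y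
  have h1 : t.map biprod.inl ≫ l = x := by
    simp only [l, Preadditive.comp_add, ← Category.assoc, ← t.map_comp]
    simp
  have h2 : t.map biprod.inr ≫ l = y := by
    simp only [l, Preadditive.comp_add, ← Category.assoc, ← t.map_comp]
    simp
  conv_lhs => rw [← h1, ← h2]
  rw [← Preadditive.add_comp, β.naturality, H.map_add, Preadditive.add_comp, ← β.naturality,
    ← β.naturality, h1, h2]

lemma Family.app_zero (h : IsScalarExtension F (F' := F') t) (β : H.Family M P) {A : T} :
    β.app (0 : t.obj A ⟶ M) = 0 := by
  have := β.app_add h (0 : t.obj A ⟶ M) 0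
  simpa using this

end ExtFun

namespace IsScalarExtension

variable (h : IsScalarExtension F (F' := F') t)

/-- The identity as an extendable functor. -/
def idExt : ExtFun t C where
  obj A := t.obj A
  map f := f
  map_id _ := rfl
  map_comp _ _ := rfl
  map_add _ _ := rfl
  epi_map q _ := by
    have := h.preservesFiniteColimits
    infer_instance
  exists_desc {A B} q _ P g hg := by
    have := h.preservesFiniteColimits
    have := h.preservesFiniteLimits
    have := h.additive
    let S : ShortComplex T := ShortComplex.mk (kernel.ι q) q (by simp)
    have hS : (S.map t).Exact := (ShortComplex.exact_kernel q).map t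
    have : Epi (S.map t).g := inferInstanceAs (Epi (t.map q))
    exact ⟨hS.desc g hg, hS.g_desc g hg⟩

variable {h} in
-- The objects of the image are dense in `C`. The value of `β` at a cover `p` of `M` kills the
-- kernel of `p`, because that kernel is itself covered by some `tY`, on which naturality applies.
lemma exists_desc_family {M P : C} (β : h.idExt.Family M P) :
    ∃ g : M ⟶ P, ∀ (A : T) (x : t.obj A ⟶ M), x ≫ g = β.app x := by
  obtain ⟨X, p, hp⟩ := h.exists_cover M
  obtain ⟨Y, k, hk⟩ := h.exists_cover (kernel p)
  have hS : (ShortComplex.mk (kernel.ι p) p (by simp)).Exact := ShortComplex.exact_kernel p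
  have hz : kernel.ι p ≫ β.app p = 0 := by
    rw [← cancel_epi k, comp_zero]
    refine (Category.assoc _ _ _).symm.trans ((β.naturality _ _).symm.trans ?_)
    rw [Category.assoc, kernel.condition, comp_zero]
    exact β.app_zero h
  refine ⟨hS.desc _ hz, fun A x => ?_⟩
  let γ : h.idExt.Family M P := { app := fun x => x ≫ hS.desc _ hz,
                                  naturality := fun f x => Category.assoc _ _ _ }
  exact ExtFun.Family.app_eq_of_epi h γ β p (hS.g_desc _ hz) x

end IsScalarExtension

end Extension

/-! ### The tensor product on the scalar extension -/

lemma exists_desc_of_preservesFiniteColimits {A B : Type*} [Category* A] [Category* B] [Abelian A]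
    [Abelian B] (G : A ⥤ B) [PreservesFiniteColimits G] {X Y : A} (q : X ⟶ Y) [Epi q] {P : B}
    (g : G.obj X ⟶ P) (hg : G.map (kernel.ι q) ≫ g = 0) : ∃ g', G.map q ≫ g' = g := by
  have : G.Additive :=
    have : PreservesBinaryBiproducts G := preservesBinaryBiproducts_of_preservesBinaryCoproducts _
    Functor.additive_of_preservesBinaryBiproducts _
  let S : ShortComplex A := ShortComplex.mk (kernel.ι q) q (by simp)
  have hS : S.Exact := ShortComplex.exact_kernel q
  have e := (Functor.preservesFiniteColimits_tfae G).out 3 1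
  have hg' : Epi S.g := ‹Epi q›
  obtain ⟨hS', h2⟩ := e.1 inferInstance S ⟨hS, hg'⟩
  have : Epi (S.map G).g := h2
  exact ⟨hS'.desc g hg, hS'.g_desc g hg⟩

section

variable {F F' : Type w} [Field F] [Field F'] [Algebra F F']
  {T : Type*} [Category.{v} T] [Abelian T] [Linear F T] {C : Type*} [Category.{v} C] [Abelian C]
  [Linear F' C] {t : T ⥤ C}

namespace IsScalarExtension

variable (h : IsScalarExtension F (F' := F') t)

/-- An object of `T` whose scalar extension covers `M`. -/
def gen (M : C) : T := (h.exists_cover M).choose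

def genπ (M : C) : t.obj (h.gen M) ⟶ M := (h.exists_cover M).choose_spec.choose

instance (M : C) : Epi (h.genπ M) := (h.exists_cover M).choose_spec.choose_spec

lemma exists_relations (M : C) : ∃ (Y : T) (k : t.obj Y ⟶ t.obj (h.gen M))
    (hk : k ≫ h.genπ M = 0), (ShortComplex.mk _ _ hk).Exact := by
  obtain ⟨Y, k, hk⟩ := h.exists_cover (kernel (h.genπ M))
  refine ⟨Y, k ≫ kernel.ι _, by simp, ?_⟩
  rw [ShortComplex.exact_iff_epi_kernel_lift]
  have : kernel.lift (h.genπ M) (k ≫ kernel.ι _) (by simp) = k := by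
    rw [← cancel_mono (kernel.ι _), kernel.lift_ι]
  change Epi (kernel.lift (h.genπ M) (k ≫ kernel.ι _) _)
  rwa [this]

/-- An object of `T` whose scalar extension covers the relations in a presentation of `M`. -/
def rel (M : C) : T := (h.exists_relations M).choose

def relι (M : C) : t.obj (h.rel M) ⟶ t.obj (h.gen M) := (h.exists_relations M).choose_spec.choose

@[simp]
lemma relι_genπ (M : C) : h.relι M ≫ h.genπ M = 0 :=
  (h.exists_relations M).choose_spec.choose_spec.choose

lemma exact_relι_genπ (M : C) : (ShortComplex.mk _ _ (h.relι_genπ M)).Exact :=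
  (h.exists_relations M).choose_spec.choose_spec.choose_spec

/-- Any `z` killed by `genπ` factors, after an epimorphism of `T`, through the chosen relations.
This supplies the hypothesis of `Family.ofEpi` for families defined on generators. -/
lemma map_relι_comp {D : Type*} [Category* D] [Preadditive D] (H : ExtFun t D) {M : C} {P : D}
    (g : H.obj (h.gen M) ⟶ P) (hg : H.map (h.relι M) ≫ g = 0) (Z : T)
    (z : t.obj Z ⟶ t.obj (h.gen M)) (hz : z ≫ h.genπ M = 0) : H.map z ≫ g = 0 := by
  obtain ⟨A, q, hq, l, hl⟩ := h.exists_lift_of_exact (h.exact_relι_genπ M) z hz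
  have := H.epi_map q hq
  rw [← cancel_epi (H.map (t.map q)), ← Category.assoc, ← H.map_comp, comp_zero]
  dsimp at hl
  rw [← hl, H.map_comp, Category.assoc, hg, comp_zero]

section

variable [MonoidalCategory T] [MonoidalPreadditive T] [MonoidalLinear F T]
  [∀ X : T, PreservesFiniteColimits (tensorLeft X)]
  [∀ X : T, PreservesFiniteColimits (tensorRight X)]

/-- The functor `A ↦ t (A ⊗ B)`. -/
def rightExt (B : T) : ExtFun t C where
  obj A := t.obj (A ⊗ B)
  map f := h.box f (𝟙 (t.obj B))
  map_id _ := h.box_id _ _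
  map_comp f g := by rw [← h.box_comp, Category.comp_id]
  map_add f g := h.add_box _ _ _
  epi_map q _ := by
    have := h.preservesFiniteColimits
    rw [← t.map_id, h.box_map, tensorHom_id]
    exact inferInstanceAs (Epi ((tensorRight B ⋙ t).map q))
  exists_desc q _ P g hg := by
    have := h.preservesFiniteColimits
    rw [← t.map_id, h.box_map, tensorHom_id] at hg ⊢
    exact exists_desc_of_preservesFiniteColimits (tensorRight B ⋙ t) q g hg

/-- The functor `B ↦ t (A ⊗ B)`. -/
def leftExt (A : T) : ExtFun t C where
  obj B := t.obj (A ⊗ B)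
  map f := h.box (𝟙 (t.obj A)) f
  map_id _ := h.box_id _ _
  map_comp f g := by rw [← h.box_comp, Category.comp_id]
  map_add f g := h.box_add _ _ _
  epi_map q _ := by
    have := h.preservesFiniteColimits
    rw [← t.map_id, h.box_map, id_tensorHom]
    exact inferInstanceAs (Epi ((tensorLeft A ⋙ t).map q))
  exists_desc q _ P g hg := by
    have := h.preservesFiniteColimits
    rw [← t.map_id, h.box_map, id_tensorHom] at hg ⊢
    exact exists_desc_of_preservesFiniteColimits (tensorLeft A ⋙ t) q g hg

/-- A natural family of maps `t (A ⊗ B) ⟶ P` indexed by the pairs of morphisms `t A ⟶ M`,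
`t B ⟶ N`. -/
structure BiFamily (M N P : C) where
  app {A B : T} (x : t.obj A ⟶ M) (y : t.obj B ⟶ N) : t.obj (A ⊗ B) ⟶ P
  naturality_left {A A' B : T} (f : t.obj A ⟶ t.obj A') (x : t.obj A' ⟶ M) (y : t.obj B ⟶ N) :
    app (f ≫ x) y = h.box f (𝟙 (t.obj B)) ≫ app x y
  naturality_right {A B B' : T} (g : t.obj B ⟶ t.obj B') (x : t.obj A ⟶ M) (y : t.obj B' ⟶ N) :
    app x (g ≫ y) = h.box (𝟙 (t.obj A)) g ≫ app x y

namespace BiFamily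

variable {h} {M N P : C}

/-- A natural family in two variables with the second variable fixed. -/
def fixRight (β : h.BiFamily M N P) {B : T} (y : t.obj B ⟶ N) : (h.rightExt B).Family M P where
  app x := β.app x y
  naturality f x := β.naturality_left f x y

/-- A natural family in two variables with the first variable fixed. -/
def fixLeft (β : h.BiFamily M N P) {A : T} (x : t.obj A ⟶ M) : (h.leftExt A).Family N P where
  app y := β.app x y
  naturality g y := β.naturality_right g x y

lemma app_eq_of_epi (β γ : h.BiFamily M N P) {X Y : T} (e : t.obj X ⟶ M) [Epi e]
    (e' : t.obj Y ⟶ N) [Epi e'] (hβ : β.app e e' = γ.app e e') {A B : T} (x : t.obj A ⟶ M)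
    (y : t.obj B ⟶ N) : β.app x y = γ.app x y :=
  (β.fixLeft x).app_eq_of_epi h (γ.fixLeft x) e'
    ((β.fixRight e').app_eq_of_epi h (γ.fixRight e') e hβ x) y

/-- Families in the first variable which depend naturally on the second one. -/
def ofFamilies {X : T} (e : t.obj X ⟶ M) [Epi e]
    (γ : ∀ {B : T} (_ : t.obj B ⟶ N), (h.rightExt B).Family M P)
    (hγ : ∀ {B B' : T} (g : t.obj B ⟶ t.obj B') (y : t.obj B' ⟶ N),
      (γ (g ≫ y)).app e = h.box (𝟙 (t.obj X)) g ≫ (γ y).app e) : h.BiFamily M N P where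
  app x y := (γ y).app x
  naturality_left f x y := (γ y).naturality f x
  naturality_right {A B B'} g x y := by
    -- Naturality in the second variable compares two families in the first one, which agree as soon
    -- as they agree at `e`.
    let δ : (h.rightExt B).Family M P :=
      { app := fun x => h.box (𝟙 (t.obj _)) g ≫ (γ y).app x
        naturality := fun f x => by
          refine (congrArg _ ((γ y).naturality f x)).trans ?_
          refine (Category.assoc _ _ _).symm.trans (Eq.trans ?_ (Category.assoc _ _ _))
          refine congrArg (· ≫ (γ y).app x) ?_
          change h.box _ _ ≫ h.box _ _ = h.box _ _ ≫ h.box _ _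
          rw [← h.box_comp, ← h.box_comp, Category.comp_id, Category.id_comp, Category.id_comp,
            Category.comp_id] }
    exact (γ (g ≫ y)).app_eq_of_epi h δ e (hγ g y) x

/-- Families in the second variable which depend naturally on the first one. -/
def ofFamilies' {Y : T} (e : t.obj Y ⟶ N) [Epi e]
    (γ : ∀ {A : T} (_ : t.obj A ⟶ M), (h.leftExt A).Family N P)
    (hγ : ∀ {A A' : T} (f : t.obj A ⟶ t.obj A') (x : t.obj A' ⟶ M),
      (γ (f ≫ x)).app e = h.box f (𝟙 (t.obj Y)) ≫ (γ x).app e) : h.BiFamily M N P where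
  app x y := (γ x).app y
  naturality_right g x y := (γ x).naturality g y
  naturality_left {A A' B} f x y := by
    let δ : (h.leftExt A).Family N P :=
      { app := fun y => h.box f (𝟙 (t.obj _)) ≫ (γ x).app y
        naturality := fun g y => by
          refine (congrArg _ ((γ x).naturality g y)).trans ?_
          refine (Category.assoc _ _ _).symm.trans (Eq.trans ?_ (Category.assoc _ _ _))
          refine congrArg (· ≫ (γ x).app y) ?_
          change h.box _ _ ≫ h.box _ _ = h.box _ _ ≫ h.box _ _
          rw [← h.box_comp, ← h.box_comp, Category.comp_id, Category.id_comp, Category.id_comp,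
            Category.comp_id] }
    exact (γ (f ≫ x)).app_eq_of_epi h δ e (hγ f x) y

lemma app_zero (β : h.BiFamily M N P) {A B : T} (x : t.obj A ⟶ M) :
    β.app x (0 : t.obj B ⟶ N) = 0 :=
  (β.fixLeft x).app_zero h

lemma zero_app (β : h.BiFamily M N P) {A B : T} (y : t.obj B ⟶ N) :
    β.app (0 : t.obj A ⟶ M) y = 0 :=
  (β.fixRight y).app_zero h

end BiFamily

/-- The relations defining the tensor product of two objects. -/
def tensorRel (M N : C) : (t.obj (h.rel M ⊗ h.gen N)) ⊞ (t.obj (h.gen M ⊗ h.rel N)) ⟶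
    t.obj (h.gen M ⊗ h.gen N) :=
  biprod.desc (h.box (h.relι M) (𝟙 _)) (h.box (𝟙 _) (h.relι N))

/-- The tensor product of two objects of the scalar extension. -/
def tensor (M N : C) : C := cokernel (h.tensorRel M N)

def tensorπ (M N : C) : t.obj (h.gen M ⊗ h.gen N) ⟶ h.tensor M N :=
  cokernel.π _

instance (M N : C) : Epi (h.tensorπ M N) :=
  inferInstanceAs (Epi (cokernel.π (h.tensorRel M N)))

lemma tensorRel_tensorπ (M N : C) : h.tensorRel M N ≫ h.tensorπ M N = 0 :=
  cokernel.condition _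

lemma box_relι_tensorπ (M N : C) :
    h.box (h.relι M) (𝟙 (t.obj (h.gen N))) ≫ h.tensorπ M N = 0 := by
  have := biprod.inl ≫= h.tensorRel_tensorπ M N
  rwa [tensorRel, biprod.inl_desc_assoc, comp_zero] at this

lemma relι_box_tensorπ (M N : C) :
    h.box (𝟙 (t.obj (h.gen M))) (h.relι N) ≫ h.tensorπ M N = 0 := by
  have := biprod.inr ≫= h.tensorRel_tensorπ M N
  rwa [tensorRel, biprod.inr_desc_assoc, comp_zero] at this

lemma exists_tensorπ_desc {M N P : C} (g : t.obj (h.gen M ⊗ h.gen N) ⟶ P)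
    (h1 : h.box (h.relι M) (𝟙 (t.obj (h.gen N))) ≫ g = 0)
    (h2 : h.box (𝟙 (t.obj (h.gen M))) (h.relι N) ≫ g = 0) :
    ∃ g', h.tensorπ M N ≫ g' = g :=
  ⟨cokernel.desc (h.tensorRel M N) g (by
    rw [tensorRel]
    ext
    · simpa using h1
    · simpa using h2), cokernel.π_desc _ _ _⟩

/-- A map which kills the relations defining the tensor product kills the kernel of the
projection to the tensor product. -/
lemma map_comp_of_tensorπ {D : Type*} [Category* D] [Preadditive D] (H : ExtFun t D) {M N : C}
    {P : D} (g : H.obj (h.gen M ⊗ h.gen N) ⟶ P)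
    (h1 : H.map (h.box (h.relι M) (𝟙 (t.obj (h.gen N)))) ≫ g = 0)
    (h2 : H.map (h.box (𝟙 (t.obj (h.gen M))) (h.relι N)) ≫ g = 0) (Z : T)
    (z : t.obj Z ⟶ t.obj (h.gen M ⊗ h.gen N)) (hz : z ≫ h.tensorπ M N = 0) :
    H.map z ≫ g = 0 := by
  obtain ⟨A, q, hq, l, hl⟩ := h.exists_lift_of_exact
    (ShortComplex.exact_cokernel (h.tensorRel M N)) z hz
  have := H.epi_map q hq
  rw [← cancel_epi (H.map (t.map q)), ← Category.assoc, ← H.map_comp, comp_zero]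
  have hl' : (l ≫ biprod.fst) ≫ h.box (h.relι M) (𝟙 (t.obj (h.gen N))) +
      (l ≫ biprod.snd) ≫ h.box (𝟙 (t.obj (h.gen M))) (h.relι N) = t.map q ≫ z := by
    rw [← hl]
    dsimp
    rw [tensorRel, biprod.desc_eq, Preadditive.comp_add, Category.assoc, Category.assoc]
  rw [← hl', H.map_add, H.map_comp, H.map_comp, Preadditive.add_comp, Category.assoc,
    Category.assoc, h1, h2, comp_zero, comp_zero, add_zero]

/-- The universal natural family on morphisms `t A ⟶ M` which lift to the generators of `M`. -/
def genFamily (M N : C) {A : T} (f : t.obj A ⟶ t.obj (h.gen M)) :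
    (h.leftExt A).Family N (h.tensor M N) :=
  ExtFun.Family.ofEpi h (h.genπ N) (h.box f (𝟙 (t.obj (h.gen N))) ≫ h.tensorπ M N)
    (h.map_relι_comp (h.leftExt A) _ (by
      change h.box (𝟙 (t.obj A)) (h.relι N) ≫ h.box f (𝟙 (t.obj (h.gen N))) ≫ _ = 0
      rw [← Category.assoc, ← h.box_comp, Category.id_comp, Category.comp_id,
        ← Category.comp_id f, ← Category.id_comp (h.relι N), h.box_comp, Category.assoc,
        relι_box_tensorπ, comp_zero]))

lemma genFamily_genπ (M N : C) {A : T} (f : t.obj A ⟶ t.obj (h.gen M)) :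
    (h.genFamily M N f).app (h.genπ N) = h.box f (𝟙 (t.obj (h.gen N))) ≫ h.tensorπ M N :=
  ExtFun.Family.ofEpi_app _ _ _ _

/-- A natural family, precomposed with a morphism in the first variable. -/
def compFamily {N P : C} {A A' : T} (g : t.obj A' ⟶ t.obj A) (γ : (h.leftExt A).Family N P) :
    (h.leftExt A').Family N P where
  app y := h.box g (𝟙 (t.obj _)) ≫ γ.app y
  naturality k y := by
    refine (congrArg _ (γ.naturality k y)).trans ?_
    refine (Category.assoc _ _ _).symm.trans (Eq.trans ?_ (Category.assoc _ _ _))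
    refine congrArg (· ≫ γ.app y) ?_
    change h.box _ _ ≫ h.box _ _ = h.box _ _ ≫ h.box _ _
    rw [← h.box_comp, ← h.box_comp, Category.comp_id, Category.id_comp, Category.id_comp,
      Category.comp_id]

lemma comp_genFamily (M N : C) {A A' : T} (f : t.obj A ⟶ t.obj (h.gen M))
    (g : t.obj A' ⟶ t.obj A) {B : T} (y : t.obj B ⟶ N) :
    (h.genFamily M N (g ≫ f)).app y = h.box g (𝟙 (t.obj B)) ≫ (h.genFamily M N f).app y := by
  refine ExtFun.Family.app_eq_of_epi h _ (h.compFamily g (h.genFamily M N f)) (h.genπ N)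
    ((h.genFamily_genπ _ _ _).trans ?_) y
  refine Eq.trans ?_ (congrArg (h.box g (𝟙 _) ≫ ·) (h.genFamily_genπ M N f).symm)
  rw [← Category.assoc, ← h.box_comp, Category.comp_id]

lemma genFamily_relι (M N : C) {B : T} (y : t.obj B ⟶ N) :
    (h.genFamily M N (h.relι M)).app y = 0 := by
  let δ : (h.leftExt (h.rel M)).Family N (h.tensor M N) :=
    { app := fun y => 0
      naturality := by simp }
  refine ExtFun.Family.app_eq_of_epi h _ δ (h.genπ N) ((h.genFamily_genπ _ _ _).trans ?_) y
  exact h.box_relι_tensorπ M N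

/-- The universal natural family on the morphisms to `M`, with a fixed morphism to `N`. -/
def univFamily (M N : C) {B : T} (y : t.obj B ⟶ N) :
    (h.rightExt B).Family M (h.tensor M N) :=
  ExtFun.Family.ofEpi h (h.genπ M) ((h.genFamily M N (𝟙 _)).app y)
    (h.map_relι_comp (h.rightExt B) _ ((h.comp_genFamily M N (𝟙 _) (h.relι M) y).symm.trans (by
      rw [Category.comp_id]
      exact h.genFamily_relι M N y)))

lemma univFamily_genπ (M N : C) {B : T} (y : t.obj B ⟶ N) :
    (h.univFamily M N y).app (h.genπ M) = (h.genFamily M N (𝟙 _)).app y :=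
  ExtFun.Family.ofEpi_app _ _ _ _

/-- The universal natural family in two variables. -/
def tmkFamily (M N : C) : h.BiFamily M N (h.tensor M N) :=
  BiFamily.ofFamilies (h.genπ M) (h.univFamily M N) (fun g y =>
    (h.univFamily_genπ M N _).trans (((h.genFamily M N (𝟙 _)).naturality g y).trans
      (congrArg (h.box (𝟙 _) g ≫ ·) (h.univFamily_genπ M N y).symm)))

/-- The tensor product of two morphisms, as a morphism to the tensor product. -/
def tmk {M N : C} {A B : T} (x : t.obj A ⟶ M) (y : t.obj B ⟶ N) :
    t.obj (A ⊗ B) ⟶ h.tensor M N :=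
  (h.tmkFamily M N).app x y

lemma tmk_genπ (M N : C) : h.tmk (h.genπ M) (h.genπ N) = h.tensorπ M N := by
  refine (h.univFamily_genπ M N _).trans ((h.genFamily_genπ M N _).trans ?_)
  rw [h.box_id, Category.id_comp]

lemma tmk_comp {M N : C} {A A' B B' : T} (f : t.obj A ⟶ t.obj A') (x : t.obj A' ⟶ M)
    (g : t.obj B ⟶ t.obj B') (y : t.obj B' ⟶ N) :
    h.tmk (f ≫ x) (g ≫ y) = h.box f g ≫ h.tmk x y := by
  refine ((h.tmkFamily M N).naturality_left _ _ _).trans ?_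
  rw [(h.tmkFamily M N).naturality_right, ← Category.assoc, ← h.box_comp, Category.id_comp,
    Category.comp_id]
  rfl

lemma comp_tmk {M N : C} {A A' B : T} (f : t.obj A ⟶ t.obj A') (x : t.obj A' ⟶ M)
    (y : t.obj B ⟶ N) : h.tmk (f ≫ x) y = h.box f (𝟙 (t.obj B)) ≫ h.tmk x y :=
  (h.tmkFamily M N).naturality_left _ _ _

lemma tmk_comp' {M N : C} {A B B' : T} (x : t.obj A ⟶ M) (g : t.obj B ⟶ t.obj B')
    (y : t.obj B' ⟶ N) : h.tmk x (g ≫ y) = h.box (𝟙 (t.obj A)) g ≫ h.tmk x y :=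
  (h.tmkFamily M N).naturality_right _ _ _

lemma tmk_add {M N : C} {A B : T} (x : t.obj A ⟶ M) (y y' : t.obj B ⟶ N) :
    h.tmk x (y + y') = h.tmk x y + h.tmk x y' :=
  ((h.tmkFamily M N).fixLeft x).app_add h y y'

lemma add_tmk {M N : C} {A B : T} (x x' : t.obj A ⟶ M) (y : t.obj B ⟶ N) :
    h.tmk (x + x') y = h.tmk x y + h.tmk x' y :=
  ((h.tmkFamily M N).fixRight y).app_add h x x'

@[simp]
lemma tmk_zero {M N : C} {A B : T} (x : t.obj A ⟶ M) : h.tmk x (0 : t.obj B ⟶ N) = 0 :=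
  (h.tmkFamily M N).app_zero x

@[simp]
lemma zero_tmk {M N : C} {A B : T} (y : t.obj B ⟶ N) : h.tmk (0 : t.obj A ⟶ M) y = 0 :=
  (h.tmkFamily M N).zero_app y

lemma smul_tmk {M N : C} {A B : T} (a : F') (x : t.obj A ⟶ M) (y : t.obj B ⟶ N) :
    h.tmk (a • x) y = a • h.tmk x y := by
  have : a • x = (a • 𝟙 (t.obj A)) ≫ x := by simp
  rw [this, comp_tmk, h.smul_box, h.box_id, Linear.smul_comp, Category.id_comp]

lemma tmk_smul {M N : C} {A B : T} (a : F') (x : t.obj A ⟶ M) (y : t.obj B ⟶ N) :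
    h.tmk x (a • y) = a • h.tmk x y := by
  have : a • y = (a • 𝟙 (t.obj B)) ≫ y := by simp
  rw [this, tmk_comp', h.box_smul, h.box_id, Linear.smul_comp, Category.id_comp]

variable {h} in
-- The value of `β` at the generators kills the defining relations by naturality, since each
-- relation is sent to zero in `M` or `N`. So `tensor M N` represents natural families in two
-- variables, with `tmk` as the universal one.
lemma exists_tensor_desc {M N P : C} (β : h.BiFamily M N P) :
    ∃ g : h.tensor M N ⟶ P, ∀ {A B : T} (x : t.obj A ⟶ M) (y : t.obj B ⟶ N),
      h.tmk x y ≫ g = β.app x y := by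
  obtain ⟨g, hg⟩ := h.exists_tensorπ_desc (β.app (h.genπ M) (h.genπ N))
    (by rw [← β.naturality_left, relι_genπ, β.zero_app])
    (by rw [← β.naturality_right, relι_genπ, β.app_zero])
  let γ : h.BiFamily M N P :=
    { app := fun x y => h.tmk x y ≫ g
      naturality_left := fun f x y => by rw [comp_tmk, Category.assoc]
      naturality_right := fun f x y => by rw [tmk_comp', Category.assoc] }
  refine ⟨g, fun x y => ?_⟩
  refine BiFamily.app_eq_of_epi γ β (h.genπ M) (h.genπ N) ?_ x y
  change h.tmk _ _ ≫ g = _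
  rw [tmk_genπ, hg]

variable {h} in
/-- The morphism out of the tensor product induced by a natural family in two variables. -/
def tdesc {M N P : C} (β : h.BiFamily M N P) : h.tensor M N ⟶ P := (exists_tensor_desc β).choose

variable {h} in
@[simp]
lemma tmk_tdesc {M N P : C} (β : h.BiFamily M N P) {A B : T} (x : t.obj A ⟶ M)
    (y : t.obj B ⟶ N) : h.tmk x y ≫ tdesc β = β.app x y :=
  (exists_tensor_desc β).choose_spec x y

/-- Two morphisms out of the tensor product give two families; a family is determined by its value
at a pair of epimorphisms. This is the cancellation used for every identity of constraints. -/
instance epi_tmk {M N : C} {A B : T} (x : t.obj A ⟶ M) (y : t.obj B ⟶ N) [Epi x] [Epi y] :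
    Epi (h.tmk x y) where
  left_cancellation {P} f g hfg := by
    let β (k : h.tensor M N ⟶ P) : h.BiFamily M N P :=
      { app := fun x y => h.tmk x y ≫ k
        naturality_left := fun f x y => by rw [comp_tmk, Category.assoc]
        naturality_right := fun f x y => by rw [tmk_comp', Category.assoc] }
    have := BiFamily.app_eq_of_epi (β f) (β g) x y hfg (h.genπ M) (h.genπ N)
    change h.tmk _ _ ≫ f = h.tmk _ _ ≫ g at this
    rwa [tmk_genπ, cancel_epi] at this

/-- The functoriality of the tensor product. -/
def tmap {M M' N N' : C} (φ : M ⟶ M') (ψ : N ⟶ N') : h.tensor M N ⟶ h.tensor M' N' :=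
  tdesc (h := h)
    { app := fun x y => h.tmk (x ≫ φ) (y ≫ ψ)
      naturality_left := fun f x y => by rw [Category.assoc, comp_tmk]
      naturality_right := fun f x y => by rw [Category.assoc, tmk_comp'] }

@[simp]
lemma tmk_tmap {M M' N N' : C} (φ : M ⟶ M') (ψ : N ⟶ N') {A B : T} (x : t.obj A ⟶ M)
    (y : t.obj B ⟶ N) : h.tmk x y ≫ h.tmap φ ψ = h.tmk (x ≫ φ) (y ≫ ψ) :=
  tmk_tdesc _ x y

end

end IsScalarExtension

end

/-! ### Associativity, unit and symmetry constraints -/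

section

variable {F F' : Type w} [Field F] [Field F'] [Algebra F F']
  {T : Type*} [Category.{v} T] [Abelian T] [Linear F T] {C : Type*} [Category.{v} C] [Abelian C]
  [Linear F' C] {t : T ⥤ C}

namespace IsScalarExtension

variable (h : IsScalarExtension F (F' := F') t)

variable [MonoidalCategory T] [MonoidalPreadditive T] [MonoidalLinear F T]
  [∀ X : T, PreservesFiniteColimits (tensorLeft X)]
  [∀ X : T, PreservesFiniteColimits (tensorRight X)]

lemma map_tmk {M N : C} {A A' B : T} (f : A ⟶ A') (x : t.obj A' ⟶ M) (y : t.obj B ⟶ N) :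
    h.tmk (t.map f ≫ x) y = t.map (f ▷ B) ≫ h.tmk x y := by
  rw [comp_tmk, ← t.map_id, h.box_map, tensorHom_id]

lemma tmk_map {M N : C} {A B B' : T} (x : t.obj A ⟶ M) (f : B ⟶ B') (y : t.obj B' ⟶ N) :
    h.tmk x (t.map f ≫ y) = t.map (A ◁ f) ≫ h.tmk x y := by
  rw [tmk_comp', ← t.map_id, h.box_map, id_tensorHom]

lemma epi_box {A A' B B' : T} (f : A ⟶ A') (g : B ⟶ B') [Epi f] [Epi g] :
    Epi (h.box (t.map f) (t.map g)) := by
  have := h.preservesFiniteColimits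
  have : Epi (f ▷ B) := inferInstanceAs (Epi ((tensorRight B).map f))
  have : Epi (A' ◁ g) := inferInstanceAs (Epi ((tensorLeft A').map g))
  rw [h.box_map, MonoidalCategory.tensorHom_def, t.map_comp]
  infer_instance

/-- Every morphism `t A ⟶ M` lifts to the generators of `M` locally on `A`. -/
lemma exists_lift_genπ {M : C} {A : T} (x : t.obj A ⟶ M) :
    ∃ (A' : T) (q : A' ⟶ A) (_ : Epi q) (l : t.obj A' ⟶ t.obj (h.gen M)),
      t.map q ≫ x = l ≫ h.genπ M := by
  obtain ⟨A', q, hq, l, hl⟩ := h.exists_lift_of_epi (h.genπ M) x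
  exact ⟨A', q, hq, l, hl.symm⟩

section Associator

variable (M N Q : C)

/-- The four auxiliary lemmas say that the associator of `T` respects the relations defining the
inner tensor product, so that it descends in each direction. -/
lemma tassoc_aux₁ {B : T} (y : t.obj B ⟶ Q) :
    (h.rightExt B).map (h.box (h.relι M) (𝟙 (t.obj (h.gen N)))) ≫
      t.map (α_ _ _ _).hom ≫ h.tmk (h.genπ M) (h.tmk (h.genπ N) y) = 0 := by
  have : h.box (h.box (h.relι M) (𝟙 (t.obj (h.gen N)))) (𝟙 (t.obj B)) ≫
      t.map (α_ _ _ _).hom ≫ h.tmk (h.genπ M) (h.tmk (h.genπ N) y) = 0 := by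
    rw [← Category.assoc, h.box_associator, h.box_id, Category.assoc, ← comp_tmk, relι_genπ,
      zero_tmk, comp_zero]
  exact this

lemma tassoc_aux₂ {B : T} (y : t.obj B ⟶ Q) :
    (h.rightExt B).map (h.box (𝟙 (t.obj (h.gen M))) (h.relι N)) ≫
      t.map (α_ _ _ _).hom ≫ h.tmk (h.genπ M) (h.tmk (h.genπ N) y) = 0 := by
  have : h.box (h.box (𝟙 (t.obj (h.gen M))) (h.relι N)) (𝟙 (t.obj B)) ≫
      t.map (α_ _ _ _).hom ≫ h.tmk (h.genπ M) (h.tmk (h.genπ N) y) = 0 := by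
    rw [← Category.assoc, h.box_associator, Category.assoc, ← tmk_comp', ← comp_tmk,
          relι_genπ, zero_tmk, tmk_zero, comp_zero]
  exact this

lemma tassoc_aux₃ {A : T} (x : t.obj A ⟶ M) :
    (h.leftExt A).map (h.box (h.relι N) (𝟙 (t.obj (h.gen Q)))) ≫
      t.map (α_ _ _ _).inv ≫ h.tmk (h.tmk x (h.genπ N)) (h.genπ Q) = 0 := by
  have : h.box (𝟙 (t.obj A)) (h.box (h.relι N) (𝟙 (t.obj (h.gen Q)))) ≫
      t.map (α_ _ _ _).inv ≫ h.tmk (h.tmk x (h.genπ N)) (h.genπ Q) = 0 := by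
    rw [← Category.assoc, h.box_associator_inv, Category.assoc, ← comp_tmk, ← tmk_comp',
      relι_genπ, tmk_zero, zero_tmk, comp_zero]
  exact this

lemma tassoc_aux₄ {A : T} (x : t.obj A ⟶ M) :
    (h.leftExt A).map (h.box (𝟙 (t.obj (h.gen N))) (h.relι Q)) ≫
      t.map (α_ _ _ _).inv ≫ h.tmk (h.tmk x (h.genπ N)) (h.genπ Q) = 0 := by
  have : h.box (𝟙 (t.obj A)) (h.box (𝟙 (t.obj (h.gen N))) (h.relι Q)) ≫
      t.map (α_ _ _ _).inv ≫ h.tmk (h.tmk x (h.genπ N)) (h.genπ Q) = 0 := by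
    rw [← Category.assoc, h.box_associator_inv, Category.assoc, h.box_id, ← tmk_comp',
      relι_genπ, tmk_zero, comp_zero]
  exact this

def tassocFamily {B : T} (y : t.obj B ⟶ Q) :
    (h.rightExt B).Family (h.tensor M N) (h.tensor M (h.tensor N Q)) :=
  ExtFun.Family.ofEpi h (h.tensorπ M N)
    (t.map (α_ _ _ _).hom ≫ h.tmk (h.genπ M) (h.tmk (h.genπ N) y))
    (h.map_comp_of_tensorπ (h.rightExt B) _ (h.tassoc_aux₁ M N Q y) (h.tassoc_aux₂ M N Q y))

lemma tassocFamily_π {B : T} (y : t.obj B ⟶ Q) : (h.tassocFamily M N Q y).app (h.tensorπ M N) =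
    t.map (α_ _ _ _).hom ≫ h.tmk (h.genπ M) (h.tmk (h.genπ N) y) :=
  ExtFun.Family.ofEpi_app _ _ _ _

def tassocBiFamily : h.BiFamily (h.tensor M N) Q (h.tensor M (h.tensor N Q)) :=
  BiFamily.ofFamilies (h.tensorπ M N) (h.tassocFamily M N Q) (fun g y => by
    refine (h.tassocFamily_π M N Q _).trans (Eq.trans ?_ (congrArg (h.box (𝟙 _) g ≫ ·)
      (h.tassocFamily_π M N Q y).symm))
    rw [tmk_comp', tmk_comp', ← Category.assoc, ← Category.assoc, ← h.box_associator, h.box_id])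

def tassocInvFamily {A : T} (x : t.obj A ⟶ M) :
    (h.leftExt A).Family (h.tensor N Q) (h.tensor (h.tensor M N) Q) :=
  ExtFun.Family.ofEpi h (h.tensorπ N Q)
    (t.map (α_ _ _ _).inv ≫ h.tmk (h.tmk x (h.genπ N)) (h.genπ Q))
    (h.map_comp_of_tensorπ (h.leftExt A) _ (h.tassoc_aux₃ M N Q x) (h.tassoc_aux₄ M N Q x))

lemma tassocInvFamily_π {A : T} (x : t.obj A ⟶ M) :
    (h.tassocInvFamily M N Q x).app (h.tensorπ N Q) =
    t.map (α_ _ _ _).inv ≫ h.tmk (h.tmk x (h.genπ N)) (h.genπ Q) :=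
  ExtFun.Family.ofEpi_app _ _ _ _

def tassocInvBiFamily : h.BiFamily M (h.tensor N Q) (h.tensor (h.tensor M N) Q) :=
  BiFamily.ofFamilies' (h.tensorπ N Q) (h.tassocInvFamily M N Q) (fun f x => by
    refine (h.tassocInvFamily_π M N Q _).trans (Eq.trans ?_ (congrArg (h.box f (𝟙 _) ≫ ·)
      (h.tassocInvFamily_π M N Q x).symm))
    rw [comp_tmk, comp_tmk, ← Category.assoc, ← Category.assoc, ← h.box_associator_inv, h.box_id])

lemma tmk_tassocBiFamily :
    h.tmk (h.tmk (h.genπ M) (h.genπ N)) (h.genπ Q) ≫ tdesc (h.tassocBiFamily M N Q) =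
    t.map (α_ _ _ _).hom ≫ h.tmk (h.genπ M) (h.tmk (h.genπ N) (h.genπ Q)) := by
  rw [tmk_tdesc, tmk_genπ]
  exact h.tassocFamily_π M N Q _

lemma tmk_tassocInvBiFamily :
    h.tmk (h.genπ M) (h.tmk (h.genπ N) (h.genπ Q)) ≫ tdesc (h.tassocInvBiFamily M N Q) =
    t.map (α_ _ _ _).inv ≫ h.tmk (h.tmk (h.genπ M) (h.genπ N)) (h.genπ Q) := by
  rw [tmk_tdesc, h.tmk_genπ N Q]
  exact h.tassocInvFamily_π M N Q _

/-- The associativity constraint. -/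
def tassoc : h.tensor (h.tensor M N) Q ≅ h.tensor M (h.tensor N Q) where
  hom := tdesc (h.tassocBiFamily M N Q)
  inv := tdesc (h.tassocInvBiFamily M N Q)
  hom_inv_id := by
    rw [← cancel_epi (h.tmk (h.tmk (h.genπ M) (h.genπ N)) (h.genπ Q)), ← Category.assoc,
      tmk_tassocBiFamily, Category.assoc, tmk_tassocInvBiFamily, ← t.map_comp_assoc,
      Iso.hom_inv_id, t.map_id, Category.id_comp, Category.comp_id]
  inv_hom_id := by
    rw [← cancel_epi (h.tmk (h.genπ M) (h.tmk (h.genπ N) (h.genπ Q))), ← Category.assoc,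
      tmk_tassocInvBiFamily, Category.assoc, tmk_tassocBiFamily, ← t.map_comp_assoc,
      Iso.inv_hom_id, t.map_id, Category.id_comp, Category.comp_id]

variable {M N Q}

/-- The formula is known at the generators. After epimorphisms of `T`, the morphisms `x`, `y`, `z`
factor through the generators, and these epimorphisms remain epimorphisms when tensored together. -/
lemma tmk_tassoc {A B D : T} (x : t.obj A ⟶ M) (y : t.obj B ⟶ N) (z : t.obj D ⟶ Q) :
    h.tmk (h.tmk x y) z ≫ (h.tassoc M N Q).hom =
      t.map (α_ _ _ _).hom ≫ h.tmk x (h.tmk y z) := by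
  obtain ⟨A', q, hq, l, hl⟩ := h.exists_lift_genπ x
  obtain ⟨B', q', hq', l', hl'⟩ := h.exists_lift_genπ y
  obtain ⟨D', q'', hq'', l'', hl''⟩ := h.exists_lift_genπ z
  have := h.epi_box q q'
  have : Epi (q ⊗ₘ q') := by
    have : Epi (q ▷ B') := inferInstanceAs (Epi ((tensorRight B').map q))
    have : Epi (A ◁ q') := inferInstanceAs (Epi ((tensorLeft A).map q'))
    rw [MonoidalCategory.tensorHom_def]
    infer_instance
  have := h.epi_box (q ⊗ₘ q') q''
  rw [← h.box_map] at this
  have e₁ : h.box (h.box (t.map q) (t.map q')) (t.map q'') ≫ h.tmk (h.tmk x y) z =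
      h.box (h.box l l') l'' ≫ h.tmk (h.tmk (h.genπ M) (h.genπ N)) (h.genπ Q) := by
    rw [← tmk_comp, ← tmk_comp, ← tmk_comp, ← tmk_comp, hl, hl', hl'']
  have e₂ : h.box (t.map q) (h.box (t.map q') (t.map q'')) ≫ h.tmk x (h.tmk y z) =
      h.box l (h.box l' l'') ≫ h.tmk (h.genπ M) (h.tmk (h.genπ N) (h.genπ Q)) := by
    rw [← tmk_comp, ← tmk_comp, ← tmk_comp, ← tmk_comp, hl, hl', hl'']
  rw [← cancel_epi (h.box (h.box (t.map q) (t.map q')) (t.map q'')), ← Category.assoc, e₁,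
    ← Category.assoc (h.box _ _), h.box_associator, Category.assoc, Category.assoc, e₂,
    ← Category.assoc (t.map _), ← h.box_associator, Category.assoc]
  exact congrArg _ (h.tmk_tassocBiFamily M N Q)

lemma tmk_tassoc_inv {A B D : T} (x : t.obj A ⟶ M) (y : t.obj B ⟶ N) (z : t.obj D ⟶ Q) :
    h.tmk x (h.tmk y z) ≫ (h.tassoc M N Q).inv =
      t.map (α_ _ _ _).inv ≫ h.tmk (h.tmk x y) z := by
  rw [Iso.comp_inv_eq, Category.assoc, tmk_tassoc, ← t.map_comp_assoc, Iso.inv_hom_id, t.map_id,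
    Category.id_comp]

end Associator

section Unitor

variable (M : C)

def tleftUnitorBiFamily : h.BiFamily (t.obj (𝟙_ T)) M M where
  app {_ B} a y := h.box a (𝟙 (t.obj B)) ≫ t.map (λ_ _).hom ≫ y
  naturality_left f a y := by
    rw [← Category.assoc (h.box f _), ← h.box_comp, Category.comp_id]
  naturality_right g a y := by
    rw [← Category.assoc (h.box (𝟙 _) g), ← h.box_comp, Category.id_comp, Category.comp_id,
      ← Category.assoc (t.map _), ← h.box_leftUnitor, ← Category.assoc, ← Category.assoc,
      ← h.box_comp, Category.comp_id, Category.id_comp, Category.assoc]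

def tleftUnitorInvFamily : h.idExt.Family M (h.tensor (t.obj (𝟙_ T)) M) where
  app y := t.map (λ_ _).inv ≫ h.tmk (𝟙 _) y
  naturality {A B} f y := by
    suffices t.map (λ_ A).inv ≫ h.tmk (𝟙 _) (f ≫ y) = f ≫ t.map (λ_ B).inv ≫ h.tmk (𝟙 _) y from this
    rw [tmk_comp', ← cancel_epi (t.map (λ_ A).hom), ← Category.assoc, ← t.map_comp,
      Iso.hom_inv_id, ← Category.assoc (t.map _) f, ← h.box_leftUnitor, Category.assoc,
      ← Category.assoc (t.map _) (t.map _), ← t.map_comp, Iso.hom_inv_id, t.map_id, t.map_id,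
      Category.id_comp, Category.id_comp]

/-- The left unit constraint. -/
def tleftUnitor : h.tensor (t.obj (𝟙_ T)) M ≅ M where
  hom := tdesc (h.tleftUnitorBiFamily M)
  inv := (exists_desc_family (h.tleftUnitorInvFamily M)).choose
  hom_inv_id := by
    have h2 := (exists_desc_family (h.tleftUnitorInvFamily M)).choose_spec _ (h.genπ M)
    rw [← cancel_epi (h.tmk (𝟙 _) (h.genπ M)), ← Category.assoc, tmk_tdesc]
    change (h.box _ _ ≫ _ ≫ _) ≫ _ = _
    rw [h.box_id, Category.id_comp, Category.assoc, h2]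
    change t.map (λ_ _).hom ≫ t.map (λ_ _).inv ≫ _ = _
    rw [← t.map_comp_assoc, Iso.hom_inv_id, t.map_id, Category.id_comp, Category.comp_id]
  inv_hom_id := by
    have h2 := (exists_desc_family (h.tleftUnitorInvFamily M)).choose_spec _ (h.genπ M)
    rw [← cancel_epi (h.genπ M), ← Category.assoc, h2]
    change (t.map (λ_ _).inv ≫ _) ≫ _ = _
    rw [Category.assoc, tmk_tdesc]
    change _ ≫ h.box _ _ ≫ _ = _
    rw [h.box_id, Category.id_comp, ← t.map_comp_assoc, Iso.inv_hom_id, t.map_id,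
      Category.id_comp, Category.comp_id]

variable {M}

lemma tmk_tleftUnitor {B : T} (y : t.obj B ⟶ M) :
    h.tmk (𝟙 _) y ≫ (h.tleftUnitor M).hom = t.map (λ_ B).hom ≫ y := by
  change _ ≫ tdesc _ = _
  rw [tmk_tdesc]
  change h.box _ _ ≫ _ = _
  rw [h.box_id, Category.id_comp]

end Unitor

section Braiding

variable [SymmetricCategory T]

def tbraidFamily (M N : C) : h.BiFamily M N (h.tensor N M) where
  app x y := t.map (β_ _ _).hom ≫ h.tmk y x
  naturality_left f x y := by
    rw [← Category.assoc (h.box _ _), h.box_braiding, tmk_comp', Category.assoc]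
  naturality_right f x y := by
    rw [← Category.assoc (h.box _ _), h.box_braiding, comp_tmk, Category.assoc]

/-- The symmetry. -/
def tbraid (M N : C) : h.tensor M N ≅ h.tensor N M where
  hom := tdesc (h.tbraidFamily M N)
  inv := tdesc (h.tbraidFamily N M)
  hom_inv_id := by
    rw [← cancel_epi (h.tmk (h.genπ M) (h.genπ N)), ← Category.assoc, tmk_tdesc]
    change (_ ≫ _) ≫ _ = _
    rw [Category.assoc, tmk_tdesc]
    change _ ≫ _ ≫ _ = _
    rw [← t.map_comp_assoc, SymmetricCategory.symmetry, t.map_id, Category.id_comp,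
      Category.comp_id]
  inv_hom_id := by
    rw [← cancel_epi (h.tmk (h.genπ N) (h.genπ M)), ← Category.assoc, tmk_tdesc]
    change (_ ≫ _) ≫ _ = _
    rw [Category.assoc, tmk_tdesc]
    change _ ≫ _ ≫ _ = _
    rw [← t.map_comp_assoc, SymmetricCategory.symmetry, t.map_id, Category.id_comp,
      Category.comp_id]

lemma tmk_tbraid {M N : C} {A B : T} (x : t.obj A ⟶ M) (y : t.obj B ⟶ N) :
    h.tmk x y ≫ (h.tbraid M N).hom = t.map (β_ A B).hom ≫ h.tmk y x :=
  tmk_tdesc _ _ _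

/-- The right unit constraint. -/
def trightUnitor (M : C) : h.tensor M (t.obj (𝟙_ T)) ≅ M :=
  h.tbraid _ _ ≪≫ h.tleftUnitor M

lemma tmk_trightUnitor {M : C} {B : T} (y : t.obj B ⟶ M) :
    h.tmk y (𝟙 _) ≫ (h.trightUnitor M).hom = t.map (ρ_ B).hom ≫ y := by
  rw [trightUnitor, Iso.trans_hom, ← Category.assoc, tmk_tbraid, Category.assoc, tmk_tleftUnitor,
    ← t.map_comp_assoc, braiding_leftUnitor]

end Braiding

end IsScalarExtension

end

/-! ### Coherence and the axioms of a tensor category -/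

section

variable {F F' : Type w} [Field F] [Field F'] [Algebra F F']
  {T : Type*} [Category.{v} T] [Abelian T] [Linear F T] {C : Type*} [Category.{v} C] [Abelian C]
  [Linear F' C] {t : T ⥤ C}

namespace IsScalarExtension

variable (h : IsScalarExtension F (F' := F') t)

variable [MonoidalCategory T] [MonoidalPreadditive T] [MonoidalLinear F T]
  [∀ X : T, PreservesFiniteColimits (tensorLeft X)]
  [∀ X : T, PreservesFiniteColimits (tensorRight X)] [SymmetricCategory T]

section

variable {M N P Q : C} {A B D : T} (x : t.obj A ⟶ M) (y : t.obj B ⟶ N) (z : t.obj D ⟶ Q)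

lemma tmk_tmap_assoc {M' N' : C} (φ : M ⟶ M') (ψ : N ⟶ N') (k : h.tensor M' N' ⟶ P) :
    h.tmk x y ≫ h.tmap φ ψ ≫ k = h.tmk (x ≫ φ) (y ≫ ψ) ≫ k := by
  rw [← Category.assoc, tmk_tmap]

lemma tmk_tassoc_assoc (k : h.tensor M (h.tensor N Q) ⟶ P) :
    h.tmk (h.tmk x y) z ≫ (h.tassoc M N Q).hom ≫ k =
      t.map (α_ _ _ _).hom ≫ h.tmk x (h.tmk y z) ≫ k := by
  rw [← Category.assoc, tmk_tassoc, Category.assoc]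

lemma tmk_tassoc_inv_assoc (k : h.tensor (h.tensor M N) Q ⟶ P) :
    h.tmk x (h.tmk y z) ≫ (h.tassoc M N Q).inv ≫ k =
      t.map (α_ _ _ _).inv ≫ h.tmk (h.tmk x y) z ≫ k := by
  rw [← Category.assoc, tmk_tassoc_inv, Category.assoc]

lemma tmk_tbraid_assoc (k : h.tensor N M ⟶ P) :
    h.tmk x y ≫ (h.tbraid M N).hom ≫ k = t.map (β_ A B).hom ≫ h.tmk y x ≫ k := by
  rw [← Category.assoc, tmk_tbraid, Category.assoc]

end

lemma tmap_id (M N : C) : h.tmap (𝟙 M) (𝟙 N) = 𝟙 _ := by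
  rw [← cancel_epi (h.tmk (h.genπ M) (h.genπ N)), tmk_tmap, Category.comp_id, Category.comp_id,
    Category.comp_id]

lemma tmap_comp {M M' M'' N N' N'' : C} (f₁ : M ⟶ M') (f₂ : N ⟶ N') (g₁ : M' ⟶ M'')
    (g₂ : N' ⟶ N'') : h.tmap f₁ f₂ ≫ h.tmap g₁ g₂ = h.tmap (f₁ ≫ g₁) (f₂ ≫ g₂) := by
  rw [← cancel_epi (h.tmk (h.genπ M) (h.genπ N)), tmk_tmap_assoc, tmk_tmap, tmk_tmap,
    Category.assoc, Category.assoc]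

lemma tassoc_naturality {M₁ M₂ M₃ N₁ N₂ N₃ : C} (f₁ : M₁ ⟶ N₁) (f₂ : M₂ ⟶ N₂) (f₃ : M₃ ⟶ N₃) :
    h.tmap (h.tmap f₁ f₂) f₃ ≫ (h.tassoc N₁ N₂ N₃).hom =
      (h.tassoc M₁ M₂ M₃).hom ≫ h.tmap f₁ (h.tmap f₂ f₃) := by
  rw [← cancel_epi (h.tmk (h.tmk (h.genπ M₁) (h.genπ M₂)) (h.genπ M₃)), tmk_tmap_assoc, tmk_tmap,
    tmk_tassoc, tmk_tassoc_assoc, tmk_tmap, tmk_tmap]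

lemma tleftUnitor_naturality {M N : C} (f : M ⟶ N) :
    h.tmap (𝟙 _) f ≫ (h.tleftUnitor N).hom = (h.tleftUnitor M).hom ≫ f := by
  rw [← cancel_epi (h.tmk (𝟙 _) (h.genπ M)), tmk_tmap_assoc, Category.comp_id, tmk_tleftUnitor,
    ← Category.assoc (h.tmk _ _), tmk_tleftUnitor, Category.assoc]

lemma trightUnitor_naturality {M N : C} (f : M ⟶ N) :
    h.tmap f (𝟙 _) ≫ (h.trightUnitor N).hom = (h.trightUnitor M).hom ≫ f := by
  rw [← cancel_epi (h.tmk (h.genπ M) (𝟙 _)), tmk_tmap_assoc, Category.comp_id, tmk_trightUnitor,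
    ← Category.assoc (h.tmk _ _), tmk_trightUnitor, Category.assoc]

/-- After the epimorphism `tmk` from an object of the image, each constraint becomes `t` of the
constraint of `T`, so the identity is the image of the pentagon of `T`. The triangle and the
hexagons are proved in the same way. -/
lemma tpentagon (M N P Q : C) :
    h.tmap (h.tassoc M N P).hom (𝟙 Q) ≫ (h.tassoc M (h.tensor N P) Q).hom ≫
        h.tmap (𝟙 M) (h.tassoc N P Q).hom =
      (h.tassoc (h.tensor M N) P Q).hom ≫ (h.tassoc M N (h.tensor P Q)).hom := by
  rw [← cancel_epi (h.tmk (h.tmk (h.tmk (h.genπ M) (h.genπ N)) (h.genπ P)) (h.genπ Q)),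
    tmk_tmap_assoc, tmk_tassoc, Category.comp_id, map_tmk, Category.assoc, tmk_tassoc_assoc,
    tmk_tmap, tmk_tassoc, Category.comp_id, tmk_map, tmk_tassoc_assoc, tmk_tassoc]
  simp only [← Category.assoc, ← t.map_comp]
  rw [Category.assoc, pentagon]

lemma ttriangle (M N : C) :
    (h.tassoc M (t.obj (𝟙_ T)) N).hom ≫ h.tmap (𝟙 M) (h.tleftUnitor N).hom =
      h.tmap (h.trightUnitor M).hom (𝟙 N) := by
  rw [← cancel_epi (h.tmk (h.tmk (h.genπ M) (𝟙 _)) (h.genπ N)), tmk_tassoc_assoc, tmk_tmap,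
    tmk_tleftUnitor, Category.comp_id, tmk_map, tmk_tmap, tmk_trightUnitor, map_tmk,
    Category.comp_id, ← Category.assoc, ← t.map_comp, triangle]

lemma tbraid_naturality {M M' N N' : C} (f : M ⟶ M') (g : N ⟶ N') :
    h.tmap f g ≫ (h.tbraid M' N').hom = (h.tbraid M N).hom ≫ h.tmap g f := by
  rw [← cancel_epi (h.tmk (h.genπ M) (h.genπ N)), tmk_tmap_assoc, tmk_tbraid, tmk_tbraid_assoc,
    tmk_tmap]

lemma thexagon_forward (M N P : C) :
    (h.tassoc M N P).hom ≫ (h.tbraid M (h.tensor N P)).hom ≫ (h.tassoc N P M).hom =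
      h.tmap (h.tbraid M N).hom (𝟙 P) ≫ (h.tassoc N M P).hom ≫
        h.tmap (𝟙 N) (h.tbraid M P).hom := by
  rw [← cancel_epi (h.tmk (h.tmk (h.genπ M) (h.genπ N)) (h.genπ P)), tmk_tassoc_assoc,
    tmk_tbraid_assoc, tmk_tassoc, tmk_tmap_assoc, tmk_tbraid, map_tmk, Category.comp_id,
    Category.assoc, tmk_tassoc_assoc, tmk_tmap, tmk_tbraid, tmk_map, Category.comp_id]
  simp only [← Category.assoc, ← t.map_comp]
  rw [Category.assoc, BraidedCategory.hexagon_forward, Category.assoc]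

lemma thexagon_reverse (M N P : C) :
    (h.tassoc M N P).inv ≫ (h.tbraid (h.tensor M N) P).hom ≫ (h.tassoc P M N).inv =
      h.tmap (𝟙 M) (h.tbraid N P).hom ≫ (h.tassoc M P N).inv ≫
        h.tmap (h.tbraid M P).hom (𝟙 N) := by
  rw [← cancel_epi (h.tmk (h.genπ M) (h.tmk (h.genπ N) (h.genπ P))), tmk_tassoc_inv_assoc,
    tmk_tbraid_assoc, tmk_tassoc_inv, tmk_tmap_assoc, tmk_tbraid, tmk_map, Category.comp_id,
    Category.assoc, tmk_tassoc_inv_assoc, tmk_tmap, tmk_tbraid, map_tmk, Category.comp_id]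
  simp only [← Category.assoc, ← t.map_comp]
  rw [Category.assoc, BraidedCategory.hexagon_reverse, Category.assoc]

@[reducible]
def monoidalCategoryStruct : MonoidalCategoryStruct C where
  tensorObj := h.tensor
  tensorUnit := t.obj (𝟙_ T)
  tensorHom := h.tmap
  whiskerLeft M _ _ f := h.tmap (𝟙 M) f
  whiskerRight f M := h.tmap f (𝟙 M)
  associator := h.tassoc
  leftUnitor := h.tleftUnitor
  rightUnitor := h.trightUnitor

/-- The monoidal structure on the scalar extension. -/
@[reducible]
def monoidalCategory : MonoidalCategory C :=
  letI := h.monoidalCategoryStruct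
  MonoidalCategory.ofTensorHom h.tmap_id (fun _ _ _ _ => rfl) (fun _ _ => rfl) h.tmap_comp
    h.tassoc_naturality h.tleftUnitor_naturality h.trightUnitor_naturality h.tpentagon h.ttriangle

/-- The symmetry of the monoidal structure on the scalar extension. -/
@[reducible]
def symmetricCategory : @SymmetricCategory C _ h.monoidalCategory :=
  letI := h.monoidalCategory
  { braiding := h.tbraid
    braiding_naturality_right := fun _ _ _ _ => h.tbraid_naturality _ _
    braiding_naturality_left := fun _ _ => h.tbraid_naturality _ _
    hexagon_forward := h.thexagon_forward
    hexagon_reverse := h.thexagon_reverse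
    symmetry := fun M N => (h.tbraid M N).hom_inv_id }

def tmkIso (X Y : T) : h.tensor (t.obj X) (t.obj Y) ≅ t.obj (X ⊗ Y) where
  hom := tdesc (h := h)
    { app := fun x y => h.box x y
      naturality_left := fun f x y => by rw [← h.box_comp, Category.id_comp]
      naturality_right := fun f x y => by rw [← h.box_comp, Category.id_comp] }
  inv := h.tmk (𝟙 _) (𝟙 _)
  hom_inv_id := by
    rw [← cancel_epi (h.tmk (𝟙 (t.obj X)) (𝟙 (t.obj Y))), ← Category.assoc, tmk_tdesc]
    change h.box _ _ ≫ _ = _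
    rw [h.box_id, Category.id_comp, Category.comp_id]
  inv_hom_id := by
    rw [tmk_tdesc]
    exact h.box_id _ _

lemma tmk_tmkIso {A B X Y : T} (x : t.obj A ⟶ t.obj X) (y : t.obj B ⟶ t.obj Y) :
    h.tmk x y ≫ (h.tmkIso X Y).hom = h.box x y :=
  tmk_tdesc _ _ _

/-- The scalar extension functor is symmetric monoidal. -/
@[reducible]
def braided : letI := h.monoidalCategory; letI := h.symmetricCategory; t.Braided :=
  letI := h.monoidalCategory
  letI := h.symmetricCategory
  letI : t.Monoidal := Functor.CoreMonoidal.toMonoidal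
    { εIso := Iso.refl _
      μIso := h.tmkIso
      μIso_hom_natural_left := fun {X Y} f X' => by
        rw [← cancel_epi (h.tmk (𝟙 (t.obj X)) (𝟙 (t.obj X')))]
        change _ ≫ h.tmap _ _ ≫ _ = _
        rw [← Category.assoc, tmk_tmap, ← Category.assoc, tmk_tmkIso, tmk_tmkIso, h.box_id,
          Category.id_comp, Category.id_comp, Category.id_comp, ← t.map_id, h.box_map,
          tensorHom_id]
      μIso_hom_natural_right := fun {X Y} X' f => by
        rw [← cancel_epi (h.tmk (𝟙 (t.obj X')) (𝟙 (t.obj X)))]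
        change _ ≫ h.tmap _ _ ≫ _ = _
        rw [← Category.assoc, tmk_tmap, ← Category.assoc, tmk_tmkIso, tmk_tmkIso, h.box_id,
          Category.id_comp, Category.id_comp, Category.id_comp, ← t.map_id, h.box_map,
          id_tensorHom]
      associativity := fun X Y Z => by
        rw [← cancel_epi (h.tmk (h.tmk (𝟙 (t.obj X)) (𝟙 (t.obj Y))) (𝟙 (t.obj Z)))]
        change _ ≫ h.tmap _ (𝟙 _) ≫ _ = _ ≫ (h.tassoc _ _ _).hom ≫ h.tmap (𝟙 _) _ ≫ _
        rw [← Category.assoc, tmk_tmap, tmk_tmkIso, ← Category.assoc, tmk_tmkIso,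
          ← Category.assoc, tmk_tassoc, Category.assoc, ← Category.assoc (h.tmk _ _), tmk_tmap,
          tmk_tmkIso, tmk_tmkIso, Category.comp_id, h.box_id, h.box_id, Category.comp_id,
          h.box_id, h.box_id, Category.id_comp, Category.comp_id]
      left_unitality := fun X => by
        rw [← cancel_epi (h.tmk (𝟙 _) (𝟙 (t.obj X)))]
        change _ ≫ (h.tleftUnitor _).hom = _ ≫ h.tmap _ (𝟙 _) ≫ _
        rw [tmk_tleftUnitor, ← Category.assoc (h.tmk _ _), tmk_tmap, ← Category.assoc (h.tmk _ _)]
        change _ = (h.tmk (𝟙 _ ≫ 𝟙 _) _ ≫ _) ≫ _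
        rw [tmk_tmkIso, Category.comp_id, Category.comp_id, Category.comp_id, h.box_id,
          Category.id_comp]
      right_unitality := fun X => by
        rw [← cancel_epi (h.tmk (𝟙 (t.obj X)) (𝟙 _))]
        change _ ≫ (h.trightUnitor _).hom = _ ≫ h.tmap (𝟙 _) _ ≫ _
        rw [tmk_trightUnitor, ← Category.assoc (h.tmk _ _), tmk_tmap, ← Category.assoc (h.tmk _ _)]
        change _ = (h.tmk _ (𝟙 _ ≫ 𝟙 _) ≫ _) ≫ _
        rw [tmk_tmkIso, Category.comp_id, Category.comp_id, Category.comp_id, h.box_id,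
          Category.id_comp] }
  { braided := fun X Y => by
      rw [← cancel_epi (h.tmk (𝟙 (t.obj X)) (𝟙 (t.obj Y)))]
      change _ ≫ (h.tmkIso _ _).hom ≫ _ = _ ≫ (h.tbraid _ _).hom ≫ (h.tmkIso _ _).hom
      rw [← Category.assoc, tmk_tmkIso, ← Category.assoc, tmk_tbraid, Category.assoc, tmk_tmkIso,
        h.box_id, h.box_id, Category.id_comp, Category.comp_id] }

/-- The generators of `N₂` cover `N₃` through `e`. A morphism to these generators that `e` kills
lifts locally to `N₁`, where `k` vanishes; so `k` defines a family on `N₃`, for each fixed morphism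
to `M`, and hence a family in two variables. -/
lemma exists_tensorLeft_desc {M N₁ N₂ N₃ P : C} {f : N₁ ⟶ N₂} {g : N₂ ⟶ N₃} (w : f ≫ g = 0)
    (hS : (ShortComplex.mk f g w).Exact) [Epi g] (k : h.tensor M N₂ ⟶ P)
    (hk : h.tmap (𝟙 M) f ≫ k = 0) : ∃ k', h.tmap (𝟙 M) g ≫ k' = k := by
  let e := h.genπ N₂ ≫ g
  have he {A : T} (x : t.obj A ⟶ M) (Z : T) (z : t.obj Z ⟶ t.obj (h.gen N₂)) (hz : z ≫ e = 0) :
      h.box (𝟙 (t.obj A)) z ≫ h.tmk x (h.genπ N₂) ≫ k = 0 := by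
    obtain ⟨B, q, hq, l, hl⟩ := h.exists_lift_of_exact hS (z ≫ h.genπ N₂) (by simpa [e] using hz)
    have := h.epi_box (𝟙 A) q
    dsimp at hl
    rw [← cancel_epi (h.box (t.map (𝟙 A)) (t.map q)), comp_zero, ← Category.assoc, ← h.box_comp,
      ← Category.assoc, ← tmk_comp, Category.comp_id, Category.assoc, ← hl, t.map_id,
      Category.id_comp, ← Category.comp_id x, ← tmk_tmap, Category.assoc, hk, comp_zero]
  let γ {A : T} (x : t.obj A ⟶ M) : (h.leftExt A).Family N₃ P :=
    ExtFun.Family.ofEpi h e (h.tmk x (h.genπ N₂) ≫ k) (he x)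
  have hγ {A : T} (x : t.obj A ⟶ M) : (γ x).app e = h.tmk x (h.genπ N₂) ≫ k :=
    ExtFun.Family.ofEpi_app _ _ _ _
  let β : h.BiFamily M N₃ P := BiFamily.ofFamilies' e γ (fun f x => by
    refine (hγ _).trans (Eq.trans ?_ (congrArg (h.box f (𝟙 _) ≫ ·) (hγ x).symm))
    rw [comp_tmk, Category.assoc])
  refine ⟨tdesc β, ?_⟩
  rw [← cancel_epi (h.tmk (h.genπ M) (h.genπ N₂)), ← Category.assoc, tmk_tmap, tmk_tdesc,
    Category.comp_id]
  exact hγ _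

/-- Uniqueness of the descended morphism comes from preservation of epimorphisms, so only its
existence has to be supplied. -/
lemma preservesFiniteColimits_of_exists_desc {A B : Type*} [Category* A] [Category* B] [Abelian A]
    [Abelian B] (G : A ⥤ B) [G.Additive] (epi : ∀ {X Y : A} (f : X ⟶ Y), Epi f → Epi (G.map f))
    (desc : ∀ (S : ShortComplex A) (_ : S.Exact) (_ : Epi S.g) {P : B} (k : G.obj S.X₂ ⟶ P),
      G.map S.f ≫ k = 0 → ∃ k', G.map S.g ≫ k' = k) : PreservesFiniteColimits G := by
  refine ((Functor.preservesFiniteColimits_tfae G).out 3 1).2 fun S hS => ?_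
  have := hS.2
  have hepi : Epi (S.map G).g := epi S.g hS.2
  refine ⟨?_, hepi⟩
  obtain ⟨k', hk'⟩ := desc S hS.1 hS.2 (cokernel.π (G.map S.f)) (cokernel.condition _)
  refine ShortComplex.exact_of_g_is_cokernel _ (CokernelCofork.IsColimit.ofπ _ _
    (fun {P} k hk => (desc S hS.1 hS.2 k hk).choose)
    (fun {P} k hk => (desc S hS.1 hS.2 k hk).choose_spec) (fun {P} k hk m hm => ?_))
  exact (cancel_epi (S.map G).g).1 (hm.trans (desc S hS.1 hS.2 k hk).choose_spec.symm)

theorem isTensorCategory (hT : IsTensorCategory F T) :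
    letI := h.monoidalCategory
    letI := h.symmetricCategory
    IsTensorCategory F' C :=
  letI := h.monoidalCategory
  letI := h.symmetricCategory
  have hp : MonoidalPreadditive C :=
    { whiskerLeft_zero := fun {M N P} => by
        change h.tmap _ _ = _
        rw [← cancel_epi (h.tmk (h.genπ M) (h.genπ N)), tmk_tmap, comp_zero, tmk_zero, comp_zero]
      zero_whiskerRight := fun {M N P} => by
        change h.tmap _ _ = _
        rw [← cancel_epi (h.tmk (h.genπ N) (h.genπ M)), tmk_tmap, comp_zero, zero_tmk, comp_zero]
      whiskerLeft_add := fun {M N P} f g => by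
        change h.tmap _ _ = h.tmap _ _ + h.tmap _ _
        rw [← cancel_epi (h.tmk (h.genπ M) (h.genπ N)), Preadditive.comp_add, tmk_tmap, tmk_tmap,
          tmk_tmap, Preadditive.comp_add, tmk_add]
      add_whiskerRight := fun {M N P} f g => by
        change h.tmap _ _ = h.tmap _ _ + h.tmap _ _
        rw [← cancel_epi (h.tmk (h.genπ N) (h.genπ M)), Preadditive.comp_add, tmk_tmap, tmk_tmap,
          tmk_tmap, Preadditive.comp_add, add_tmk] }
  have hl : MonoidalLinear F' C :=
    { whiskerLeft_smul := fun M {N P} a f => by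
        change h.tmap _ _ = a • h.tmap _ _
        rw [← cancel_epi (h.tmk (h.genπ M) (h.genπ N)), Linear.comp_smul, tmk_tmap, tmk_tmap,
          Linear.comp_smul, tmk_smul]
      smul_whiskerRight := fun a {N P} f M => by
        change h.tmap _ _ = a • h.tmap _ _
        rw [← cancel_epi (h.tmk (h.genπ N) (h.genπ M)), Linear.comp_smul, tmk_tmap, tmk_tmap,
          Linear.comp_smul, smul_tmk] }
  have hleft (M : C) : PreservesFiniteColimits (tensorLeft M) := by
    refine preservesFiniteColimits_of_exists_desc _ (fun {N P} f hf => ?_)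
      (fun S hS hg P k hk => h.exists_tensorLeft_desc S.zero hS k hk)
    have : Epi (h.tmk (h.genπ M) (h.genπ N) ≫ h.tmap (𝟙 M) f) := by
      rw [tmk_tmap]
      infer_instance
    exact epi_of_epi (h.tmk (h.genπ M) (h.genπ N)) (h.tmap (𝟙 M) f)
  { rightExact_left := hleft
    rightExact_right := fun M =>
      preservesFiniteColimits_of_natIso (BraidedCategory.tensorLeftIsoTensorRight M)
    -- By the description of morphisms, `End(t 𝟙)` is `F' ⊗ End(𝟙) = F'`. Injectivity amounts to `t
    -- 𝟙 ≠ 0`, which holds because `End(𝟙) = F` is nonzero.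
    end_unit := by
      constructor
      · rw [injective_iff_map_eq_zero]
        intro a ha
        by_contra hne
        have h1 : (𝟙 (t.obj (𝟙_ T))) = 0 := by
          have h2 : a • 𝟙 (t.obj (𝟙_ T)) = 0 := ha
          rw [← one_smul F' (𝟙 (t.obj (𝟙_ T))), ← inv_mul_cancel₀ hne, mul_smul, h2, smul_zero]
        have h3 := h.eq_zero (n := 1) (a := fun _ => 1)
          (LinearIndependent.of_subsingleton 0 one_ne_zero) (fun _ => 𝟙 (𝟙_ T)) (by simpa) 0
        have h4 : algebraMap F (End (𝟙_ T)) 1 = algebraMap F (End (𝟙_ T)) 0 := by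
          rw [map_one, map_zero]
          exact h3
        exact one_ne_zero (hT.end_unit.1 h4)
      · intro f
        obtain ⟨n, a, g, hg⟩ := h.exists_sum (X := 𝟙_ T) (Y := 𝟙_ T) f
        choose r hr using fun i => hT.end_unit.2 (g i)
        refine ⟨∑ i, a i * algebraMap F F' (r i), ?_⟩
        change (∑ i, a i * algebraMap F F' (r i)) • 𝟙 (t.obj (𝟙_ T)) = f
        rw [hg, Finset.sum_smul]
        refine Finset.sum_congr rfl fun i _ => ?_
        have h5 : g i = r i • 𝟙 (𝟙_ T) := (hr i).symm
        rw [h5, h.map_smul, t.map_id, mul_smul] }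

end IsScalarExtension

end

/-! ### The unit object of a pre-Tannakian category is simple -/

section

variable {F : Type w} [Field F] {T : Type*} [Category.{v} T] [Abelian T] [Linear F T]
  [MonoidalCategory T] [SymmetricCategory T]

namespace IsPreTannakian

/-- A dual of an object. -/
def dual (hT : IsPreTannakian F T) (X : T) : T := (hT.rigid X).choose

@[reducible]
def pairing (hT : IsPreTannakian F T) (X : T) : ExactPairing X (hT.dual X) :=
  (hT.rigid X).choose_spec.some

/-- Tensoring with `W` is right adjoint to tensoring with its dual, so it is left exact. -/
lemma mono_whiskerLeft (hT : IsPreTannakian F T) (W : T) {X Y : T} (f : X ⟶ Y) [Mono f] :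
    Mono (W ◁ f) := by
  have := hT.pairing W
  have : PreservesLimitsOfSize.{0, 0} (tensorLeft W) :=
    (tensorLeftAdjunction W (hT.dual W)).rightAdjoint_preservesLimits
  exact inferInstanceAs (Mono ((tensorLeft W).map f))

lemma mono_whiskerRight (hT : IsPreTannakian F T) (W : T) {X Y : T} (f : X ⟶ Y) [Mono f] :
    Mono (f ▷ W) := by
  have := hT.mono_whiskerLeft W f
  have h : f ▷ W = (β_ X W).hom ≫ W ◁ f ≫ (β_ W Y).hom := by
    rw [BraidedCategory.braiding_naturality_right, ← Category.assoc,
      SymmetricCategory.symmetry, Category.id_comp]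
  rw [h]
  infer_instance

lemma epi_whiskerLeft (hT : IsPreTannakian F T) (W : T) {X Y : T} (f : X ⟶ Y) [Epi f] :
    Epi (W ◁ f) :=
  have := hT.rightExact_left W
  inferInstanceAs (Epi ((tensorLeft W).map f))

lemma eq_smul_id (hT : IsPreTannakian F T) (f : 𝟙_ T ⟶ 𝟙_ T) : ∃ r : F, f = r • 𝟙 (𝟙_ T) := by
  obtain ⟨r, hr⟩ := hT.end_unit.2 f
  exact ⟨r, hr.symm⟩

lemma isIso_of_ne_zero (hT : IsPreTannakian F T) (f : 𝟙_ T ⟶ 𝟙_ T) (hf : f ≠ 0) : IsIso f := by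
  obtain ⟨r, rfl⟩ := hT.eq_smul_id f
  have hr : r ≠ 0 := by
    rintro rfl
    exact hf (zero_smul _ _)
  exact ⟨r⁻¹ • 𝟙 _, by simp [smul_smul, hr], by simp [smul_smul, hr]⟩

/-- The transpose of a monomorphism to the unit is an epimorphism. -/
lemma epi_transpose (hT : IsPreTannakian F T) {U D : T} [ExactPairing U D] (i : U ⟶ 𝟙_ T)
    [Mono i] : Epi (η_ U D ≫ i ▷ D ≫ (λ_ D).hom) := by
  have := hT.toMonoidalPreadditive
  refine Preadditive.epi_of_cancel_zero _ fun {W} g hg => ?_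
  have h1 : η_ U D ≫ U ◁ g = 0 := by
    have := hT.mono_whiskerRight W i
    rw [← cancel_mono (i ▷ W), ← cancel_mono (λ_ W).hom, Category.assoc, Category.assoc,
      whisker_exchange_assoc, leftUnitor_naturality, zero_comp, zero_comp]
    simpa using hg
  -- Under the duality between `U` and `D`, the morphism `g : D ⟶ W` corresponds to `η ≫ U ◁ g`,
  -- which has just been shown to vanish because `i ▷ W` is a monomorphism.
  have h2 : tensorLeftHomEquiv (𝟙_ T) U D W ((ρ_ D).hom ≫ g) = 0 := by
    have : tensorLeftHomEquiv (𝟙_ T) U D W ((ρ_ D).hom ≫ g) = η_ U D ≫ U ◁ g := by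
      simp only [tensorLeftHomEquiv, Equiv.coe_fn_mk]
      rw [whiskerLeft_comp]
      have h3 : (α_ U D (𝟙_ T)).hom ≫ U ◁ (ρ_ D).hom = (ρ_ _).hom := by simp
      rw [reassoc_of% h3, rightUnitor_naturality_assoc, ← unitors_equal, Iso.inv_hom_id_assoc]
    rw [this, h1]
  have h4 : (ρ_ D).hom ≫ g = 0 := by
    apply (tensorLeftHomEquiv (𝟙_ T) U D W).injective
    rw [h2]
    simp [tensorLeftHomEquiv]
  rwa [← cancel_epi (ρ_ D).hom, comp_zero]

open ZeroObject in
/-- Every nonzero subobject of the unit is the unit. -/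
lemma epi_of_mono_unit (hT : IsPreTannakian F T) {U : T} (i : U ⟶ 𝟙_ T) [Mono i]
    (hi : i ≠ 0) : Epi i := by
  have := hT.toMonoidalPreadditive
  have := hT.pairing U
  let D := hT.dual U
  -- The transpose `s` of `i` is an epimorphism. By the zigzag identity, the inclusion `j` of its
  -- kernel becomes zero after tensoring with `U`; since tensoring is exact, `U ⊗ kernel s = 0` and
  -- `U ◁ s` is an isomorphism.
  let s : 𝟙_ T ⟶ D := η_ U D ≫ i ▷ D ≫ (λ_ D).hom
  have hs : Epi s := hT.epi_transpose i
  let j := kernel.ι s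
  have hj : j ▷ U = 0 := by
    have h1 : j ≫ η_ U D ≫ i ▷ D = 0 := by
      have := kernel.condition s
      rw [← cancel_mono (λ_ D).hom]
      simpa [s, j] using this
    have h2 : (λ_ U).inv ≫ η_ U D ▷ U ≫ (α_ U D U).hom ≫ U ◁ ε_ U D ≫ (ρ_ U).hom = 𝟙 U := by
      rw [ExactPairing.evaluation_coevaluation_assoc]
      simp
    have h3 : j ▷ U ≫ (λ_ U).hom ≫ i = 0 := by
      have h4 : (j ≫ η_ U D ≫ i ▷ D) ▷ U = 0 := by rw [h1, MonoidalPreadditive.zero_whiskerRight]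
      have h5 : (j ≫ η_ U D ≫ i ▷ D) ▷ U ≫ (α_ _ D U).hom ≫ 𝟙_ T ◁ ε_ U D ≫ (ρ_ _).hom =
          j ▷ U ≫ (λ_ U).hom ≫ i := by
        have h6 : i ▷ D ▷ U ≫ (α_ _ D U).hom ≫ 𝟙_ T ◁ ε_ U D ≫ (ρ_ _).hom =
            (α_ _ D U).hom ≫ U ◁ ε_ U D ≫ (ρ_ _).hom ≫ i := by
          rw [associator_naturality_left_assoc, ← whisker_exchange_assoc, rightUnitor_naturality]
        rw [comp_whiskerRight, comp_whiskerRight, Category.assoc, Category.assoc, h6]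
        have h7 := congrArg (fun k => (λ_ U).hom ≫ k ≫ i) h2
        simp only [Category.assoc, Iso.hom_inv_id_assoc, Category.id_comp] at h7
        rw [h7]
      rw [← h5, h4, zero_comp]
    have h8 : j ▷ U ≫ (λ_ U).hom = 0 := by
      rw [← cancel_mono i, Category.assoc, h3, zero_comp]
    rwa [← cancel_mono (λ_ U).hom, zero_comp]
  have hUj : U ◁ j = 0 := by
    rw [← cancel_mono (β_ _ _).hom, BraidedCategory.braiding_naturality_right, hj, comp_zero,
      zero_comp]
  have hUK : IsZero (U ⊗ kernel s) := by
    have := hT.mono_whiskerLeft U j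
    rw [IsZero.iff_id_eq_zero, ← cancel_mono (U ◁ j), hUj, comp_zero, comp_zero]
  have hepi := hT.epi_whiskerLeft U s
  have hmono : Mono (U ◁ s) := by
    have := hT.pairing U
    have : PreservesLimitsOfSize.{0, 0} (tensorLeft U) :=
      (tensorLeftAdjunction U (hT.dual U)).rightAdjoint_preservesLimits
    have hadd : (tensorLeft U).Additive := inferInstance
    refine Preadditive.mono_of_kernel_zero ?_
    have h9 := (PreservesKernel.iso (tensorLeft U) s).symm
    have : IsZero (kernel ((tensorLeft U).map s)) := hUK.of_iso h9
    exact this.eq_of_src _ _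
  have : IsIso (U ◁ s) := isIso_of_mono_of_epi _
  -- As `U ⊗ D` is identified with `U`, coevaluation becomes a nonzero morphism `𝟙 ⟶ U`. Then `r ≫
  -- i` is a nonzero element of the field `End(𝟙)`, hence invertible, and `i` is an epimorphism.
  let r : 𝟙_ T ⟶ U := η_ U D ≫ inv (U ◁ s) ≫ (ρ_ U).hom
  have hr : r ≠ 0 := by
    intro h0
    have h1 : η_ U D = 0 := by
      rw [← cancel_mono (inv (U ◁ s) ≫ (ρ_ U).hom), zero_comp]
      exact h0
    have h2 : η_ U D ▷ U ≫ (α_ U D U).hom ≫ U ◁ ε_ U D = 0 := by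
      rw [h1, MonoidalPreadditive.zero_whiskerRight, zero_comp]
    rw [ExactPairing.evaluation_coevaluation] at h2
    have h3 : 𝟙 U = 0 := by
      rw [← cancel_epi (λ_ U).hom, ← cancel_mono (ρ_ U).inv, Category.comp_id, h2, comp_zero,
        zero_comp]
    exact hi (by rw [← Category.id_comp i, h3, zero_comp])
  have hri : r ≫ i ≠ 0 := fun h0 => hr (by rw [← cancel_mono i, h0, zero_comp])
  have := hT.isIso_of_ne_zero _ hri
  exact epi_of_epi r i

lemma epi_of_ne_zero (hT : IsPreTannakian F T) {Y : T} (f : Y ⟶ 𝟙_ T) (hf : f ≠ 0) : Epi f := by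
  have hi : Abelian.image.ι f ≠ 0 := fun h0 => hf (by
    rw [← Abelian.image.fac f, h0, comp_zero])
  have := hT.epi_of_mono_unit (Abelian.image.ι f) hi
  rw [← Abelian.image.fac f]
  exact epi_comp _ _

end IsPreTannakian

/-- A nonzero morphism to the unit of the scalar extension becomes, after restriction to a
subobject, a multiple of an epimorphism of `T`. -/
lemma IsScalarExtension.exists_epi_unit {F' : Type w} [Field F'] [Algebra F F'] {C : Type*}
    [Category.{v} C] [Abelian C] [Linear F' C] {t : T ⥤ C}
    (h : IsScalarExtension F (F' := F') t) (hT : IsPreTannakian F T) {Y : T}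
    (u : t.obj Y ⟶ t.obj (𝟙_ T)) (hu : u ≠ 0) :
    ∃ (Y' : T) (j : Y' ⟶ Y) (e : Y' ⟶ 𝟙_ T) (a : F'), Epi e ∧ a ≠ 0 ∧
      t.map j ≫ u = a • t.map e := by
  have := h.additive
  obtain ⟨n, a, f, rfl⟩ := h.exists_sum u
  induction n generalizing Y with
  | zero => simp at hu
  | succ n ih =>
    -- A nonzero `f 0` is an epimorphism, and restriction to its kernel removes one term of the sum.
    -- If the restricted sum is nonzero, induction applies. If it is zero, `u` factors through `t (f
    -- 0)` by an element of `End(t 𝟙)`, that is, by a scalar.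
    by_cases h0 : f 0 = 0
    · have h1 : ∑ i, a i • t.map (f i) = ∑ i : Fin n, a i.succ • t.map (f i.succ) := by
        rw [Fin.sum_univ_succ, h0, t.map_zero, smul_zero, zero_add]
      rw [h1] at hu ⊢
      exact ih _ _ hu
    · have := hT.epi_of_ne_zero _ h0
      let k := kernel.ι (f 0)
      have h1 : t.map k ≫ ∑ i, a i • t.map (f i) =
          ∑ i : Fin n, a i.succ • t.map (k ≫ f i.succ) := by
        rw [Fin.sum_univ_succ, Preadditive.comp_add, Linear.comp_smul, ← t.map_comp,
          kernel.condition, t.map_zero, smul_zero, zero_add, Preadditive.comp_sum]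
        simp only [Linear.comp_smul, t.map_comp]
      by_cases h2 : t.map k ≫ ∑ i, a i • t.map (f i) = 0
      · have := h.preservesFiniteColimits
        have := h.preservesFiniteLimits
        obtain ⟨c, hc⟩ := h.idExt.exists_desc (f 0) inferInstance _ h2
        change t.map (f 0) ≫ c = _ at hc
        obtain ⟨m, b, g, rfl⟩ := h.exists_sum (X := 𝟙_ T) (Y := 𝟙_ T) c
        choose r hr using fun i => hT.eq_smul_id (g i)
        have h3 : ∑ i, b i • t.map (g i) =
            (∑ i, b i * algebraMap F F' (r i)) • 𝟙 (t.obj (𝟙_ T)) := by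
          rw [Finset.sum_smul]
          refine Finset.sum_congr rfl fun i _ => ?_
          rw [hr, h.map_smul, t.map_id, mul_smul]
        rw [h3, Linear.comp_smul, Category.comp_id] at hc
        refine ⟨Y, 𝟙 Y, f 0, ∑ i, b i * algebraMap F F' (r i), inferInstance, ?_, ?_⟩
        rotate_left
        · rw [t.map_id, Category.id_comp, ← hc]
        · intro h4
          rw [h4, zero_smul] at hc
          exact hu hc.symm
      · rw [h1] at h2
        obtain ⟨Y', j, e, b, he, hb, hj⟩ := ih _ _ h2
        refine ⟨Y', j ≫ k, e, b, he, hb, ?_⟩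
        rw [t.map_comp, Category.assoc, h1, hj]

end

/-! ### Minors and regular maps -/

section Minors

variable {A : Type*} [CommRing A] {P L : Type*} (Φ : P → L → A)

/-- The minor of a matrix given by a choice of rows and columns. -/
def minor {n : ℕ} (x : Fin n → P) (l : Fin n → L) : A :=
  (Matrix.of fun i j => Φ (x j) (l i)).det

/-- The ideal generated by the minors of size `n`. -/
def minorIdeal (n : ℕ) : Ideal A :=
  Ideal.span (Set.range fun p : (Fin n → P) × (Fin n → L) => minor Φ p.1 p.2)

/-- Laplace expansion of a minor along its first column and its first row. -/
lemma minor_cons {n : ℕ} (xs : Fin n → P) (ls : Fin n → L) :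
    ∃ m : Fin n → Fin n → A, ∀ x l, minor Φ (Fin.cons x xs) (Fin.cons l ls) =
      Φ x l * minor Φ xs ls + ∑ i, ∑ j, m i j * Φ x (ls i) * Φ (xs j) l := by
  cases n with
  | zero =>
    refine ⟨fun i => i.elim0, fun x l => ?_⟩
    simp [minor]
  | succ n =>
    -- The coefficients are signed complementary minors. They involve only `xs` and `ls`, so one
    -- choice serves all `x` and `l`.
    refine ⟨fun i j => (-1) ^ (i.succ : ℕ) * (-1) ^ (j : ℕ) *
      minor Φ (xs ∘ j.succAbove) (ls ∘ i.succAbove), fun x l => ?_⟩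
    rw [minor, Matrix.det_succ_column_zero, Fin.sum_univ_succ]
    congr 1
    · simp only [Matrix.of_apply, Fin.val_zero, pow_zero, one_mul, Fin.cons_zero]
      congr 1
    · refine Finset.sum_congr rfl fun i _ => ?_
      rw [Matrix.det_succ_row_zero, Finset.mul_sum]
      refine Finset.sum_congr rfl fun j _ => ?_
      have h1 : ((Matrix.of fun i j => Φ (Fin.cons (α := fun _ => P) x xs j)
          (Fin.cons (α := fun _ => L) l ls i)).submatrix i.succ.succAbove Fin.succ) 0 j =
          Φ (xs j) l := by
        simp
      have h2 : ((((Matrix.of fun i j => Φ (Fin.cons (α := fun _ => P) x xs j)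
          (Fin.cons (α := fun _ => L) l ls i)).submatrix i.succ.succAbove Fin.succ).submatrix
          Fin.succ j.succAbove)).det = minor Φ (xs ∘ j.succAbove) (ls ∘ i.succAbove) := by
        rw [minor]
        congr 1
        ext a b
        simp
      rw [h1, h2]
      simp only [Matrix.of_apply, Fin.cons_zero, Fin.cons_succ]
      ring

/-- The functions of two variables of the form `(x, l) ↦ ∑ mₛ Φ(x, lₛ) Φ(xₛ, l)`. -/
def composites : Submodule A (P → L → A) :=
  Submodule.span A (Set.range fun p : P × L => fun x l => Φ x p.2 * Φ p.1 l)

lemma mem_composites (f : P → L → A) (hf : f ∈ composites Φ) :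
    ∃ (n : ℕ) (m : Fin n → A) (xs : Fin n → P) (ls : Fin n → L),
      ∀ x l, f x l = ∑ s, m s * (Φ x (ls s) * Φ (xs s) l) := by
  obtain ⟨n, m, g, hg⟩ := Submodule.mem_span_set'.1 hf
  choose p hp using fun i => (g i).2
  refine ⟨n, m, fun s => (p s).1, fun s => (p s).2, fun x l => ?_⟩
  rw [← hg, Finset.sum_apply, Finset.sum_apply]
  refine Finset.sum_congr rfl fun s _ => ?_
  rw [← hp]
  rfl

/-- If the minors of each size either all vanish or generate the unit ideal, and if they vanish
for some size, then the matrix has a generalized inverse. -/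
theorem exists_regular (hΦ : ∀ n, minorIdeal Φ n = ⊥ ∨ minorIdeal Φ n = ⊤)
    (hN : ∃ N, minorIdeal Φ N = ⊥) :
    ∃ (n : ℕ) (m : Fin n → A) (xs : Fin n → P) (ls : Fin n → L),
      ∀ x l, Φ x l = ∑ s, m s * (Φ x (ls s) * Φ (xs s) l) := by
  classical
  suffices H : ∃ N, minorIdeal Φ N = ⊤ ∧ minorIdeal Φ (N + 1) = ⊥ by
    obtain ⟨N, h1, h2⟩ := H
    refine mem_composites Φ Φ ?_
    -- Bordering an `N`-minor by `x` and `l` gives an `(N + 1)`-minor, which is zero. Its expansion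
    -- writes the `N`-minor times `Φ` as a combination of composites. The `N`-minors generate the
    -- unit ideal, so `Φ` itself is one.
    have h3 : ∀ c ∈ minorIdeal Φ N, c • Φ ∈ composites Φ := by
      intro c hc
      induction hc using Submodule.span_induction with
      | mem c hc =>
        obtain ⟨⟨xs, ls⟩, rfl⟩ := hc
        obtain ⟨m, hm⟩ := minor_cons Φ xs ls
        have h4 : ∀ x l, minor Φ (Fin.cons x xs) (Fin.cons l ls) = 0 := fun x l => by
          have : minor Φ (Fin.cons x xs) (Fin.cons l ls) ∈ minorIdeal Φ (N + 1) :=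
            Ideal.subset_span ⟨(_, _), rfl⟩
          rwa [h2] at this
        have h5 : minor Φ xs ls • Φ = ∑ i, ∑ j, (-m i j) • fun x l => Φ x (ls i) * Φ (xs j) l := by
          ext x l
          have h6 := hm x l
          rw [h4] at h6
          simp only [Pi.smul_apply, Finset.sum_apply, smul_eq_mul, neg_mul, Finset.sum_neg_distrib]
          simp only [mul_assoc] at h6
          linear_combination -h6
        change minor Φ xs ls • Φ ∈ _
        rw [h5]
        exact sum_mem fun i _ => sum_mem fun j _ => Submodule.smul_mem _ _
          (Submodule.subset_span ⟨(xs j, ls i), rfl⟩)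
      | zero => rw [zero_smul]; exact zero_mem _
      | add a b _ _ ha hb => rw [add_smul]; exact add_mem ha hb
      | smul a b _ hb => rw [smul_assoc]; exact Submodule.smul_mem _ _ hb
    have := h3 1 (by rw [h1]; trivial)
    rwa [one_smul] at this
  have hN0 : Nat.find hN = 0 ∨ ∃ k, Nat.find hN = k + 1 := by
    cases Nat.find hN with
    | zero => exact Or.inl rfl
    | succ k => exact Or.inr ⟨k, rfl⟩
  have hspec := Nat.find_spec hN
  -- The empty minor is `1`, so the least size with vanishing minors can be `0` only over the zero
  -- ring; otherwise the preceding size has unit ideal.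
  obtain h0 | ⟨k, hk⟩ := hN0
  · rw [h0] at hspec
    have h1 : (1 : A) = 0 := by
      have : minor Φ (Fin.elim0 : Fin 0 → P) Fin.elim0 ∈ minorIdeal Φ 0 :=
        Ideal.subset_span ⟨(_, _), rfl⟩
      rw [hspec] at this
      simpa [minor] using this
    have := subsingleton_of_zero_eq_one h1.symm
    exact ⟨0, Subsingleton.elim _ _, Subsingleton.elim _ _⟩
  · rw [hk] at hspec
    exact ⟨k, (hΦ k).resolve_left (Nat.find_min hN (by omega)), hspec⟩

/-- The minors of a bilinear form on a module with `m` generators vanish in sizes above `m`. -/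
lemma exists_minorIdeal_eq_bot {R M N : Type*} [CommRing R] [Algebra R A] [AddCommGroup M]
    [Module R M] [AddCommGroup N] [Module R N] [Module.Finite R M] (Ψ : M →ₗ[R] N →ₗ[R] A) :
    ∃ n, minorIdeal (fun x l => Ψ x l) n = ⊥ := by
  obtain ⟨m, p, hp⟩ := Module.Finite.exists_fin' R M
  refine ⟨m + 1, Ideal.span_eq_bot.2 ?_⟩
  rintro _ ⟨⟨xs, ls⟩, rfl⟩
  let c : M →ₗ[R] (Fin (m + 1) → A) := LinearMap.pi fun i => Ψ.flip (ls i)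
  -- For fixed `ls` the minor is an `R`-alternating form in `m + 1` elements of `M`. Pulled back to
  -- `R ^ m` it vanishes, since `m + 1` basis vectors cannot be distinct.
  let d : (Fin (m + 1) → A) [⋀^Fin (m + 1)]→ₗ[R] A :=
    { (Matrix.detRowAlternating (R := A)
        (n := Fin (m + 1))).toMultilinearMap.restrictScalars R with
      map_eq_zero_of_eq' := Matrix.detRowAlternating.map_eq_zero_of_eq' }
  let f : M [⋀^Fin (m + 1)]→ₗ[R] A := d.compLinearMap c
  have h1 : f.compLinearMap p = 0 := by
    refine Module.Basis.ext_alternating (Pi.basisFun R (Fin m)) fun v hv => ?_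
    have := Fintype.card_le_of_injective v hv
    simp at this
  choose w hw using hp
  have h2 : f xs = 0 := by
    have := congrArg (fun g => g (fun i => w (xs i))) h1
    simpa [AlternatingMap.compLinearMap_apply, hw, Function.comp_def] using this
  change Matrix.det _ = 0
  rw [← Matrix.det_transpose]
  exact h2

end Minors

/-! ### Lax monoidal functors to modules -/

section LaxMonoidal

open Functor.LaxMonoidal TensorProduct

variable {D : Type*} [Category* D] [MonoidalCategory D] {R : Type v} [CommRing R]
  (G : D ⥤ ModuleCat.{v} R) [G.LaxMonoidal]

/-- The tensor product of elements of the values of a lax monoidal functor. -/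
def mul (X Y : D) : G.obj X →ₗ[R] G.obj Y →ₗ[R] G.obj (X ⊗ Y) :=
  (TensorProduct.mk R (G.obj X) (G.obj Y)).compr₂ (μ G X Y).hom

lemma mul_eq {X Y : D} (x : G.obj X) (y : G.obj Y) : mul G X Y x y = μ G X Y (x ⊗ₜ[R] y) := rfl

/-- The unit element of the value at the unit object. -/
def one : G.obj (𝟙_ D) := ε G (1 : R)

lemma map_whiskerRight_mul {X X' Y : D} (f : X ⟶ X') (x : G.obj X) (y : G.obj Y) :
    G.map (f ▷ Y) (mul G X Y x y) = mul G X' Y (G.map f x) y := by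
  have := congrArg (fun k => k.hom (x ⊗ₜ[R] y)) (μ_natural_left G f Y)
  exact this.symm

lemma map_whiskerLeft_mul {X Y Y' : D} (f : Y ⟶ Y') (x : G.obj X) (y : G.obj Y) :
    G.map (X ◁ f) (mul G X Y x y) = mul G X Y' x (G.map f y) := by
  have := congrArg (fun k => k.hom (x ⊗ₜ[R] y)) (μ_natural_right G X f)
  exact this.symm

lemma map_tensorHom_mul {X X' Y Y' : D} (f : X ⟶ X') (g : Y ⟶ Y') (x : G.obj X) (y : G.obj Y) :
    G.map (f ⊗ₘ g) (mul G X Y x y) = mul G X' Y' (G.map f x) (G.map g y) := by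
  rw [MonoidalCategory.tensorHom_def, G.map_comp, ModuleCat.comp_apply, map_whiskerRight_mul,
    map_whiskerLeft_mul]

lemma map_associator_mul {X Y Z : D} (x : G.obj X) (y : G.obj Y) (z : G.obj Z) :
    G.map (α_ X Y Z).hom (mul G _ Z (mul G X Y x y) z) = mul G X _ x (mul G Y Z y z) :=
  congrArg (fun k => k.hom ((x ⊗ₜ[R] y) ⊗ₜ[R] z)) (associativity G X Y Z)

lemma map_associator_inv_mul {X Y Z : D} (x : G.obj X) (y : G.obj Y) (z : G.obj Z) :
    G.map (α_ X Y Z).inv (mul G X _ x (mul G Y Z y z)) = mul G _ Z (mul G X Y x y) z := by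
  rw [← map_associator_mul, ← ModuleCat.comp_apply, ← G.map_comp, Iso.hom_inv_id, G.map_id]
  rfl

lemma map_leftUnitor_mul {X : D} (x : G.obj X) :
    G.map (λ_ X).hom (mul G _ X (one G) x) = x := by
  have := congrArg (fun k => k.hom ((1 : R) ⊗ₜ[R] x)) (left_unitality G X)
  exact this.symm.trans (one_smul R x)

lemma map_rightUnitor_mul {X : D} (x : G.obj X) :
    G.map (ρ_ X).hom (mul G X _ x (one G)) = x := by
  have := congrArg (fun k => k.hom (x ⊗ₜ[R] (1 : R))) (right_unitality G X)
  exact this.symm.trans (one_smul R x)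

lemma map_braiding_mul [BraidedCategory D] (G : D ⥤ ModuleCat.{v} R) [G.LaxBraided] {X Y : D}
    (x : G.obj X) (y : G.obj Y) :
    G.map (β_ X Y).hom (mul G X Y x y) = mul G Y X y x :=
  congrArg (fun k => k.hom (x ⊗ₜ[R] y)) (Functor.LaxBraided.braided (F := G) X Y)

lemma span_mul (X Y : D) [IsIso (μ G X Y)] :
    Submodule.span R (Set.range fun p : G.obj X × G.obj Y => mul G X Y p.1 p.2) = ⊤ := by
  have h1 : Function.Surjective (μ G X Y) := ((ModuleCat.epi_iff_surjective _).1 inferInstance)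
  rw [eq_top_iff]
  rintro z -
  obtain ⟨z, rfl⟩ := h1 z
  induction z using TensorProduct.induction_on with
  | zero => rw [map_zero]; exact zero_mem _
  | tmul x y => exact Submodule.subset_span ⟨(x, y), rfl⟩
  | add a b ha hb => rw [map_add]; exact add_mem ha hb

/-- The tensor product of linear functionals. -/
def dualMul (X Y : D) [IsIso (μ G X Y)] (l : Module.Dual R (G.obj X)) (k : Module.Dual R (G.obj Y)) :
    Module.Dual R (G.obj (X ⊗ Y)) :=
  (TensorProduct.lid R R).toLinearMap ∘ₗ TensorProduct.map l k ∘ₗ (inv (μ G X Y)).hom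

lemma dualMul_mul (X Y : D) [IsIso (μ G X Y)] (l : Module.Dual R (G.obj X))
    (k : Module.Dual R (G.obj Y)) (x : G.obj X) (y : G.obj Y) :
    dualMul G X Y l k (mul G X Y x y) = l x * k y := by
  have : (inv (μ G X Y)).hom (mul G X Y x y) = x ⊗ₜ[R] y := by
    rw [mul_eq, ← ModuleCat.comp_apply, IsIso.hom_inv_id]
    rfl
  simp only [dualMul, LinearMap.comp_apply]
  rw [this]
  exact rfl

/-- The functional dual to the unit element. -/
def dualOne [IsIso (ε G)] : Module.Dual R (G.obj (𝟙_ D)) := (inv (ε G)).hom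

lemma dualOne_one [IsIso (ε G)] : dualOne G (one G) = 1 := by
  change (inv (ε G)) (ε G (1 : R)) = 1
  rw [← ModuleCat.comp_apply, IsIso.hom_inv_id]
  rfl

lemma eq_smul_one [IsIso (ε G)] (x : G.obj (𝟙_ D)) : x = dualOne G x • one G := by
  have h1 : ε G (inv (ε G) x) = x := by
    rw [← ModuleCat.comp_apply, IsIso.inv_hom_id]
    rfl
  conv_lhs => rw [← h1]
  change _ = dualOne G x • (ε G).hom (1 : R)
  rw [← map_smul]
  exact congrArg (ε G).hom (mul_one _).symm

end LaxMonoidal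

/-! ### Values of morphisms of the scalar extension under a fibre functor -/

lemma exists_projective_dual_basis (R M : Type*) [CommRing R] [AddCommGroup M] [Module R M]
    [Module.Finite R M] [Module.Projective R M] :
    ∃ (n : ℕ) (x : Fin n → M) (l : Fin n → Module.Dual R M), ∀ y, y = ∑ i, l i y • x i := by
  obtain ⟨n, p, hp⟩ := Module.Finite.exists_fin' R M
  obtain ⟨s, hs⟩ := p.exists_rightInverse_of_surjective (LinearMap.range_eq_top.2 hp)
  refine ⟨n, fun i => p (Pi.single i 1), fun i => LinearMap.proj i ∘ₗ s, fun y => ?_⟩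
  have h1 : s y = ∑ i, s y i • Pi.single i (1 : R) := by
    ext j
    simp [Finset.sum_apply, Pi.single_apply]
  have h2 : p (s y) = y := LinearMap.congr_fun hs y
  conv_lhs => rw [← h2, h1, map_sum]
  simp

lemma eq_of_dual {R M : Type*} [CommRing R] [AddCommGroup M] [Module R M]
    [Module.Finite R M] [Module.Projective R M] {x y : M}
    (h : ∀ l : Module.Dual R M, l x = l y) : x = y := by
  obtain ⟨n, z, l, hl⟩ := exists_projective_dual_basis R M
  rw [hl x, hl y]
  simp only [h]

section

open TensorProduct

variable {F F' : Type w} [Field F] [Field F'] [Algebra F F']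
  {T : Type*} [Category.{v} T] [Abelian T] [Linear F T] {C : Type*} [Category.{v} C] [Abelian C]
  [Linear F' C] {t : T ⥤ C}

namespace IsScalarExtension

variable (h : IsScalarExtension F (F' := F') t)

/-- A balanced biadditive map on `F'` and the morphisms of `T` induces an additive map on
morphisms of the scalar extension. -/
def homLift {G : Type*} [AddCommGroup G] {X Y : T} (β : F' →+ (X ⟶ Y) →+ G)
    (hβ : ∀ (r : F) (a : F') (f : X ⟶ Y), β (r • a) f = β a (r • f)) :
    (t.obj X ⟶ t.obj Y) →+ G :=
  (TensorProduct.liftAddHom β hβ).comp (h.homEquiv X Y).symm.toAddMonoidHom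

lemma homLift_smul {G : Type*} [AddCommGroup G] {X Y : T} (β : F' →+ (X ⟶ Y) →+ G)
    (hβ : ∀ (r : F) (a : F') (f : X ⟶ Y), β (r • a) f = β a (r • f)) (a : F') (f : X ⟶ Y) :
    h.homLift β hβ (a • t.map f) = β a f := by
  change TensorProduct.liftAddHom β hβ ((h.homEquiv X Y).symm (a • t.map f)) = _
  rw [homEquiv_symm_smul]
  rfl

end IsScalarExtension

end

/-! ### Values and matrix coefficients of morphisms of the scalar extension -/

section

open TensorProduct

variable {F F' : Type v} [Field F] [Field F'] [Algebra F F']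
  {T : Type u} [Category.{v} T] [Abelian T] [Linear F T] [MonoidalCategory T]
  [SymmetricCategory T] {C : Type*} [Category.{v} C] [Abelian C] [Linear F' C] {t : T ⥤ C}
  {R : Type v} [CommRing R] [Algebra F R] [Algebra F' R] [IsScalarTower F F' R]

namespace IsFibreFunctor

variable {ω : LaxBraidedFunctor T (ModuleCat.{v} R)} (hω : IsFibreFunctor F T R ω)
  (h : IsScalarExtension F (F' := F') t)

/-- The action of a morphism of the scalar extension on the values of a fibre functor over an
`F'`-algebra. -/
def map {X Y : T} : (t.obj X ⟶ t.obj Y) →+ (ω.toFunctor.obj X ⟶ ω.toFunctor.obj Y) :=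
  have := hω.additive
  h.homLift
    { toFun := fun a =>
        { toFun := fun f => algebraMap F' R a • ω.toFunctor.map f
          map_zero' := by simp
          map_add' := by simp [Functor.map_add] }
      map_zero' := by ext; simp
      map_add' := fun a b => by
        refine AddMonoidHom.ext fun f => ?_
        simp [add_smul] }
    (fun r a f => by
      change algebraMap F' R (r • a) • ω.toFunctor.map f =
        algebraMap F' R a • ω.toFunctor.map (r • f)
      rw [hω.linear, smul_smul, Algebra.smul_def, map_mul, ← IsScalarTower.algebraMap_apply,
        mul_comm])

lemma map_smul_map {X Y : T} (a : F') (f : X ⟶ Y) :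
    hω.map h (a • t.map f) = algebraMap F' R a • ω.toFunctor.map f :=
  h.homLift_smul _ _ _ _

lemma map_map {X Y : T} (f : X ⟶ Y) : hω.map h (t.map f) = ω.toFunctor.map f := by
  have := hω.map_smul_map h 1 f
  rwa [one_smul, map_one, one_smul] at this

lemma map_smul {X Y : T} (a : F') (f : t.obj X ⟶ t.obj Y) :
    hω.map h (a • f) = algebraMap F' R a • hω.map h f := by
  refine h.hom_induction (fun b f => ?_) (fun f g hf hg => ?_) f
  · rw [smul_smul, map_smul_map, map_smul_map, map_mul, mul_smul]
  · rw [smul_add, map_add, map_add, smul_add, hf, hg]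

lemma map_comp {X Y Z : T} (f : t.obj X ⟶ t.obj Y) (g : t.obj Y ⟶ t.obj Z) :
    hω.map h (f ≫ g) = hω.map h f ≫ hω.map h g := by
  refine h.hom_induction (fun a f => ?_) (fun f₁ f₂ h₁ h₂ => ?_) f
  · refine h.hom_induction (fun b g => ?_) (fun f₁ f₂ h₁ h₂ => ?_) g
    · rw [Linear.smul_comp, Linear.comp_smul, ← t.map_comp, map_smul, map_smul, map_map, map_smul,
        map_smul, map_map, map_map, ω.toFunctor.map_comp, Linear.smul_comp, Linear.comp_smul]
    · rw [Preadditive.comp_add, map_add, h₁, h₂, map_add, Preadditive.comp_add]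
  · rw [Preadditive.add_comp, map_add, h₁, h₂, map_add, Preadditive.add_comp]

/-- A fibre functor over an `F'`-algebra as an extendable functor. -/
def ext : ExtFun t (ModuleCat.{v} R) where
  obj X := ω.toFunctor.obj X
  map f := hω.map h f
  map_id X := by rw [← t.map_id, map_map, ω.toFunctor.map_id]
  map_comp f g := hω.map_comp h f g
  map_add f g := map_add _ _ _
  epi_map q _ := by
    have := hω.rightExact
    rw [map_map]
    infer_instance
  exists_desc q _ P g hg := by
    have := hω.rightExact
    rw [map_map] at hg ⊢
    exact exists_desc_of_preservesFiniteColimits ω.toFunctor q g hg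

/-- The matrix coefficients of a morphism of the scalar extension under a fibre functor. -/
def coeff {X Y : T} : (t.obj X ⟶ t.obj Y) →+
    (ω.toFunctor.obj X →ₗ[R] Module.Dual R (ω.toFunctor.obj Y) →ₗ[R] R ⊗[F] F') :=
  have := hω.additive
  h.homLift
    { toFun := fun a =>
        { toFun := fun f => ((Module.Dual.eval R (ω.toFunctor.obj Y)) ∘ₗ
            (ω.toFunctor.map f).hom).compr₂ (LinearMap.toSpanSingleton R _ ((1 : R) ⊗ₜ[F] a))
          map_zero' := by ext; simp
          map_add' := fun f g => by
            ext x l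
            simp [Functor.map_add, add_smul] }
      map_zero' := by ext; simp
      map_add' := fun a b => by
        refine AddMonoidHom.ext fun f => ?_
        ext x l
        simp [TensorProduct.tmul_add] }
    (fun r a f => by
      ext x l
      change l (ω.toFunctor.map f x) • ((1 : R) ⊗ₜ[F] (r • a)) =
        l (ω.toFunctor.map (r • f) x) • ((1 : R) ⊗ₜ[F] a)
      have : l (ω.toFunctor.map (r • f) x) = r • l (ω.toFunctor.map f x) := by
        rw [hω.linear, Algebra.smul_def]
        exact l.map_smul _ _
      rw [this, TensorProduct.tmul_smul, smul_comm, smul_assoc])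

lemma coeff_smul_map {X Y : T} (a : F') (f : X ⟶ Y) (x : ω.toFunctor.obj X)
    (l : Module.Dual R (ω.toFunctor.obj Y)) :
    hω.coeff h (a • t.map f) x l = l (ω.toFunctor.map f x) • ((1 : R) ⊗ₜ[F] a) := by
  rw [coeff, h.homLift_smul]
  rfl

lemma coeff_map {X Y : T} (f : X ⟶ Y) (x : ω.toFunctor.obj X)
    (l : Module.Dual R (ω.toFunctor.obj Y)) :
    hω.coeff h (t.map f) x l = algebraMap R _ (l (ω.toFunctor.map f x)) := by
  have := hω.coeff_smul_map h 1 f x l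
  rwa [one_smul, ← Algebra.TensorProduct.one_def, ← Algebra.algebraMap_eq_smul_one] at this

lemma coeff_smul {X Y : T} (a : F') (f : t.obj X ⟶ t.obj Y) (x : ω.toFunctor.obj X)
    (l : Module.Dual R (ω.toFunctor.obj Y)) :
    hω.coeff h (a • f) x l = (1 : R) ⊗ₜ[F] a * hω.coeff h f x l := by
  refine h.hom_induction (fun b f => ?_) (fun f g hf hg => ?_) f
  · rw [smul_smul, coeff_smul_map, coeff_smul_map, mul_smul_comm,
      Algebra.TensorProduct.tmul_mul_tmul, one_mul]
  · rw [smul_add, map_add, map_add, LinearMap.add_apply, LinearMap.add_apply, LinearMap.add_apply,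
      LinearMap.add_apply, mul_add, hf, hg]

lemma coeff_map_comp {X Y Z : T} (f : X ⟶ Y) (g : t.obj Y ⟶ t.obj Z) (x : ω.toFunctor.obj X)
    (l : Module.Dual R (ω.toFunctor.obj Z)) :
    hω.coeff h (t.map f ≫ g) x l = hω.coeff h g (ω.toFunctor.map f x) l := by
  refine h.hom_induction (fun b g => ?_) (fun f g hf hg => ?_) g
  · rw [Linear.comp_smul, ← t.map_comp, coeff_smul_map, coeff_smul_map, ω.toFunctor.map_comp]
    rfl
  · rw [Preadditive.comp_add, map_add, map_add, LinearMap.add_apply, LinearMap.add_apply,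
      LinearMap.add_apply, LinearMap.add_apply, hf, hg]

lemma coeff_comp_map {X Y Z : T} (f : t.obj X ⟶ t.obj Y) (g : Y ⟶ Z) (x : ω.toFunctor.obj X)
    (l : Module.Dual R (ω.toFunctor.obj Z)) :
    hω.coeff h (f ≫ t.map g) x l = hω.coeff h f x (l ∘ₗ (ω.toFunctor.map g).hom) := by
  refine h.hom_induction (fun b f => ?_) (fun f g hf hg => ?_) f
  · rw [Linear.smul_comp, ← t.map_comp, coeff_smul_map, coeff_smul_map, ω.toFunctor.map_comp]
    rfl
  · rw [Preadditive.add_comp, map_add, map_add, LinearMap.add_apply, LinearMap.add_apply,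
      LinearMap.add_apply, LinearMap.add_apply, hf, hg]

variable (F F' R) in
/-- The multiplication map of the scalar extension of `R`. -/
def mulHom : R ⊗[F] F' →ₐ[R] R :=
  Algebra.TensorProduct.lift (AlgHom.id R R) (IsScalarTower.toAlgHom F F' R)
    fun _ _ => Commute.all _ _

/-- The coefficients keep the scalars of `F'` and of `R` apart; multiplying them together gives the
matrix of the actual `R`-linear map. -/
lemma mulHom_coeff {X Y : T} (f : t.obj X ⟶ t.obj Y) (x : ω.toFunctor.obj X)
    (l : Module.Dual R (ω.toFunctor.obj Y)) :
    mulHom F F' R (hω.coeff h f x l) = l (hω.map h f x) := by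
  refine h.hom_induction (fun b f => ?_) (fun f g hf hg => ?_) f
  · rw [coeff_smul_map, map_smul_map, _root_.map_smul]
    have : l ((algebraMap F' R b • ω.toFunctor.map f) x) =
        algebraMap F' R b * l (ω.toFunctor.map f x) := l.map_smul _ _
    rw [this, mulHom, Algebra.TensorProduct.lift_tmul, map_one, one_mul, smul_eq_mul, mul_comm]
    rfl
  · rw [map_add, map_add, LinearMap.add_apply, LinearMap.add_apply, map_add, hf, hg]
    exact (l.map_add _ _).symm

variable [MonoidalPreadditive T] [MonoidalLinear F T]

lemma map_box_mul {X X' Y Y' : T} (f : t.obj X ⟶ t.obj X') (g : t.obj Y ⟶ t.obj Y')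
    (x : ω.toFunctor.obj X) (y : ω.toFunctor.obj Y) :
    hω.map h (h.box f g) (mul ω.toFunctor X Y x y) =
      mul ω.toFunctor X' Y' (hω.map h f x) (hω.map h g y) := by
  refine h.hom_induction (fun a f => ?_) (fun f₁ f₂ h₁ h₂ => ?_) f
  · refine h.hom_induction (fun b g => ?_) (fun f₁ f₂ h₁ h₂ => ?_) g
    · rw [h.box_smul_smul, map_smul_map, map_smul_map, map_smul_map]
      change algebraMap F' R (a * b) • ω.toFunctor.map (f ⊗ₘ g) (mul ω.toFunctor X Y x y) =
        mul ω.toFunctor X' Y' (algebraMap F' R a • ω.toFunctor.map f x)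
          (algebraMap F' R b • ω.toFunctor.map g y)
      rw [map_tensorHom_mul, _root_.map_smul, _root_.map_smul, LinearMap.smul_apply, map_mul,
        mul_smul, smul_comm]
    · rw [h.box_add, map_add, map_add]
      change hω.map h _ _ + hω.map h _ _ = mul ω.toFunctor X' Y' _ (hω.map h _ _ + hω.map h _ _)
      rw [h₁, h₂, _root_.map_add]
  · rw [h.add_box, map_add, map_add]
    change hω.map h _ _ + hω.map h _ _ = mul ω.toFunctor X' Y' (hω.map h _ _ + hω.map h _ _) _
    rw [h₁, h₂, _root_.map_add, LinearMap.add_apply]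

lemma coeff_box_mul {X X' Y Y' : T} (f : t.obj X ⟶ t.obj X') (g : t.obj Y ⟶ t.obj Y')
    (x : ω.toFunctor.obj X) (y : ω.toFunctor.obj Y) (l : Module.Dual R (ω.toFunctor.obj X'))
    (k : Module.Dual R (ω.toFunctor.obj Y')) [IsIso (Functor.LaxMonoidal.μ ω.toFunctor X' Y')] :
    hω.coeff h (h.box f g) (mul ω.toFunctor X Y x y) (dualMul ω.toFunctor X' Y' l k) =
      hω.coeff h f x l * hω.coeff h g y k := by
  refine h.hom_induction (fun a f => ?_) (fun f₁ f₂ h₁ h₂ => ?_) f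
  · refine h.hom_induction (fun b g => ?_) (fun f₁ f₂ h₁ h₂ => ?_) g
    · rw [h.box_smul_smul, coeff_smul_map, coeff_smul_map, coeff_smul_map, map_tensorHom_mul,
        dualMul_mul, smul_mul_smul_comm, Algebra.TensorProduct.tmul_mul_tmul, one_mul]
    · rw [h.box_add, map_add, map_add, LinearMap.add_apply, LinearMap.add_apply,
        LinearMap.add_apply, LinearMap.add_apply, h₁, h₂, mul_add]
  · rw [h.add_box, map_add, map_add, LinearMap.add_apply, LinearMap.add_apply,
      LinearMap.add_apply, LinearMap.add_apply, h₁, h₂, add_mul]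

/-- Tensoring with an identity creates no new coefficients on pure tensors. Thus the coefficients of
the transpose of `f` lie in the ideal generated by those of `f`. -/
lemma coeff_box_id_mul {X X' Y : T} (f : t.obj X ⟶ t.obj X') (x : ω.toFunctor.obj X)
    (y : ω.toFunctor.obj Y) (l : Module.Dual R (ω.toFunctor.obj (X' ⊗ Y))) :
    hω.coeff h (h.box f (𝟙 (t.obj Y))) (mul ω.toFunctor X Y x y) l =
      hω.coeff h f x (l ∘ₗ (mul ω.toFunctor X' Y).flip y) := by
  refine h.hom_induction (fun a f => ?_) (fun f₁ f₂ h₁ h₂ => ?_) f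
  · rw [← t.map_id, ← one_smul F' (t.map (𝟙 Y)), h.box_smul_smul, coeff_smul_map, coeff_smul_map,
      map_tensorHom_mul, ω.toFunctor.map_id, mul_one]
    rfl
  · rw [h.add_box, map_add, map_add, LinearMap.add_apply, LinearMap.add_apply,
      LinearMap.add_apply, LinearMap.add_apply, h₁, h₂]

end IsFibreFunctor

end

/-! ### Minors of morphisms of the scalar extension -/

section

open TensorProduct

variable {F F' : Type v} [Field F] [Field F'] [Algebra F F']
  {T : Type u} [Category.{v} T] [Abelian T] [Linear F T] [MonoidalCategory T]
  [SymmetricCategory T] {C : Type*} [Category.{v} C] [Abelian C] [Linear F' C] {t : T ⥤ C}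
  {R : Type v} [CommRing R] [Algebra F R] [Algebra F' R] [IsScalarTower F F' R]

/-- The tensor powers of an object. -/
def tensorPow (X : T) : ℕ → T
  | 0 => 𝟙_ T
  | n + 1 => X ⊗ tensorPow X n

/-- The inductive step in the construction of `extract`. -/
def extractStep (X : T) {Z : T} (d : X ⊗ Z ⟶ X ⊗ Z) : X ⊗ X ⊗ Z ⟶ X ⊗ X ⊗ Z :=
  𝟙 _ - X ◁ d ≫ (α_ X X Z).inv ≫ (β_ X X).hom ▷ Z ≫ (α_ X X Z).hom

/-- The alternating sum over the factors of a tensor power which moves a factor to the front. -/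
def extract (X : T) : ∀ n, X ⊗ tensorPow X n ⟶ X ⊗ tensorPow X n
  | 0 => 𝟙 _
  | n + 1 => extractStep X (extract X n)

/-- The pure tensors in the values of a lax monoidal functor at the tensor powers. -/
def pureTensor (G : T ⥤ ModuleCat.{v} R) [G.LaxMonoidal] (X : T) :
    ∀ n, (Fin n → G.obj X) → G.obj (tensorPow X n)
  | 0, _ => one G
  | n + 1, x => mul G X (tensorPow X n) (x 0) (pureTensor G X n (Fin.tail x))

lemma dual_eq_of_mul (G : T ⥤ ModuleCat.{v} R) [G.LaxMonoidal] {X Y : T}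
    [IsIso (Functor.LaxMonoidal.μ G X Y)] {l k : Module.Dual R (G.obj (X ⊗ Y))}
    (h : ∀ x y, l (mul G X Y x y) = k (mul G X Y x y)) : l = k := by
  refine LinearMap.ext_on (span_mul G X Y) ?_
  rintro _ ⟨⟨x, y⟩, rfl⟩
  exact h x y

lemma span_mul_of_span (G : T ⥤ ModuleCat.{v} R) [G.LaxMonoidal] (X Y : T)
    [IsIso (Functor.LaxMonoidal.μ G X Y)] {s : Set (G.obj Y)} (hs : Submodule.span R s = ⊤) :
    Submodule.span R {z | ∃ x, ∃ y ∈ s, mul G X Y x y = z} = ⊤ := by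
  rw [eq_top_iff]
  refine (span_mul G X Y).ge.trans (Submodule.span_le.2 ?_)
  rintro _ ⟨⟨x, y⟩, rfl⟩
  have hy : y ∈ Submodule.span R s := by rw [hs]; trivial
  change mul G X Y x y ∈ _
  induction hy using Submodule.span_induction with
  | mem y hy => exact Submodule.subset_span ⟨x, y, hy, rfl⟩
  | zero => rw [map_zero]; exact zero_mem _
  | add a b _ _ ha hb => rw [map_add]; exact add_mem ha hb
  | smul r a _ ha => rw [map_smul]; exact Submodule.smul_mem _ _ ha

lemma span_pureTensor (G : T ⥤ ModuleCat.{v} R) [G.LaxMonoidal] [IsIso (Functor.LaxMonoidal.ε G)]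
    [∀ X Y, IsIso (Functor.LaxMonoidal.μ G X Y)] (X : T) (n : ℕ) :
    Submodule.span R (Set.range (pureTensor G X n)) = ⊤ := by
  induction n with
  | zero =>
    rw [eq_top_iff]
    rintro x -
    rw [eq_smul_one G x]
    exact Submodule.smul_mem _ _ (Submodule.subset_span ⟨Fin.elim0, rfl⟩)
  | succ n ih =>
    rw [eq_top_iff]
    refine (span_mul_of_span G X (tensorPow X n) ih).ge.trans (Submodule.span_mono ?_)
    rintro _ ⟨x, _, ⟨z, rfl⟩, rfl⟩
    exact ⟨Fin.cons x z, rfl⟩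

lemma dualMul_add (G : T ⥤ ModuleCat.{v} R) [G.LaxMonoidal] {X Y : T}
    [IsIso (Functor.LaxMonoidal.μ G X Y)]
    (l : Module.Dual R (G.obj X)) (k k' : Module.Dual R (G.obj Y)) :
    dualMul G X Y l (k + k') = dualMul G X Y l k + dualMul G X Y l k' :=
  dual_eq_of_mul _ fun x y => by
    rw [LinearMap.add_apply, dualMul_mul, dualMul_mul, dualMul_mul, LinearMap.add_apply, mul_add]

lemma dualMul_smul (G : T ⥤ ModuleCat.{v} R) [G.LaxMonoidal] {X Y : T}
    [IsIso (Functor.LaxMonoidal.μ G X Y)]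
    (l : Module.Dual R (G.obj X)) (r : R) (k : Module.Dual R (G.obj Y)) :
    dualMul G X Y l (r • k) = r • dualMul G X Y l k :=
  dual_eq_of_mul _ fun x y => by
    rw [LinearMap.smul_apply, dualMul_mul, dualMul_mul, LinearMap.smul_apply, mul_smul_comm]

lemma span_dualMul_of_span (G : T ⥤ ModuleCat.{v} R) [G.LaxMonoidal] (X Y : T)
    [IsIso (Functor.LaxMonoidal.μ G X Y)] [Module.Finite R (G.obj X)]
    [Module.Projective R (G.obj X)] {s : Set (Module.Dual R (G.obj Y))}
    (hs : Submodule.span R s = ⊤) :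
    Submodule.span R {z | ∃ l, ∃ k ∈ s, dualMul G X Y l k = z} = ⊤ := by
  rw [eq_top_iff]
  rintro k -
  obtain ⟨m, x, l, hl⟩ := exists_projective_dual_basis R (G.obj X)
  have h1 : k = ∑ i, dualMul G X Y (l i) (k ∘ₗ mul G X Y (x i)) := by
    refine dual_eq_of_mul G fun a b => ?_
    rw [LinearMap.sum_apply]
    simp only [dualMul_mul, LinearMap.comp_apply]
    conv_lhs => rw [hl a, map_sum, LinearMap.sum_apply, map_sum]
    refine Finset.sum_congr rfl fun i _ => ?_
    rw [_root_.map_smul, LinearMap.smul_apply, _root_.map_smul, smul_eq_mul]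
  rw [h1]
  refine sum_mem fun i _ => ?_
  have hk : k ∘ₗ mul G X Y (x i) ∈ Submodule.span R s := by rw [hs]; trivial
  generalize k ∘ₗ mul G X Y (x i) = k' at hk ⊢
  induction hk using Submodule.span_induction with
  | mem k hk => exact Submodule.subset_span ⟨l i, k, hk, rfl⟩
  | zero =>
    rw [← zero_smul R (0 : Module.Dual R (G.obj Y)), dualMul_smul, zero_smul]
    exact zero_mem _
  | add a b _ _ ha hb => rw [dualMul_add]; exact add_mem ha hb
  | smul r a _ ha => rw [dualMul_smul]; exact Submodule.smul_mem _ _ ha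

/-- The products of linear functionals on the tensor powers. -/
def pureDual (G : T ⥤ ModuleCat.{v} R) [G.LaxMonoidal] [IsIso (Functor.LaxMonoidal.ε G)]
    [∀ X Y, IsIso (Functor.LaxMonoidal.μ G X Y)] (X : T) :
    ∀ n, (Fin n → Module.Dual R (G.obj X)) → Module.Dual R (G.obj (tensorPow X n))
  | 0, _ => dualOne G
  | n + 1, l => dualMul G X (tensorPow X n) (l 0) (pureDual G X n (Fin.tail l))

lemma span_pureDual (G : T ⥤ ModuleCat.{v} R) [G.LaxMonoidal] [IsIso (Functor.LaxMonoidal.ε G)]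
    [∀ X Y, IsIso (Functor.LaxMonoidal.μ G X Y)] (X : T) [Module.Finite R (G.obj X)]
    [Module.Projective R (G.obj X)] (n : ℕ) :
    Submodule.span R (Set.range (pureDual G X n)) = ⊤ := by
  induction n with
  | zero =>
    rw [eq_top_iff]
    rintro (l : Module.Dual R (G.obj (𝟙_ T))) -
    have : l = l (one G) • dualOne G := by
      ext x
      rw [eq_smul_one G x]
      simp [dualOne_one, mul_comm]
    rw [this]
    exact Submodule.smul_mem _ _ (Submodule.subset_span ⟨Fin.elim0, rfl⟩)
  | succ n ih =>
    rw [eq_top_iff]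
    refine (span_dualMul_of_span G X (tensorPow X n) ih).ge.trans (Submodule.span_mono ?_)
    rintro _ ⟨x, _, ⟨z, rfl⟩, rfl⟩
    exact ⟨Fin.cons x z, rfl⟩

lemma map_extractStep_mul (G : T ⥤ ModuleCat.{v} R) [G.LaxBraided] [G.Additive] (X : T) {Z : T}
    (d : X ⊗ Z ⟶ X ⊗ Z) (x : G.obj X) (y : G.obj (X ⊗ Z)) {ι : Type*} [Fintype ι] (c : ι → R)
    (a : ι → G.obj X) (b : ι → G.obj Z) (hd : G.map d y = ∑ i, c i • mul G X Z (a i) (b i)) :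
    G.map (extractStep X d) (mul G X _ x y) =
      mul G X _ x y - ∑ i, c i • mul G X _ (a i) (mul G X Z x (b i)) := by
  have h3 : ∀ (a b : G.obj X) (c : G.obj Z),
      G.map (α_ X X Z).hom (G.map ((β_ X X).hom ▷ Z)
        (G.map (α_ X X Z).inv (mul G X _ a (mul G X _ b c)))) =
      mul G X _ b (mul G X _ a c) := by
    intro a b c
    rw [map_associator_inv_mul, map_whiskerRight_mul, map_braiding_mul, map_associator_mul]
  rw [extractStep, G.map_sub, G.map_id, G.map_comp, G.map_comp, G.map_comp]
  change _ - G.map (α_ X X Z).hom (G.map ((β_ X X).hom ▷ Z)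
        (G.map (α_ X X Z).inv (G.map (X ◁ d) (mul G X _ x y)))) = _
  rw [map_whiskerLeft_mul, hd]
  simp only [map_sum, map_smul, h3]
  rfl

/-- The signs are those of the Laplace expansion along the first row. In the induction, the
extracted factor is exchanged with the new first one, at the cost of one sign. -/
lemma map_extract_pureTensor (G : T ⥤ ModuleCat.{v} R) [G.LaxBraided]
    [G.Additive] (X : T) (n : ℕ) (x : Fin (n + 1) → G.obj X) :
    G.map (extract X n) (pureTensor G X (n + 1) x) =
      ∑ j : Fin (n + 1), (-1 : R) ^ (j : ℕ) •
        mul G X (tensorPow X n) (x j) (pureTensor G X n (x ∘ j.succAbove)) := by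
  induction n with
  | zero =>
    rw [Fin.sum_univ_one]
    have : G.map (extract X 0) = 𝟙 _ := G.map_id _
    rw [this]
    simp only [Fin.val_zero, pow_zero, one_smul]
    rfl
  | succ n ih =>
    refine (map_extractStep_mul G X (extract X n) (x 0) _ _ _ _ (ih (Fin.tail x))).trans ?_
    refine Eq.trans ?_ (Fin.sum_univ_succ _).symm
    rw [sub_eq_add_neg, ← Finset.sum_neg_distrib]
    refine congrArg₂ (· + ·) ?_ (Finset.sum_congr rfl fun j _ => ?_)
    · simp only [Fin.val_zero, pow_zero, one_smul]
      rfl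
    · have h1 : x ∘ j.succ.succAbove = Fin.cons (x 0) (Fin.tail x ∘ j.succAbove) := by
        ext i
        cases i using Fin.cases <;> simp [Fin.tail]
      rw [Fin.val_succ, pow_succ, mul_neg_one, neg_smul, h1]
      rfl

namespace IsFibreFunctor

variable {ω : LaxBraidedFunctor T (ModuleCat.{v} R)} (hω : IsFibreFunctor F T R ω)
  (h : IsScalarExtension F (F' := F') t)

section

variable [MonoidalPreadditive T] [MonoidalLinear F T] {X Y : T} (f : t.obj X ⟶ t.obj Y)

/-- This is the `n`-th tensor power of `f` preceded by antisymmetrization. It replaces the exterior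
power of `f`, with no division by factorials, so it works in every characteristic. -/
def minorHom (h : IsScalarExtension F (F' := F') t) {X Y : T} (f : t.obj X ⟶ t.obj Y) :
    ∀ n, t.obj (tensorPow X n) ⟶ t.obj (tensorPow Y n)
  | 0 => 𝟙 _
  | n + 1 => t.map (extract X n) ≫ h.box f (minorHom h f n)

lemma coeff_minorHom [IsIso (Functor.LaxMonoidal.ε ω.toFunctor)]
    [∀ X Y, IsIso (Functor.LaxMonoidal.μ ω.toFunctor X Y)] (n : ℕ)
    (x : Fin n → ω.toFunctor.obj X) (l : Fin n → Module.Dual R (ω.toFunctor.obj Y)) :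
    hω.coeff h (minorHom h f n) (pureTensor ω.toFunctor X n x) (pureDual ω.toFunctor Y n l) =
      minor (fun x l => hω.coeff h f x l) x l := by
  induction n with
  | zero =>
    have : hω.coeff h (𝟙 (t.obj (𝟙_ T))) (one ω.toFunctor) (dualOne ω.toFunctor) = 1 := by
      rw [← t.map_id, coeff_map, ω.toFunctor.map_id, ModuleCat.id_apply, dualOne_one, map_one]
    refine Eq.trans this ?_
    simp [minor]
  | succ n ih =>
    have h1 : hω.coeff h (minorHom h f (n + 1)) (pureTensor ω.toFunctor X (n + 1) x)
        (pureDual ω.toFunctor Y (n + 1) l) = hω.coeff h (h.box f (minorHom h f n))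
        (ω.toFunctor.map (extract X n) (pureTensor ω.toFunctor X (n + 1) x))
        (dualMul ω.toFunctor Y (tensorPow Y n) (l 0) (pureDual ω.toFunctor Y n (Fin.tail l))) :=
      hω.coeff_map_comp h _ _ _ _
    have := hω.additive
    rw [h1, map_extract_pureTensor, map_sum, LinearMap.sum_apply, minor, Matrix.det_succ_row_zero]
    refine Finset.sum_congr rfl fun j _ => ?_
    rw [_root_.map_smul, LinearMap.smul_apply, coeff_box_mul, ih, minor]
    simp only [Matrix.of_apply]
    rw [mul_assoc, Algebra.smul_def, map_pow, map_neg, map_one]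
    rfl

lemma box_rightUnitor {B Y : T} (g : t.obj B ⟶ t.obj Y) :
    h.box g (𝟙 (t.obj (𝟙_ T))) ≫ t.map (ρ_ Y).hom = t.map (ρ_ B).hom ≫ g := by
  refine h.hom_induction (fun a g => ?_) (fun f₁ f₂ h₁ h₂ => ?_) g
  · rw [← t.map_id]
    simp only [h.smul_box, h.box_map, Linear.smul_comp, Linear.comp_smul, ← t.map_comp,
      tensorHom_id, rightUnitor_naturality]
  · simp only [h.add_box, Preadditive.add_comp, Preadditive.comp_add, h₁, h₂]

/-- The zigzag identity recovers `f` from its transpose `t(Z ⊗ D) ⟶ t 𝟙`. -/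
lemma eq_zero_of_box_comp {D W Z : T} [ExactPairing D W] (f : t.obj Z ⟶ t.obj W)
    (hf : h.box f (𝟙 (t.obj D)) ≫ t.map (ε_ D W) = 0) : f = 0 := by
  have h1 : h.box (h.box f (𝟙 (t.obj D))) (𝟙 (t.obj W)) ≫ t.map (ε_ D W ▷ W) = 0 := by
    rw [← tensorHom_id, ← h.box_map, t.map_id, ← h.box_comp, hf, h.zero_box]
  have h2 : h.box f (𝟙 (t.obj (𝟙_ T))) ≫ t.map (W ◁ η_ D W) =
      t.map (Z ◁ η_ D W) ≫ h.box f (𝟙 (t.obj (D ⊗ W))) := by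
    rw [← id_tensorHom, ← id_tensorHom, ← h.box_map, ← h.box_map, t.map_id, t.map_id, ← h.box_comp,
      ← h.box_comp, Category.id_comp, Category.id_comp, Category.comp_id, Category.comp_id]
  have h3 : h.box f (𝟙 (t.obj (𝟙_ T))) ≫ t.map ((ρ_ W).hom ≫ (λ_ W).inv) = 0 := by
    rw [← ExactPairing.coevaluation_evaluation D W, t.map_comp, reassoc_of% h2, t.map_comp,
      ← h.box_id, ← Category.assoc (h.box f _), h.box_associator_inv, Category.assoc, h1,
      comp_zero, comp_zero]
  rw [t.map_comp, ← Category.assoc, box_rightUnitor, Category.assoc] at h3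
  rw [← cancel_mono (t.map (λ_ W).inv), ← cancel_epi (t.map (ρ_ Z).hom), h3, zero_comp, comp_zero]

/-- The matrix coefficients of a nonzero morphism generate the unit ideal. -/
lemma span_coeff (hT : IsPreTannakian F T) (hf : f ≠ 0) :
    Ideal.span (Set.range fun p : ω.toFunctor.obj X × Module.Dual R (ω.toFunctor.obj Y) =>
      hω.coeff h f p.1 p.2) = ⊤ := by
  have := hT.pairing Y
  have : ExactPairing (hT.dual Y) Y := BraidedCategory.exactPairing_swap Y (hT.dual Y)
  -- The transpose of `f` is a nonzero morphism to the unit, so on some `Y'` it is `a • t e` with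
  -- `e` an epimorphism and `a ≠ 0`. As `ω(e)` is surjective, it hits the unit element, which
  -- produces the invertible coefficient `1 ⊗ a`.
  obtain ⟨Y', j, e, a, he, ha, hj⟩ := h.exists_epi_unit hT
    (h.box f (𝟙 (t.obj (hT.dual Y))) ≫ t.map (ε_ (hT.dual Y) Y))
    fun h0 => hf (eq_zero_of_box_comp h f h0)
  have := hω.isIso_ε
  have := hω.isIso_μ
  have := hω.rightExact
  obtain ⟨y, hy⟩ := (ModuleCat.epi_iff_surjective (ω.toFunctor.map e)).1 inferInstance
    (one ω.toFunctor)
  have h1 : hω.coeff h (a • t.map e) y (dualOne ω.toFunctor) = (1 : R) ⊗ₜ[F] a := by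
    rw [coeff_smul_map, hy, dualOne_one, one_smul]
  rw [← hj, coeff_map_comp, coeff_comp_map] at h1
  have h2 : (1 : R) ⊗ₜ[F] a ∈ Ideal.span (Set.range
      fun p : ω.toFunctor.obj X × Module.Dual R (ω.toFunctor.obj Y) =>
        hω.coeff h f p.1 p.2) := by
    rw [← h1]
    generalize dualOne ω.toFunctor ∘ₗ (ω.toFunctor.map (ε_ (hT.dual Y) Y)).hom = l
    generalize ω.toFunctor.map j y = z
    have h3 : z ∈ Submodule.span R (Set.range
        fun p : ω.toFunctor.obj X × ω.toFunctor.obj (hT.dual Y) =>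
          mul ω.toFunctor X (hT.dual Y) p.1 p.2) :=
      by rw [span_mul]; trivial
    induction h3 using Submodule.span_induction with
    | mem z hz =>
      obtain ⟨⟨x, d⟩, rfl⟩ := hz
      rw [coeff_box_id_mul]
      exact Ideal.subset_span ⟨(_, _), rfl⟩
    | zero => rw [map_zero]; exact zero_mem _
    | add a b _ _ ha hb => rw [map_add]; exact add_mem ha hb
    | smul r a _ ha =>
      rw [_root_.map_smul, LinearMap.smul_apply, Algebra.smul_def]
      exact Ideal.mul_mem_left _ _ ha
  refine Ideal.eq_top_of_isUnit_mem _ h2 (IsUnit.of_mul_eq_one ((1 : R) ⊗ₜ[F] a⁻¹) ?_)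
  rw [Algebra.TensorProduct.tmul_mul_tmul, mul_inv_cancel₀ ha, one_mul]
  rfl

/-- The `n`-minors are coefficients of the one morphism `minorHom`, at tensors and functionals that
span. If that morphism is zero they vanish; otherwise `span_coeff` applies to it. -/
lemma minorIdeal_eq (hT : IsPreTannakian F T) (n : ℕ) :
    minorIdeal (fun x l => hω.coeff h f x l) n = ⊥ ∨
      minorIdeal (fun x l => hω.coeff h f x l) n = ⊤ := by
  have := hω.isIso_ε
  have := hω.isIso_μ
  have := hω.finite
  have := hω.projective
  by_cases h0 : minorHom h f n = 0
  · refine Or.inl (Ideal.span_eq_bot.2 ?_)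
    rintro _ ⟨⟨x, l⟩, rfl⟩
    change minor _ x l = 0
    rw [← coeff_minorHom, h0, map_zero]
    rfl
  · refine Or.inr (top_le_iff.1 ((span_coeff hω h _ hT h0).ge.trans (Ideal.span_le.2 ?_)))
    rintro _ ⟨⟨x, l⟩, rfl⟩
    have hx := (span_pureTensor ω.toFunctor X n).ge (show x ∈ _ from trivial)
    have hl := (span_pureDual ω.toFunctor Y n).ge (show l ∈ _ from trivial)
    change hω.coeff h (minorHom h f n) x l ∈ minorIdeal _ n
    induction hx using Submodule.span_induction with
    | mem x hx =>
      obtain ⟨x, rfl⟩ := hx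
      induction hl using Submodule.span_induction with
      | mem l hl =>
        obtain ⟨l, rfl⟩ := hl
        rw [coeff_minorHom]
        exact Ideal.subset_span ⟨(x, l), rfl⟩
      | zero => rw [map_zero]; exact zero_mem _
      | add a b _ _ ha hb => rw [map_add]; exact add_mem ha hb
      | smul r a _ ha =>
        rw [_root_.map_smul, Algebra.smul_def]
        exact Ideal.mul_mem_left _ _ ha
    | zero => rw [map_zero]; exact zero_mem _
    | add a b _ _ ha hb => rw [map_add]; exact add_mem ha hb
    | smul r a _ ha =>
      rw [_root_.map_smul, LinearMap.smul_apply, Algebra.smul_def]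
      exact Ideal.mul_mem_left _ _ ha

/-- The coefficient matrix has a generalized inverse over `R ⊗ F'`: minors larger than the number of
generators of `ω(X)` vanish, and the intermediate ideals are `0` or everything. -/
lemma exists_coeff_eq (hT : IsPreTannakian F T) : ∃ (n : ℕ) (m : Fin n → R ⊗[F] F')
    (xs : Fin n → ω.toFunctor.obj X) (ls : Fin n → Module.Dual R (ω.toFunctor.obj Y)),
    ∀ x l, hω.coeff h f x l = ∑ s, m s * (hω.coeff h f x (ls s) * hω.coeff h f (xs s) l) :=
  have := hω.finite
  exists_regular _ (minorIdeal_eq hω h f hT) (exists_minorIdeal_eq_bot (hω.coeff h f))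

end

end IsFibreFunctor

end

/-! ### Flatness of fibre functors over the scalar extension -/

section

open TensorProduct

variable {F F' : Type v} [Field F] [Field F'] [Algebra F F']
  {T : Type u} [Category.{v} T] [Abelian T] [Linear F T] [MonoidalCategory T]
  [SymmetricCategory T] {C : Type*} [Category.{v} C] [Abelian C] [Linear F' C] {t : T ⥤ C}
  {R : Type v} [CommRing R] [Algebra F R] [Algebra F' R] [IsScalarTower F F' R]

lemma IsScalarExtension.exists_sum_basis (h : IsScalarExtension F (F' := F') t) {X Y : T}
    (u : t.obj X ⟶ t.obj Y) : ∃ c : Module.Basis.ofVectorSpaceIndex F F' →₀ (X ⟶ Y),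
      u = c.sum fun i f => Module.Basis.ofVectorSpace F F' i • t.map f := by
  classical
  let b := Module.Basis.ofVectorSpace F F'
  let x := (h.homEquiv X Y).symm u
  refine ⟨TensorProduct.equivFinsuppOfBasisLeft b x, ?_⟩
  have h1 : x = (TensorProduct.equivFinsuppOfBasisLeft b x).sum fun i f => b i ⊗ₜ f := by
    conv_lhs => rw [← (TensorProduct.equivFinsuppOfBasisLeft b).symm_apply_apply x]
    exact TensorProduct.equivFinsuppOfBasisLeft_symm_apply _ _
  have h2 : h.homEquiv X Y x = u := (h.homEquiv X Y).apply_symm_apply u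
  conv_lhs => rw [← h2, h1, Finsupp.sum, map_sum]
  rfl

namespace IsFibreFunctor

variable {ω : LaxBraidedFunctor T (ModuleCat.{v} R)} (hω : IsFibreFunctor F T R ω)
  (h : IsScalarExtension F (F' := F') t)

lemma exists_of_map_eq_zero (hω : IsFibreFunctor F T R ω) {X Y : T} (f : X ⟶ Y) (x : ω.toFunctor.obj X)
    (hx : ω.toFunctor.map f x = 0) : ∃ y, ω.toFunctor.map (kernel.ι f) y = x := by
  have := hω.additive
  have := hω.leftExact
  have := hω.rightExact
  let S : ShortComplex T := ShortComplex.mk (kernel.ι f) f (by simp)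
  have hS : S.Exact := ShortComplex.exact_kernel f
  exact (ShortComplex.moduleCat_exact_iff _).1 (hS.map ω.toFunctor) x hx

lemma exists_of_forall_map_eq_zero (hω : IsFibreFunctor F T R ω) {X Y : T} {ι : Type*}
    (s : Finset ι) (f : ι → (X ⟶ Y)) (x : ω.toFunctor.obj X)
    (hx : ∀ i ∈ s, ω.toFunctor.map (f i) x = 0) :
    ∃ (Z : T) (j : Z ⟶ X) (y : ω.toFunctor.obj Z),
      (∀ i ∈ s, j ≫ f i = 0) ∧ ω.toFunctor.map j y = x := by
  classical
  induction s using Finset.induction_on with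
  | empty => exact ⟨X, 𝟙 X, x, by simp, by rw [ω.toFunctor.map_id]; rfl⟩
  | insert a s ha ih =>
    obtain ⟨Z, j, y, hj, hy⟩ := ih fun i hi => hx i (Finset.mem_insert_of_mem hi)
    obtain ⟨z, hz⟩ := hω.exists_of_map_eq_zero (j ≫ f a) y (by
      rw [ω.toFunctor.map_comp, ModuleCat.comp_apply, hy]
      exact hx a (Finset.mem_insert_self a s))
    refine ⟨_, kernel.ι (j ≫ f a) ≫ j, z, fun i hi => ?_, ?_⟩
    · obtain rfl | hi := Finset.mem_insert.1 hi
      · rw [Category.assoc, kernel.condition]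
      · rw [Category.assoc, hj i hi, comp_zero]
    · rw [ω.toFunctor.map_comp, ModuleCat.comp_apply, hz, hy]

lemma exists_biprod (hω : IsFibreFunctor F T R ω) {X Y : T} (x : ω.toFunctor.obj X)
    (y : ω.toFunctor.obj Y) : ∃ z : ω.toFunctor.obj (X ⊞ Y),
      ω.toFunctor.map biprod.fst z = x ∧ ω.toFunctor.map biprod.snd z = y := by
  have := hω.additive
  refine ⟨ω.toFunctor.map biprod.inl x + ω.toFunctor.map biprod.inr y, ?_, ?_⟩
  · rw [map_add, ← ModuleCat.comp_apply, ← ModuleCat.comp_apply, ← Functor.map_comp,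
      ← Functor.map_comp, biprod.inl_fst, biprod.inr_fst, ω.toFunctor.map_zero,
      ω.toFunctor.map_id]
    exact add_zero x
  · rw [map_add, ← ModuleCat.comp_apply, ← ModuleCat.comp_apply, ← Functor.map_comp,
      ← Functor.map_comp, biprod.inl_snd, biprod.inr_snd, ω.toFunctor.map_zero,
      ω.toFunctor.map_id]
    exact zero_add y

/-- This is where coefficients in `R ⊗ F'` rather than `R` matter. With `u = ∑ bᵢ • t cᵢ` for a
basis of `F'`, the elements `1 ⊗ bᵢ` are independent over `R`, so every `ω(cᵢ)` kills `x`. Exactness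
of `ω` then brings `x` from the common kernel of the `cᵢ`. -/
lemma exists_of_coeff_eq_zero {X Y : T} (u : t.obj X ⟶ t.obj Y) (x : ω.toFunctor.obj X)
    (hx : ∀ l, hω.coeff h u x l = 0) :
    ∃ (Z : T) (i : Z ⟶ X) (y : ω.toFunctor.obj Z), t.map i ≫ u = 0 ∧ ω.toFunctor.map i y = x := by
  classical
  have := hω.additive
  have := hω.finite
  have := hω.projective
  have := h.additive
  obtain ⟨c, hc⟩ := h.exists_sum_basis u
  let b := Module.Basis.ofVectorSpace F F'
  have h1 : ∀ i ∈ c.support, ω.toFunctor.map (c i) x = 0 := by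
    intro i hi
    refine eq_of_dual (R := R) fun l => ?_
    have h2 := hx l
    rw [hc, Finsupp.sum, map_sum, LinearMap.sum_apply, LinearMap.sum_apply] at h2
    simp only [coeff_smul_map] at h2
    have h3 : LinearIndependent R (fun i => (1 : R) ⊗ₜ[F] b i) := by
      have := (Algebra.TensorProduct.basis R b).linearIndependent
      simpa only [Algebra.TensorProduct.basis_apply] using
        (show LinearIndependent R fun i => Algebra.TensorProduct.basis R b i from this)
    rw [map_zero]
    exact linearIndependent_iff'.1 h3 c.support (fun i => l (ω.toFunctor.map (c i) x)) h2 i hi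
  obtain ⟨Z, j, y, hj, hy⟩ := hω.exists_of_forall_map_eq_zero c.support c x h1
  refine ⟨Z, j, y, ?_, hy⟩
  rw [hc, Finsupp.sum, Preadditive.comp_sum]
  refine Finset.sum_eq_zero fun i hi => ?_
  rw [Linear.comp_smul, ← t.map_comp, hj i hi, t.map_zero, smul_zero]

/-- The pairs of a family of matrix coefficients which factors through `φ`, and of the image of
the corresponding element. -/
def coeffSubmonoid {X Y : T} (φ : t.obj X ⟶ t.obj Y) :
    AddSubmonoid ((Module.Dual R (ω.toFunctor.obj Y) → R ⊗[F] F') × ω.toFunctor.obj X) where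
  carrier := {p | ∃ (U : T) (v : t.obj U ⟶ t.obj X) (w : ω.toFunctor.obj U),
    (∀ l, hω.coeff h (v ≫ φ) w l = p.1 l) ∧ hω.map h v w = p.2}
  zero_mem' := ⟨X, 0, 0, by simp, by simp⟩
  add_mem' := by
    rintro _ _ ⟨U, v, w, h1, h2⟩ ⟨U', v', w', h1', h2'⟩
    have := hω.additive
    have := h.additive
    obtain ⟨y, hy, hy'⟩ := hω.exists_biprod w w'
    refine ⟨U ⊞ U', t.map biprod.fst ≫ v + t.map biprod.snd ≫ v', y, fun l => ?_, ?_⟩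
    · rw [Preadditive.add_comp, Category.assoc, Category.assoc, map_add, LinearMap.add_apply,
        LinearMap.add_apply, coeff_map_comp, coeff_map_comp, hy, hy', h1, h1']
      rfl
    · rw [map_add, map_comp, map_comp, map_map, map_map]
      change hω.map h v (ω.toFunctor.map _ y) + hω.map h v' (ω.toFunctor.map _ y) = _
      rw [hy, hy', h2, h2']
      rfl

/-- For `g = r ⊗ a`, the morphism `a • 𝟙` and the element `r • x` realize the pair; sums are
realized on biproducts. An element of `R ⊗ F'` thus multiplies the coefficients in full but acts on
`x` only through its image in `R`. -/
lemma mul_coeff_mem_coeffSubmonoid {X Y : T} (φ : t.obj X ⟶ t.obj Y) (g : R ⊗[F] F')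
    (x : ω.toFunctor.obj X) :
    ((fun l => g * hω.coeff h φ x l, mulHom F F' R g • x) :
      (Module.Dual R (ω.toFunctor.obj Y) → R ⊗[F] F') × ω.toFunctor.obj X) ∈
        hω.coeffSubmonoid h φ := by
  induction g using TensorProduct.induction_on with
  | zero =>
    convert zero_mem (hω.coeffSubmonoid h φ) using 1
    ext l <;> simp
  | tmul r a =>
    refine ⟨X, a • 𝟙 _, r • x, fun l => ?_, ?_⟩
    · rw [Linear.smul_comp, Category.id_comp, coeff_smul, _root_.map_smul, LinearMap.smul_apply,
        Algebra.smul_def, ← mul_assoc]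
      congr 1
      rw [mul_comm]
      exact (Algebra.TensorProduct.tmul_mul_tmul _ _ _ _).trans (by rw [mul_one, one_mul]; rfl)
    · rw [map_smul, ← t.map_id, map_map, ω.toFunctor.map_id]
      change algebraMap F' R a • r • x = mulHom F F' R (r ⊗ₜ a) • x
      rw [mulHom, Algebra.TensorProduct.lift_tmul, smul_smul, mul_comm]
      rfl
  | add g g' hg hg' =>
    convert add_mem hg hg' using 1
    ext l
    · simp [add_mul]
    · simp [add_smul]

/-- A relation between the values of a fibre functor comes from relations in the scalar
extension. -/
theorem exists_of_mapExt_eq_zero (hT : IsPreTannakian F T) {X Y : T}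
    (φ : t.obj X ⟶ t.obj Y) (x : ω.toFunctor.obj X) (hx : hω.map h φ x = 0) :
    ∃ (Z : T) (z : t.obj Z ⟶ t.obj X) (w : ω.toFunctor.obj Z),
      z ≫ φ = 0 ∧ hω.map h z w = x := by
  have := hT.toMonoidalPreadditive
  have := hT.toMonoidalLinear
  obtain ⟨n, m, xs, ls, hm⟩ := hω.exists_coeff_eq h φ hT
  let g (s : Fin n) := m s * hω.coeff h φ x (ls s)
  -- The generalized inverse corrects `x` by the terms `-g s` at `xs s`. The coefficients become
  -- zero by `hm`, while the element stays `x`: the image of `g s` in `R` contains the factor `ls s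
  -- (ω(φ) x) = 0`.
  have h1 : (0, x) ∈ hω.coeffSubmonoid h φ := by
    have h2 := add_mem (hω.mul_coeff_mem_coeffSubmonoid h φ 1 x)
      (sum_mem fun s (_ : s ∈ Finset.univ) => hω.mul_coeff_mem_coeffSubmonoid h φ (-g s) (xs s))
    convert h2 using 1
    ext l
    · simp only [Prod.fst_add, Prod.fst_sum, Pi.add_apply, Finset.sum_apply, Pi.zero_apply,
        one_mul, neg_mul, Finset.sum_neg_distrib, g]
      rw [hm x l]
      simp only [mul_assoc]
      exact (add_neg_cancel _).symm
    · have h3 : ∀ s, mulHom F F' R (-g s) = 0 := fun s => by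
        rw [map_neg, map_mul, mulHom_coeff, hx, map_zero, mul_zero, neg_zero]
      simp only [Prod.snd_add, Prod.snd_sum, h3, zero_smul, Finset.sum_const_zero, map_one,
        one_smul, add_zero]
  obtain ⟨U, v, w, h2, h3⟩ := h1
  obtain ⟨Z, i, y, hi, hy⟩ := hω.exists_of_coeff_eq_zero h (v ≫ φ) w h2
  refine ⟨Z, t.map i ≫ v, y, by rw [Category.assoc, hi], ?_⟩
  rw [map_comp, map_map]
  change hω.map h v (ω.toFunctor.map i y) = x
  rw [hy, h3]


end IsFibreFunctor

end

/-! ### The right exact extension of a functor -/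

section

variable {F F' : Type w} [Field F] [Field F'] [Algebra F F']
  {T : Type*} [Category.{v} T] [Abelian T] [Linear F T] {C : Type*} [Category.{v} C] [Abelian C]
  [Linear F' C] {t : T ⥤ C} {D : Type*} [Category* D] [Abelian D]

namespace ExtFun

variable (h : IsScalarExtension F (F' := F') t) (H : ExtFun t D)

/-- The value of the right exact extension of a functor. -/
def extObj (M : C) : D := cokernel (H.map (h.relι M))

def extπ (M : C) : H.obj (h.gen M) ⟶ H.extObj h M := cokernel.π _

instance (M : C) : Epi (H.extπ h M) := inferInstanceAs (Epi (cokernel.π (H.map (h.relι M))))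

lemma map_relι_extπ (M : C) : H.map (h.relι M) ≫ H.extπ h M = 0 := cokernel.condition _

lemma exact_extπ (M : C) : (ShortComplex.mk _ _ (H.map_relι_extπ h M)).Exact :=
  ShortComplex.exact_cokernel (H.map (h.relι M))

def toExtFamily (M : C) : H.Family M (H.extObj h M) :=
  Family.ofEpi h (h.genπ M) (H.extπ h M)
    (h.map_relι_comp H _ (H.map_relι_extπ h M))

/-- The morphism induced by `x : t A ⟶ M` on the values of the right exact extension. -/
def toExt {M : C} {A : T} (x : t.obj A ⟶ M) : H.obj A ⟶ H.extObj h M := (H.toExtFamily h M).app x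

lemma toExt_genπ (M : C) : H.toExt h (h.genπ M) = H.extπ h M :=
  Family.ofEpi_app _ _ _ _

lemma toExt_comp {M : C} {A B : T} (f : t.obj A ⟶ t.obj B) (x : t.obj B ⟶ M) :
    H.toExt h (f ≫ x) = H.map f ≫ H.toExt h x :=
  (H.toExtFamily h M).naturality f x

lemma toExt_add {M : C} {A : T} (x y : t.obj A ⟶ M) : H.toExt h (x + y) = H.toExt h x + H.toExt h y :=
  (H.toExtFamily h M).app_add h x y

lemma toExt_zero {M : C} {A : T} : H.toExt h (0 : t.obj A ⟶ M) = 0 :=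
  (H.toExtFamily h M).app_zero h

instance epi_toExt {M : C} {A : T} (x : t.obj A ⟶ M) [Epi x] : Epi (H.toExt h x) where
  left_cancellation {P} f g hfg := by
    have := Family.app_eq_of_epi h ((H.toExtFamily h M).comp f) ((H.toExtFamily h M).comp g) x hfg
      (h.genπ M)
    change H.toExt h _ ≫ f = H.toExt h _ ≫ g at this
    rwa [toExt_genπ, cancel_epi] at this

lemma exists_extDesc {M : C} {P : D} (β : H.Family M P) :
    ∃ g : H.extObj h M ⟶ P, ∀ {A : T} (x : t.obj A ⟶ M), H.toExt h x ≫ g = β.app x := by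
  have h1 : H.map (h.relι M) ≫ β.app (h.genπ M) = 0 := by
    rw [← β.naturality, h.relι_genπ, β.app_zero h]
  have h2 := H.exact_extπ h M
  have : Epi (ShortComplex.mk _ _ (H.map_relι_extπ h M)).g := inferInstanceAs (Epi (H.extπ h M))
  refine ⟨h2.desc _ h1, fun x => ?_⟩
  refine Family.app_eq_of_epi h ((H.toExtFamily h M).comp (h2.desc _ h1)) β (h.genπ M) ?_ x
  change H.toExt h _ ≫ _ = _
  rw [toExt_genπ]
  exact h2.g_desc _ h1

/-- The morphism out of the right exact extension induced by a natural family. -/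
def extDesc {M : C} {P : D} (β : H.Family M P) : H.extObj h M ⟶ P := (H.exists_extDesc h β).choose

lemma toExt_extDesc {M : C} {P : D} (β : H.Family M P) {A : T} (x : t.obj A ⟶ M) :
    H.toExt h x ≫ H.extDesc h β = β.app x :=
  (H.exists_extDesc h β).choose_spec x

def extMap {M N : C} (φ : M ⟶ N) : H.extObj h M ⟶ H.extObj h N :=
  H.extDesc h ((H.toExtFamily h N).precomp φ)

lemma toExt_extMap {M N : C} (φ : M ⟶ N) {A : T} (x : t.obj A ⟶ M) :
    H.toExt h x ≫ H.extMap h φ = H.toExt h (x ≫ φ) :=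
  H.toExt_extDesc h _ x

/-- The right exact extension of a functor. -/
def extend : C ⥤ D where
  obj M := H.extObj h M
  map φ := H.extMap h φ
  map_id M := by
    rw [← cancel_epi (H.toExt h (h.genπ M)), toExt_extMap, Category.comp_id, Category.comp_id]
  map_comp {M N P} f g := by
    rw [← cancel_epi (H.toExt h (h.genπ M)), toExt_extMap, ← Category.assoc, ← Category.assoc,
      toExt_extMap, toExt_extMap]

lemma toExt_map {M N : C} (φ : M ⟶ N) {A : T} (x : t.obj A ⟶ M) :
    H.toExt h x ≫ (H.extend h).map φ = H.toExt h (x ≫ φ) :=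
  H.toExt_extDesc h _ x

instance : (H.extend h).Additive where
  map_add {M N f g} := by
    change H.extMap h _ = H.extMap h _ + H.extMap h _
    rw [← cancel_epi (H.toExt h (h.genπ M)), toExt_extMap, Preadditive.comp_add, toExt_add,
      ← toExt_extMap, ← toExt_extMap]
    exact (Preadditive.comp_add _ _ _ _ _ _).symm

lemma epi_extMap {M N : C} (f : M ⟶ N) [Epi f] : Epi (H.extMap h f) := by
  have h1 := H.toExt_extMap h f (h.genπ M)
  have : Epi (H.toExt h (h.genπ M) ≫ H.extMap h f) := by
    rw [h1]
    infer_instance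
  exact epi_of_epi (H.toExt h (h.genπ M)) _

lemma exists_extMap_desc (S : ShortComplex C) (hS : S.Exact) [Epi S.g] {P : D}
    (k : H.extObj h S.X₂ ⟶ P) (hk : H.extMap h S.f ≫ k = 0) :
    ∃ k', H.extMap h S.g ≫ k' = k := by
  let β : H.Family S.X₃ P := Family.ofEpi h (h.genπ S.X₂ ≫ S.g) (H.toExt h (h.genπ S.X₂) ≫ k)
    (fun Z z hz => by
      obtain ⟨A, q, hq, l, hl⟩ := h.exists_lift_of_exact hS (z ≫ h.genπ S.X₂)
        (by rw [Category.assoc, hz])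
      have := H.epi_map q hq
      rw [← cancel_epi (H.map (t.map q)), comp_zero, ← Category.assoc (H.map z), ← toExt_comp,
        ← Category.assoc, ← toExt_comp, ← hl, ← toExt_extMap, Category.assoc, hk, comp_zero])
  refine ⟨H.extDesc h β, ?_⟩
  rw [← cancel_epi (H.toExt h (h.genπ S.X₂)), ← Category.assoc, toExt_extMap, toExt_extDesc]
  exact Family.ofEpi_app _ _ _ _

instance : PreservesFiniteColimits (H.extend h) :=
  IsScalarExtension.preservesFiniteColimits_of_exists_desc _ (fun f _ => H.epi_extMap h f)
    fun S hS _ _ k hk => H.exists_extMap_desc h S hS k hk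

/-- The right exact extension agrees with the functor on the image of `t`. -/
def extendIso (A : T) : H.obj A ≅ H.extObj h (t.obj A) where
  hom := H.toExt h (𝟙 (t.obj A))
  inv := H.extDesc h (P := H.obj A)
    { app := fun f => H.map f
      naturality := fun f g => H.map_comp f g }
  hom_inv_id := (H.toExt_extDesc h _ _).trans (H.map_id A)
  inv_hom_id := by
    rw [← cancel_epi (H.toExt h (𝟙 (t.obj A))), ← Category.assoc, toExt_extDesc]
    exact (congrArg (· ≫ _) (H.map_id A)).trans
      ((Category.id_comp _).trans (Category.comp_id _).symm)

lemma toExt_eq {M : C} {A : T} (x : t.obj A ⟶ M) :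
    H.toExt h x = (H.extendIso h A).hom ≫ (H.extend h).map x := by
  rw [extendIso, toExt_map, Category.id_comp]

/-- A natural transformation between right exact functors on the scalar extension is an
isomorphism if it is one on the image of `t`. -/
lemma _root_.ScalarExtension.IsScalarExtension.isIso_app
    (h : IsScalarExtension F (F' := F') t) {G G' : C ⥤ D} [PreservesFiniteColimits G]
    [PreservesFiniteColimits G'] (α : G ⟶ G') (hα : ∀ A, IsIso (α.app (t.obj A))) (M : C) :
    IsIso (α.app M) := by
  obtain ⟨Y, k, hk⟩ := h.exists_cover (kernel (h.genπ M))
  let i := inv (α.app (t.obj (h.gen M)))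
  -- The inverse at `M` is descended from the inverse at the generators; it kills the kernel because
  -- the kernel is covered by an object of the image.
  obtain ⟨g, hg⟩ := exists_desc_of_preservesFiniteColimits G' (h.genπ M) (i ≫ G.map (h.genπ M)) (by
    have h1 : G'.map (k ≫ kernel.ι (h.genπ M)) ≫ i =
        inv (α.app (t.obj Y)) ≫ G.map (k ≫ kernel.ι (h.genπ M)) := by
      rw [IsIso.comp_inv_eq, Category.assoc, IsIso.eq_inv_comp, α.naturality]
    have : G.Additive :=
      have : PreservesBinaryBiproducts G :=
        preservesBinaryBiproducts_of_preservesBinaryCoproducts _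
      Functor.additive_of_preservesBinaryBiproducts _
    rw [← cancel_epi (G'.map k), ← Category.assoc, ← G'.map_comp, reassoc_of% h1, ← G.map_comp,
      Category.assoc, kernel.condition, comp_zero, G.map_zero, comp_zero, comp_zero])
  refine ⟨g, ?_, ?_⟩
  · rw [← cancel_epi (G.map (h.genπ M)), α.naturality_assoc, hg, IsIso.hom_inv_id_assoc,
      Category.comp_id]
  · rw [← cancel_epi (G'.map (h.genπ M)), reassoc_of% hg, α.naturality, IsIso.inv_hom_id_assoc,
      Category.comp_id]

end ExtFun

end

/-! ### Exactness and projectivity of the extended fibre functor -/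

section

open TensorProduct

variable {F F' : Type v} [Field F] [Field F'] [Algebra F F']
  {T : Type u} [Category.{v} T] [Abelian T] [Linear F T] [MonoidalCategory T]
  [SymmetricCategory T] {C : Type*} [Category.{v} C] [Abelian C] [Linear F' C] {t : T ⥤ C}
  {R : Type v} [CommRing R] [Algebra F R] [Algebra F' R] [IsScalarTower F F' R]

namespace IsFibreFunctor

variable {ω : LaxBraidedFunctor T (ModuleCat.{v} R)} (hω : IsFibreFunctor F T R ω)
  (h : IsScalarExtension F (F' := F') t)

/-- The extension of a fibre functor to the scalar extension. -/
abbrev extend : C ⥤ ModuleCat.{v} R := (hω.ext h).extend h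

/-- The map to the values of the extended fibre functor induced by a morphism. -/
def toExtend {A : T} {M : C} (x : t.obj A ⟶ M) : ω.toFunctor.obj A ⟶ (hω.extend h).obj M :=
  (hω.ext h).toExt h x

lemma toExtend_comp {A B : T} {M : C} (f : t.obj A ⟶ t.obj B) (x : t.obj B ⟶ M)
    (a : ω.toFunctor.obj A) :
    hω.toExtend h (f ≫ x) a = hω.toExtend h x (hω.map h f a) :=
  congrArg (fun k => k.hom a) ((hω.ext h).toExt_comp h f x)

lemma toExtend_map_comp {A B : T} {M : C} (f : A ⟶ B) (x : t.obj B ⟶ M)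
    (a : ω.toFunctor.obj A) :
    hω.toExtend h (t.map f ≫ x) a = hω.toExtend h x (ω.toFunctor.map f a) := by
  rw [toExtend_comp, map_map]

lemma toExtend_zero {A : T} {M : C} (a : ω.toFunctor.obj A) :
    hω.toExtend h (0 : t.obj A ⟶ M) a = 0 :=
  congrArg (fun k => k.hom a) ((hω.ext h).toExt_zero h (M := M) (A := A))

lemma map_toExtend {A : T} {M N : C} (x : t.obj A ⟶ M) (φ : M ⟶ N) (a : ω.toFunctor.obj A) :
    (hω.extend h).map φ (hω.toExtend h x a) = hω.toExtend h (x ≫ φ) a :=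
  congrArg (fun k => k.hom a) ((hω.ext h).toExt_map h φ x)

lemma toExtend_surjective {A : T} {M : C} (x : t.obj A ⟶ M) [Epi x] :
    Function.Surjective (hω.toExtend h x) :=
  (ModuleCat.epi_iff_surjective _).1 (inferInstanceAs (Epi ((hω.ext h).toExt h x)))

lemma toExtend_smul {A : T} {M : C} (c : F') (x : t.obj A ⟶ M) (a : ω.toFunctor.obj A) :
    hω.toExtend h (c • x) a = algebraMap F' R c • hω.toExtend h x a := by
  have : c • x = (c • 𝟙 (t.obj A)) ≫ x := by rw [Linear.smul_comp, Category.id_comp]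
  rw [this, toExtend_comp, map_smul, ← t.map_id, map_map, ω.toFunctor.map_id]
  exact (hω.toExtend h x).hom.map_smul _ _

/-- The relations between the values of the extended fibre functor. -/
theorem exists_of_toExtend_eq_zero (hT : IsPreTannakian F T) {A : T} {M : C} (x : t.obj A ⟶ M)
    (a : ω.toFunctor.obj A) (ha : hω.toExtend h x a = 0) :
    ∃ (Z : T) (z : t.obj Z ⟶ t.obj A) (w : ω.toFunctor.obj Z),
      z ≫ x = 0 ∧ hω.map h z w = a := by
  have := h.additive
  have := hω.additive
  have := hω.rightExact
  obtain ⟨A', q, hq, l, hl⟩ := h.exists_lift_of_epi (h.genπ M) x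
  obtain ⟨a', rfl⟩ := (ModuleCat.epi_iff_surjective (ω.toFunctor.map q)).1 inferInstance a
  rw [← toExtend_map_comp, ← hl, toExtend_comp] at ha
  obtain ⟨r, hr⟩ := (ShortComplex.moduleCat_exact_iff _).1 ((hω.ext h).exact_extπ h M)
    (hω.map h l a') (by
      rw [toExtend, (hω.ext h).toExt_genπ h M] at ha
      exact ha)
  change hω.map h (h.relι M) r = _ at hr
  -- The vanishing of `a` in the cokernel means `ω(l) a' = ω(relι) r`. So the pair `(a', r)` is
  -- killed by the difference of the two morphisms, and the relation theorem on `T` applies to it.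
  obtain ⟨y, hy, hy'⟩ := hω.exists_biprod a' r
  obtain ⟨Z, z, w, hz, hw⟩ := hω.exists_of_mapExt_eq_zero h hT
    (t.map biprod.fst ≫ l - t.map biprod.snd ≫ h.relι M) y (by
      rw [map_sub, map_comp, map_comp, map_map, map_map]
      change hω.map h l (ω.toFunctor.map _ y) - hω.map h (h.relι M) (ω.toFunctor.map _ y) = 0
      rw [hy, hy', hr, sub_self])
  refine ⟨Z, z ≫ t.map biprod.fst ≫ t.map q, w, ?_, ?_⟩
  · have h1 : z ≫ t.map biprod.fst ≫ l = z ≫ t.map biprod.snd ≫ h.relι M := by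
      rw [← sub_eq_zero, ← Preadditive.comp_sub, hz]
    rw [Category.assoc, Category.assoc, ← hl, reassoc_of% h1, h.relι_genπ, comp_zero, comp_zero]
  · rw [map_comp, map_comp, map_map, map_map]
    change ω.toFunctor.map q (ω.toFunctor.map biprod.fst (hω.map h z w)) = _
    rw [hw, hy]

/-- Only preservation of monomorphisms remains. An element killed by `f` is represented by one
coming from some `z` with `z ≫ genπ ≫ f = 0`; as `f` is a monomorphism, `z ≫ genπ = 0`, and the
element is zero. -/
lemma preservesFiniteLimits_extend (hT : IsPreTannakian F T) :
    PreservesFiniteLimits (hω.extend h) := by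
  have hmono : ∀ {M N : C} (f : M ⟶ N), Mono f → Mono ((hω.extend h).map f) := by
    intro M N f hf
    rw [ModuleCat.mono_iff_injective, injective_iff_map_eq_zero]
    intro y hy
    obtain ⟨a, rfl⟩ := hω.toExtend_surjective h (h.genπ M) y
    rw [map_toExtend] at hy
    obtain ⟨Z, z, w, hz, rfl⟩ := hω.exists_of_toExtend_eq_zero h hT _ _ hy
    have : z ≫ h.genπ M = 0 := by
      rw [← cancel_mono f, Category.assoc, hz, zero_comp]
    rw [← toExtend_comp, this, toExtend_zero]
  have e' := (Functor.preservesFiniteLimits_tfae (hω.extend h)).out 0 3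
  refine e'.1 fun S hS => ?_
  have := hS.mono_f
  have := hS.epi_g
  have e := (Functor.preservesFiniteColimits_tfae (hω.extend h)).out 3 0
  have h1 := e.1 inferInstance S hS
  exact ⟨h1.1, hmono _ inferInstance⟩

lemma finite_extend (M : C) : Module.Finite R ((hω.extend h).obj M) :=
  have := hω.finite
  Module.Finite.of_surjective (hω.toExtend h (h.genπ M)).hom
    (hω.toExtend_surjective h (h.genπ M))

/-- The generalized inverse for the relations, specialized to `R`, gives an endomorphism `e` of
`ω(gen M)` with values in the image of `u` and equal to the identity there. Hence `id - e` factors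
through the quotient `p` and splits it, making the value at `M` a summand of a projective module. -/
lemma projective_extend (hT : IsPreTannakian F T) (M : C) :
    Module.Projective R ((hω.extend h).obj M) := by
  have := hω.finite
  have := hω.projective
  have := hT.toMonoidalPreadditive
  have := hT.toMonoidalLinear
  obtain ⟨n, m, xs, ls, hm⟩ := hω.exists_coeff_eq h (h.relι M) hT
  let u : ω.toFunctor.obj (h.rel M) ⟶ ω.toFunctor.obj (h.gen M) := hω.map h (h.relι M)
  let p : ω.toFunctor.obj (h.gen M) ⟶ (hω.extend h).obj M := hω.toExtend h (h.genπ M)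
  have hup : ∀ x, p (u x) = 0 := fun x => by
    have := hω.toExtend_comp h (h.relι M) (h.genπ M) x
    rw [h.relι_genπ, toExtend_zero] at this
    exact this.symm
  let e : ω.toFunctor.obj (h.gen M) →ₗ[R] ω.toFunctor.obj (h.gen M) :=
    ∑ s, (mulHom F F' R (m s)) • (ls s).smulRight (u (xs s))
  have he : ∀ y, e y = ∑ s, mulHom F F' R (m s) • ls s y • u (xs s) := fun y => by
    simp [e, LinearMap.sum_apply]
  have heu : ∀ x, e (u x) = u x := fun x => by
    refine eq_of_dual (R := R) fun l => ?_
    have h1 := congrArg (mulHom F F' R) (hm x l)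
    simp only [map_sum, map_mul, mulHom_coeff] at h1
    rw [he, map_sum, h1]
    refine Finset.sum_congr rfl fun s _ => ?_
    rw [_root_.map_smul, _root_.map_smul]
    rfl
  have hpe : ∀ y, p (e y) = 0 := fun y => by
    rw [he, map_sum]
    refine Finset.sum_eq_zero fun s _ => ?_
    rw [_root_.map_smul, _root_.map_smul, hup, smul_zero, smul_zero]
  have hp : Function.Surjective p := hω.toExtend_surjective h (h.genπ M)
  have hker : LinearMap.ker p.hom ≤ LinearMap.ker (LinearMap.id - e) := by
    intro y hy
    obtain ⟨r, rfl⟩ := (ShortComplex.moduleCat_exact_iff _).1 ((hω.ext h).exact_extπ h M) y (by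
      have : p.hom y = 0 := hy
      simp only [p, toExtend, (hω.ext h).toExt_genπ h M] at this
      exact this)
    exact sub_eq_zero.2 (heu r).symm
  let s : (hω.extend h).obj M →ₗ[R] ω.toFunctor.obj (h.gen M) :=
    (LinearMap.ker p.hom).liftQ (LinearMap.id - e) hker ∘ₗ
      (p.hom.quotKerEquivOfSurjective hp).symm.toLinearMap
  refine Module.Projective.of_split s p.hom ?_
  refine LinearMap.ext fun z => ?_
  obtain ⟨y, rfl⟩ := hp z
  have h2 : s (p y) = y - e y := by
    have : (p.hom.quotKerEquivOfSurjective hp).symm (p y) = Submodule.Quotient.mk y := by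
      rw [LinearEquiv.symm_apply_eq]
      rfl
    change (LinearMap.ker p.hom).liftQ (LinearMap.id - e) hker
      ((p.hom.quotKerEquivOfSurjective hp).symm (p y)) = _
    rw [this]
    rfl
  change p (s (p y)) = p y
  rw [h2, map_sub, hpe, sub_zero]

end IsFibreFunctor

end

/-! ### The tensor structure of the extended fibre functor -/

section

open Functor.OplaxMonoidal

variable {F F' : Type v} [Field F] [Field F'] [Algebra F F']
  {T : Type u} [Category.{v} T] [Abelian T] [Linear F T] [MonoidalCategory T]
  [SymmetricCategory T] {C : Type*} [Category.{v} C] [Abelian C] [Linear F' C]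
  [MonoidalCategory C] [SymmetricCategory C] {t : T ⥤ C} [t.Braided]

/-- The tensor product of two morphisms, composed with the comparison map of `t`. -/
def tens {A B : T} {M N : C} (x : t.obj A ⟶ M) (y : t.obj B ⟶ N) : t.obj (A ⊗ B) ⟶ M ⊗ N :=
  δ t A B ≫ (x ⊗ₘ y)

lemma tens_comp_tensorHom {A B : T} {M M' N N' : C} (x : t.obj A ⟶ M) (y : t.obj B ⟶ N)
    (φ : M ⟶ M') (ψ : N ⟶ N') : tens x y ≫ (φ ⊗ₘ ψ) = tens (x ≫ φ) (y ≫ ψ) := by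
  rw [tens, tens, Category.assoc, MonoidalCategory.tensorHom_comp_tensorHom]

lemma tens_comp_whiskerRight {A B : T} {M M' N : C} (x : t.obj A ⟶ M) (y : t.obj B ⟶ N)
    (φ : M ⟶ M') : tens x y ≫ φ ▷ N = tens (x ≫ φ) y := by
  rw [← tensorHom_id, tens_comp_tensorHom, Category.comp_id]

lemma tens_comp_whiskerLeft {A B : T} {M N N' : C} (x : t.obj A ⟶ M) (y : t.obj B ⟶ N)
    (φ : N ⟶ N') : tens x y ≫ M ◁ φ = tens x (y ≫ φ) := by
  rw [← id_tensorHom, tens_comp_tensorHom, Category.comp_id]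

lemma map_tens {A A' B B' : T} {M N : C} (f : A ⟶ A') (g : B ⟶ B') (x : t.obj A' ⟶ M)
    (y : t.obj B' ⟶ N) : t.map (f ⊗ₘ g) ≫ tens x y = tens (t.map f ≫ x) (t.map g ≫ y) := by
  rw [tens, ← Category.assoc, ← δ_natural, Category.assoc,
    MonoidalCategory.tensorHom_comp_tensorHom]
  rfl

lemma tens_associator {A B D : T} {M N P : C} (x : t.obj A ⟶ M) (y : t.obj B ⟶ N)
    (z : t.obj D ⟶ P) :
    tens (tens x y) z ≫ (α_ M N P).hom = t.map (α_ A B D).hom ≫ tens x (tens y z) := by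
  have h1 : tens (tens x y) z = δ t (A ⊗ B) D ≫ δ t A B ▷ t.obj D ≫ ((x ⊗ₘ y) ⊗ₘ z) := by
    rw [tens, tens, ← tensorHom_id, MonoidalCategory.tensorHom_comp_tensorHom, Category.id_comp]
  have h2 : tens x (tens y z) = δ t A (B ⊗ D) ≫ t.obj A ◁ δ t B D ≫ (x ⊗ₘ (y ⊗ₘ z)) := by
    rw [tens, tens, ← id_tensorHom, MonoidalCategory.tensorHom_comp_tensorHom, Category.id_comp]
  rw [h1, h2, Category.assoc, Category.assoc, associator_naturality]
  simp

lemma tens_leftUnitor {A : T} {M : C} (x : t.obj A ⟶ M) :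
    tens (η t) x ≫ (λ_ M).hom = t.map (λ_ A).hom ≫ x := by
  rw [tens, MonoidalCategory.tensorHom_def, Category.assoc, Category.assoc, leftUnitor_naturality]
  have h2 : δ t (𝟙_ T) A ≫ η t ▷ t.obj A ≫ (λ_ (t.obj A)).hom = t.map (λ_ A).hom := by
    rw [← cancel_epi (t.map (λ_ A).inv)]
    have := left_unitality t A
    rw [← t.map_comp, Iso.inv_hom_id, t.map_id, ← Category.assoc (δ t _ _), ← Category.assoc,
      ← this, Iso.inv_hom_id]
  rw [← h2, Category.assoc, Category.assoc]

lemma tens_braiding {A B : T} {M N : C} (x : t.obj A ⟶ M) (y : t.obj B ⟶ N) :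
    tens x y ≫ (β_ M N).hom = t.map (β_ A B).hom ≫ tens y x := by
  rw [tens, tens, Category.assoc, BraidedCategory.braiding_naturality, Functor.map_braiding]
  simp

lemma tens_rightUnitor {A : T} {M : C} (x : t.obj A ⟶ M) :
    tens x (η t) ≫ (ρ_ M).hom = t.map (ρ_ A).hom ≫ x := by
  rw [← braiding_leftUnitor, ← Category.assoc, tens_braiding, Category.assoc, tens_leftUnitor,
    ← Category.assoc, ← t.map_comp, braiding_leftUnitor]

variable [MonoidalPreadditive T] [MonoidalLinear F T]

/-- The monoidal structure on `C` is arbitrary here. Its bilinearity and its compatibility with `t`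
force it to agree with `box` on morphisms between objects of the image. -/
lemma box_tens [MonoidalPreadditive C] [MonoidalLinear F' C]
    (h : IsScalarExtension F (F' := F') t) {A A' B B' : T} {M N : C}
    (f : t.obj A ⟶ t.obj A') (g : t.obj B ⟶ t.obj B') (x : t.obj A' ⟶ M) (y : t.obj B' ⟶ N) :
    h.box f g ≫ tens x y = tens (f ≫ x) (g ≫ y) := by
  refine h.hom_induction (fun a f => ?_) (fun f₁ f₂ h₁ h₂ => ?_) f
  · refine h.hom_induction (fun b g => ?_) (fun f₁ f₂ h₁ h₂ => ?_) g
    · rw [h.box_smul_smul, Linear.smul_comp, map_tens, Linear.smul_comp, Linear.smul_comp, tens,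
        tens, MonoidalCategory.tensorHom_def, MonoidalCategory.tensorHom_def]
      simp [smul_smul, mul_comm]
    · rw [h.box_add, Preadditive.add_comp, Preadditive.add_comp, h₁, h₂, tens, tens, tens,
        MonoidalCategory.tensorHom_def, MonoidalCategory.tensorHom_def,
        MonoidalCategory.tensorHom_def]
      simp
  · rw [h.add_box, Preadditive.add_comp, Preadditive.add_comp, h₁, h₂, tens, tens, tens,
      MonoidalCategory.tensorHom_def, MonoidalCategory.tensorHom_def,
      MonoidalCategory.tensorHom_def]
    simp

end

/-! ### Lax monoidal structure of the extended fibre functor -/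

section

open TensorProduct

variable {F F' : Type v} [Field F] [Field F'] [Algebra F F']
  {T : Type u} [Category.{v} T] [Abelian T] [Linear F T] [MonoidalCategory T]
  [SymmetricCategory T] {C : Type*} [Category.{v} C] [Abelian C] [Linear F' C]
  [MonoidalCategory C] [SymmetricCategory C] {t : T ⥤ C} [t.Braided]
  {R : Type v} [CommRing R] [Algebra F R] [Algebra F' R] [IsScalarTower F F' R]

namespace IsFibreFunctor

variable {ω : LaxBraidedFunctor T (ModuleCat.{v} R)} (hω : IsFibreFunctor F T R ω)
  (h : IsScalarExtension F (F' := F') t)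

variable [MonoidalPreadditive T] [MonoidalLinear F T] [MonoidalPreadditive C]
  [MonoidalLinear F' C]

lemma exists_mulLeft {A : T} {M : C} (x : t.obj A ⟶ M) (N : C) (a : ω.toFunctor.obj A) :
    ∃ L : (hω.extend h).obj N ⟶ (hω.extend h).obj (M ⊗ N), ∀ (B : T) (y : t.obj B ⟶ N)
      (b : ω.toFunctor.obj B), L (hω.toExtend h y b) =
        hω.toExtend h (tens x y) (mul ω.toFunctor A B a b) := by
  let β : (hω.ext h).Family N ((hω.extend h).obj (M ⊗ N)) :=
    { app := fun {B} y => ModuleCat.ofHom ((hω.toExtend h (tens x y)).hom ∘ₗ mul ω.toFunctor A B a)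
      naturality := fun {B B'} f y => by
        refine ModuleCat.hom_ext (LinearMap.ext fun b => ?_)
        change hω.toExtend h (tens x (f ≫ y)) (mul ω.toFunctor A B a b) =
          hω.toExtend h (tens x y) (mul ω.toFunctor A B' a (hω.map h f b))
        have h1 : hω.map h (𝟙 (t.obj A)) a = a := by
          rw [← t.map_id, map_map, ω.toFunctor.map_id]
          rfl
        conv_rhs => rw [← h1]
        rw [← map_box_mul, ← toExtend_comp, box_tens, Category.id_comp] }
  exact ⟨(hω.ext h).extDesc h β, fun B y b =>
    congrArg (fun k => k.hom b) ((hω.ext h).toExt_extDesc h β y)⟩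

lemma hom_ext_toExtend {M : C} {P : ModuleCat.{v} R} {f g : (hω.extend h).obj M ⟶ P}
    (hfg : ∀ (a : ω.toFunctor.obj (h.gen M)),
      f (hω.toExtend h (h.genπ M) a) = g (hω.toExtend h (h.genπ M) a)) : f = g := by
  refine ModuleCat.hom_ext (LinearMap.ext fun m => ?_)
  obtain ⟨a, rfl⟩ := hω.toExtend_surjective h (h.genπ M) m
  exact hfg a

/-- The product descends one variable at a time: first in `N` for a fixed element over `M` by
`exists_mulLeft`, then in `M`, as a family with values in a module of linear maps. -/
lemma exists_extendMul (M N : C) :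
    ∃ L : (hω.extend h).obj M →ₗ[R] (hω.extend h).obj N →ₗ[R] (hω.extend h).obj (M ⊗ N),
      ∀ (A B : T) (x : t.obj A ⟶ M) (y : t.obj B ⟶ N) (a : ω.toFunctor.obj A)
        (b : ω.toFunctor.obj B), L (hω.toExtend h x a) (hω.toExtend h y b) =
          hω.toExtend h (tens x y) (mul ω.toFunctor A B a b) := by
  choose L hL using fun (A : T) (x : t.obj A ⟶ M) => hω.exists_mulLeft h x N
  let l {A : T} (x : t.obj A ⟶ M) : ω.toFunctor.obj A →ₗ[R]
      ((hω.extend h).obj N →ₗ[R] (hω.extend h).obj (M ⊗ N)) :=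
    { toFun := fun a => (L A x a).hom
      map_add' := fun a a' => by
        refine LinearMap.ext fun n => ?_
        obtain ⟨b, rfl⟩ := hω.toExtend_surjective h (h.genπ N) n
        refine (hL _ _ _ _ _ _).trans ?_
        rw [map_add, LinearMap.add_apply, map_add, LinearMap.add_apply]
        exact (congrArg₂ (· + ·) (hL _ _ _ _ _ _) (hL _ _ _ _ _ _)).symm
      map_smul' := fun r a => by
        refine LinearMap.ext fun n => ?_
        obtain ⟨b, rfl⟩ := hω.toExtend_surjective h (h.genπ N) n
        refine (hL _ _ _ _ _ _).trans ?_
        rw [_root_.map_smul, LinearMap.smul_apply, _root_.map_smul]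
        exact (congrArg (r • ·) (hL _ _ _ _ _ _)).symm }
  let β : (hω.ext h).Family M
      (ModuleCat.of R ((hω.extend h).obj N →ₗ[R] (hω.extend h).obj (M ⊗ N))) :=
    { app := fun x => ModuleCat.ofHom (l x)
      naturality := fun {A A'} f x => by
        refine ModuleCat.hom_ext (LinearMap.ext fun a => LinearMap.ext fun n => ?_)
        obtain ⟨b, rfl⟩ := hω.toExtend_surjective h (h.genπ N) n
        refine (hL _ _ _ _ _ _).trans (Eq.trans ?_ (hL _ _ _ _ _ _).symm)
        have h1 : hω.map h (𝟙 (t.obj (h.gen N))) b = b := by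
          rw [← t.map_id, map_map, ω.toFunctor.map_id]
          rfl
        change _ = hω.toExtend h (tens x (h.genπ N)) (mul ω.toFunctor _ _ (hω.map h f a) b)
        conv_rhs => rw [← h1]
        rw [← map_box_mul, ← toExtend_comp, box_tens, Category.id_comp] }
  refine ⟨((hω.ext h).extDesc h β).hom, fun A B x y a b => ?_⟩
  have h2 := congrArg (fun k => k.hom a) ((hω.ext h).toExt_extDesc h β x)
  exact (congrArg (fun k => k (hω.toExtend h y b)) h2).trans (hL _ _ _ _ _ _)

/-- The tensor product of elements of the values of the extended fibre functor. -/
def extendMul (M N : C) :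
    (hω.extend h).obj M →ₗ[R] (hω.extend h).obj N →ₗ[R] (hω.extend h).obj (M ⊗ N) :=
  (hω.exists_extendMul h M N).choose

lemma extendMul_toExtend {M N : C} {A B : T} (x : t.obj A ⟶ M) (y : t.obj B ⟶ N)
    (a : ω.toFunctor.obj A) (b : ω.toFunctor.obj B) :
    hω.extendMul h M N (hω.toExtend h x a) (hω.toExtend h y b) =
      hω.toExtend h (tens x y) (mul ω.toFunctor A B a b) :=
  (hω.exists_extendMul h M N).choose_spec _ _ _ _ _ _

/-- The comparison map of the extended fibre functor. -/
def extendμ (M N : C) :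
    (hω.extend h).obj M ⊗ (hω.extend h).obj N ⟶ (hω.extend h).obj (M ⊗ N) :=
  ModuleCat.ofHom (TensorProduct.lift (hω.extendMul h M N))

lemma extendμ_tmul {M N : C} {A B : T} (x : t.obj A ⟶ M) (y : t.obj B ⟶ N)
    (a : ω.toFunctor.obj A) (b : ω.toFunctor.obj B) :
    hω.extendμ h M N (hω.toExtend h x a ⊗ₜ[R] hω.toExtend h y b) =
      hω.toExtend h (tens x y) (mul ω.toFunctor A B a b) :=
  hω.extendMul_toExtend h x y a b

lemma tensor_hom_ext {M N : C} {P : ModuleCat.{v} R}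
    {f g : (hω.extend h).obj M ⊗ (hω.extend h).obj N ⟶ P}
    (hfg : ∀ (a : ω.toFunctor.obj (h.gen M)) (b : ω.toFunctor.obj (h.gen N)),
      f (hω.toExtend h (h.genπ M) a ⊗ₜ[R] hω.toExtend h (h.genπ N) b) =
        g (hω.toExtend h (h.genπ M) a ⊗ₜ[R] hω.toExtend h (h.genπ N) b)) : f = g := by
  refine ModuleCat.hom_ext (TensorProduct.ext' fun m n => ?_)
  obtain ⟨a, rfl⟩ := hω.toExtend_surjective h (h.genπ M) m
  obtain ⟨b, rfl⟩ := hω.toExtend_surjective h (h.genπ N) n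
  exact hfg a b

lemma extendμ_natural_left {M M' : C} (f : M ⟶ M') (N : C) :
    (hω.extend h).map f ▷ (hω.extend h).obj N ≫ hω.extendμ h M' N =
      hω.extendμ h M N ≫ (hω.extend h).map (f ▷ N) := by
  refine hω.tensor_hom_ext h fun a b => ?_
  change hω.extendμ h M' N ((hω.extend h).map f (hω.toExtend h _ a) ⊗ₜ[R]
      hω.toExtend h (h.genπ N) b) =
    (hω.extend h).map (f ▷ N) (hω.extendμ h M N _)
  rw [extendμ_tmul, map_toExtend, map_toExtend, extendμ_tmul, tens_comp_whiskerRight]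

lemma extendμ_natural_right (M : C) {N N' : C} (f : N ⟶ N') :
    (hω.extend h).obj M ◁ (hω.extend h).map f ≫ hω.extendμ h M N' =
      hω.extendμ h M N ≫ (hω.extend h).map (M ◁ f) := by
  refine hω.tensor_hom_ext h fun a b => ?_
  change hω.extendμ h M N' (hω.toExtend h (h.genπ M) a ⊗ₜ[R]
      (hω.extend h).map f (hω.toExtend h _ b)) =
    (hω.extend h).map (M ◁ f) (hω.extendμ h M N _)
  rw [extendμ_tmul, map_toExtend, map_toExtend, extendμ_tmul, tens_comp_whiskerLeft]

/-- The extended fibre functor is a lax monoidal functor. -/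
@[reducible]
def laxMonoidalExtend : (hω.extend h).LaxMonoidal where
  ε := Functor.LaxMonoidal.ε ω.toFunctor ≫ hω.toExtend h (Functor.OplaxMonoidal.η t)
  μ := hω.extendμ h
  μ_natural_left f N := hω.extendμ_natural_left h f N
  μ_natural_right M f := hω.extendμ_natural_right h M f
  associativity M N P := by
    refine ModuleCat.hom_ext (TensorProduct.ext_threefold fun m n p => ?_)
    obtain ⟨a, rfl⟩ := hω.toExtend_surjective h (h.genπ M) m
    obtain ⟨b, rfl⟩ := hω.toExtend_surjective h (h.genπ N) n
    obtain ⟨c, rfl⟩ := hω.toExtend_surjective h (h.genπ P) p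
    change (hω.extend h).map (α_ M N P).hom (hω.extendμ h (M ⊗ N) P
      (hω.extendμ h M N (hω.toExtend h _ a ⊗ₜ[R] hω.toExtend h _ b) ⊗ₜ[R] hω.toExtend h _ c)) =
      hω.extendμ h M (N ⊗ P) (hω.toExtend h _ a ⊗ₜ[R]
        hω.extendμ h N P (hω.toExtend h _ b ⊗ₜ[R] hω.toExtend h _ c))
    rw [extendμ_tmul, extendμ_tmul, extendμ_tmul, extendμ_tmul, map_toExtend, tens_associator,
      toExtend_map_comp, map_associator_mul]
  left_unitality M := by
    refine ModuleCat.hom_ext (TensorProduct.ext' fun r m => ?_)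
    obtain ⟨a, rfl⟩ := hω.toExtend_surjective h (h.genπ M) m
    change r • hω.toExtend h _ a = (hω.extend h).map (λ_ M).hom (hω.extendμ h (𝟙_ C) M
      (hω.toExtend h (Functor.OplaxMonoidal.η t) (Functor.LaxMonoidal.ε ω.toFunctor r) ⊗ₜ[R]
        hω.toExtend h _ a))
    have hr : Functor.LaxMonoidal.ε ω.toFunctor r = r • one ω.toFunctor := by
      rw [one, ← _root_.map_smul]
      exact congrArg _ (mul_one r).symm
    rw [hr, extendμ_tmul, map_toExtend, tens_leftUnitor, toExtend_map_comp, _root_.map_smul,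
      LinearMap.smul_apply, _root_.map_smul, map_leftUnitor_mul, _root_.map_smul]
  right_unitality M := by
    refine ModuleCat.hom_ext (TensorProduct.ext' fun m r => ?_)
    obtain ⟨a, rfl⟩ := hω.toExtend_surjective h (h.genπ M) m
    change r • hω.toExtend h _ a = (hω.extend h).map (ρ_ M).hom (hω.extendμ h M (𝟙_ C)
      (hω.toExtend h _ a ⊗ₜ[R]
        hω.toExtend h (Functor.OplaxMonoidal.η t) (Functor.LaxMonoidal.ε ω.toFunctor r)))
    have hr : Functor.LaxMonoidal.ε ω.toFunctor r = r • one ω.toFunctor := by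
      rw [one, ← _root_.map_smul]
      exact congrArg _ (mul_one r).symm
    rw [hr, extendμ_tmul, map_toExtend, tens_rightUnitor, toExtend_map_comp, _root_.map_smul,
      _root_.map_smul, map_rightUnitor_mul, _root_.map_smul]

@[reducible]
def laxBraidedExtend : (hω.extend h).LaxBraided :=
  { hω.laxMonoidalExtend h with
    braided := fun M N => by
      refine hω.tensor_hom_ext h fun a b => ?_
      change (hω.extend h).map (β_ M N).hom (hω.extendμ h M N
        (hω.toExtend h _ a ⊗ₜ[R] hω.toExtend h _ b)) =
        hω.extendμ h N M (hω.toExtend h _ b ⊗ₜ[R] hω.toExtend h _ a)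
      rw [extendμ_tmul, extendμ_tmul, map_toExtend, tens_braiding, toExtend_map_comp,
        map_braiding_mul] }

end IsFibreFunctor

end

/-! ### The extended fibre functor is a fibre functor -/

section

open TensorProduct

instance preservesFiniteColimits_tensorLeft {R : Type v} [CommRing R] (P : ModuleCat.{v} R) :
    PreservesFiniteColimits (tensorLeft P) :=
  have := (ihom.adjunction P).leftAdjoint_preservesColimits
  inferInstance

instance preservesFiniteColimits_tensorRight {R : Type v} [CommRing R] (P : ModuleCat.{v} R) :
    PreservesFiniteColimits (tensorRight P) :=
  ⟨fun _ _ _ => preservesColimitsOfShape_of_natIso (BraidedCategory.tensorLeftIsoTensorRight P)⟩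

variable {F F' : Type v} [Field F] [Field F'] [Algebra F F']
  {T : Type u} [Category.{v} T] [Abelian T] [Linear F T] [MonoidalCategory T]
  [SymmetricCategory T] {C : Type*} [Category.{v} C] [Abelian C] [Linear F' C] {t : T ⥤ C}
  {R : Type v} [CommRing R] [Algebra F R] [Algebra F' R] [IsScalarTower F F' R]

namespace IsFibreFunctor

variable {ω : LaxBraidedFunctor T (ModuleCat.{v} R)} (hω : IsFibreFunctor F T R ω)
  (h : IsScalarExtension F (F' := F') t)

lemma isIso_toExtend {A : T} {M : C} (x : t.obj A ⟶ M) [IsIso x] : IsIso (hω.toExtend h x) := by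
  have h1 := Functor.map_isIso (hω.extend h) x
  have h2 : IsIso ((hω.ext h).extendIso h A).hom := inferInstance
  rw [toExtend, (hω.ext h).toExt_eq h]
  exact @IsIso.comp_isIso _ _ _ _ _ _ _ h2 h1

lemma nontrivial (hω : IsFibreFunctor F T R ω) (hT : IsPreTannakian F T) : Nontrivial R := by
  by_contra hR
  rw [not_nontrivial_iff_subsingleton] at hR
  have := hω.faithful
  have h1 : 𝟙 (𝟙_ T) = 0 := ω.toFunctor.map_injective (ModuleCat.hom_ext (LinearMap.ext fun x => by
    have := Module.subsingleton R (ω.toFunctor.obj (𝟙_ T))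
    exact Subsingleton.elim _ _))
  have h2 : algebraMap F (End (𝟙_ T)) 1 = algebraMap F (End (𝟙_ T)) 0 := by
    rw [map_one, map_zero]
    exact h1
  exact one_ne_zero (hT.end_unit.1 h2)

section

variable [MonoidalPreadditive T] [MonoidalLinear F T]

/-- A morphism which is surjective under a fibre functor is an epimorphism. -/
lemma epi_of_map_surjective (hT : IsPreTannakian F T) {X Z : T} (z : t.obj Z ⟶ t.obj X)
    (hz : Function.Surjective (hω.map h z)) : Epi z := by
  have := hω.nontrivial hT
  have := hω.additive
  have := h.additive
  have := hω.isIso_ε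
  have := hω.isIso_μ
  have := hT.pairing X
  let D := hT.dual X
  let c := η_ X D
  -- The goal is to lift coevaluation along `z ⊗ D` after an epimorphism onto the unit, because
  -- transposing such a lift shows that `z` is an epimorphism. Under `ω` the lift exists by
  -- surjectivity.
  have h1 : ∃ w, hω.map h (h.box z (𝟙 (t.obj D))) w = ω.toFunctor.map c (one ω.toFunctor) := by
    have h2 : (⊤ : Submodule R _) ≤
        LinearMap.range (hω.map h (h.box z (𝟙 (t.obj D)))).hom := by
      rw [← span_mul ω.toFunctor X D, Submodule.span_le]
      rintro _ ⟨⟨x, d⟩, rfl⟩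
      obtain ⟨x, rfl⟩ := hz x
      refine ⟨mul ω.toFunctor Z D x d, ?_⟩
      refine (hω.map_box_mul h z (𝟙 (t.obj D)) x d).trans ?_
      rw [← t.map_id, map_map, ω.toFunctor.map_id]
      rfl
    exact h2 trivial
  obtain ⟨w, hw⟩ := h1
  obtain ⟨y, hy, hy'⟩ := hω.exists_biprod w (one ω.toFunctor)
  -- The relation between `w` and the unit element is realized by a morphism `g` of `C`. Its
  -- component in the unit is nonzero because it hits the unit element and `R` is nontrivial, so it
  -- restricts to `a • t e` with `e` an epimorphism; dividing by `a` gives the lift `s`.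
  obtain ⟨U, g, v, hg, hv⟩ := hω.exists_of_mapExt_eq_zero h hT
    (t.map biprod.fst ≫ h.box z (𝟙 (t.obj D)) - t.map biprod.snd ≫ t.map c) y (by
      rw [map_sub, map_comp, map_comp, map_map, map_map, map_map]
      change hω.map h _ (ω.toFunctor.map _ y) - ω.toFunctor.map c (ω.toFunctor.map _ y) = 0
      rw [hy, hy', hw, sub_self])
  have hne : g ≫ t.map biprod.snd ≠ 0 := by
    intro h0
    have h3 : hω.map h (g ≫ t.map biprod.snd) v = one ω.toFunctor := by
      rw [map_comp, map_map]
      change ω.toFunctor.map _ (hω.map h g v) = _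
      rw [hv, hy']
    rw [h0, map_zero] at h3
    have h4 := dualOne_one ω.toFunctor
    rw [← h3] at h4
    exact zero_ne_one ((map_zero _).symm.trans h4)
  obtain ⟨Y, j, e, a, he, ha, hj⟩ := h.exists_epi_unit hT _ hne
  let s : t.obj Y ⟶ t.obj (Z ⊗ D) := a⁻¹ • (t.map j ≫ g ≫ t.map biprod.fst)
  have hs : s ≫ h.box z (𝟙 (t.obj D)) = t.map (e ≫ c) := by
    have h5 : g ≫ t.map biprod.fst ≫ h.box z (𝟙 (t.obj D)) =
        (g ≫ t.map biprod.snd) ≫ t.map c := by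
      rw [Category.assoc, ← sub_eq_zero, ← Preadditive.comp_sub, hg]
    rw [Linear.smul_comp, Category.assoc, Category.assoc, h5, ← Category.assoc, hj,
      Linear.smul_comp, smul_smul, inv_mul_cancel₀ ha, one_smul, t.map_comp]
  have hs' : h.box s (𝟙 (t.obj X)) ≫ h.box (h.box z (𝟙 (t.obj D))) (𝟙 (t.obj X)) =
      t.map (e ▷ X ≫ c ▷ X) := by
    rw [← h.box_comp, hs, Category.comp_id, ← t.map_id, h.box_map, tensorHom_id, comp_whiskerRight]
  have hX : c ▷ X ≫ (α_ X D X).hom ≫ X ◁ ε_ X D ≫ (ρ_ X).hom = (λ_ X).hom := by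
    rw [ExactPairing.evaluation_coevaluation_assoc]
    simp
  have hz' : h.box (h.box z (𝟙 (t.obj D))) (𝟙 (t.obj X)) ≫
      t.map ((α_ X D X).hom ≫ X ◁ ε_ X D ≫ (ρ_ X).hom) =
      t.map ((α_ Z D X).hom ≫ Z ◁ ε_ X D ≫ (ρ_ Z).hom) ≫ z := by
    have h6 : h.box z (𝟙 (t.obj (D ⊗ X))) ≫ t.map (X ◁ ε_ X D) =
        t.map (Z ◁ ε_ X D) ≫ h.box z (𝟙 (t.obj (𝟙_ T))) := by
      rw [← id_tensorHom, ← id_tensorHom, ← h.box_map, ← h.box_map, t.map_id, t.map_id,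
        ← h.box_comp, ← h.box_comp, Category.id_comp, Category.id_comp, Category.comp_id,
        Category.comp_id]
    rw [t.map_comp, t.map_comp, ← Category.assoc, h.box_associator, h.box_id, Category.assoc,
      reassoc_of% h6, box_rightUnitor]
    simp
  -- Transposing `s` and applying the zigzag identity exhibits `e ⊗ X`, an epimorphism, as a
  -- morphism factoring through `z`.
  have hfin : (h.box s (𝟙 (t.obj X)) ≫ t.map ((α_ Z D X).hom ≫ Z ◁ ε_ X D ≫ (ρ_ Z).hom)) ≫ z =
      t.map (e ▷ X ≫ (λ_ X).hom) := by
    rw [Category.assoc, ← hz', ← Category.assoc, hs', ← t.map_comp, Category.assoc, hX]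
  have : Epi (e ▷ X) := by
    have := hT.rightExact_right X
    exact inferInstanceAs (Epi ((tensorRight X).map e))
  have := h.preservesFiniteColimits
  have : Epi ((h.box s (𝟙 (t.obj X)) ≫
      t.map ((α_ Z D X).hom ≫ Z ◁ ε_ X D ≫ (ρ_ Z).hom)) ≫ z) := by
    rw [hfin]
    infer_instance
  exact epi_of_epi (h.box s (𝟙 (t.obj X)) ≫
    t.map ((α_ Z D X).hom ≫ Z ◁ ε_ X D ≫ (ρ_ Z).hom)) z

/-- The elements which come from relations of `x`. -/
lemma exists_surjective_of_toExtend_eq_zero (hT : IsPreTannakian F T) {A : T} {M : C}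
    (x : t.obj A ⟶ M) (hx : ∀ a, hω.toExtend h x a = 0) :
    ∃ (Z : T) (z : t.obj Z ⟶ t.obj A), z ≫ x = 0 ∧ Function.Surjective (hω.map h z) := by
  classical
  have := hω.additive
  have := h.additive
  have := hω.finite
  obtain ⟨s, hs⟩ := (Module.Finite.fg_top : (⊤ : Submodule R (ω.toFunctor.obj A)).FG)
  have key : ∀ s : Finset (ω.toFunctor.obj A), ∃ (Z : T) (z : t.obj Z ⟶ t.obj A), z ≫ x = 0 ∧
      (s : Set (ω.toFunctor.obj A)) ⊆ LinearMap.range (hω.map h z).hom := by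
    intro s
    induction s using Finset.induction_on with
    | empty => exact ⟨A, 0, zero_comp, by simp⟩
    | insert a s _ ih =>
      obtain ⟨Z, z, hz, hzs⟩ := ih
      obtain ⟨Y, y, w, hy, hw⟩ := hω.exists_of_toExtend_eq_zero h hT x a (hx a)
      refine ⟨Y ⊞ Z, t.map biprod.fst ≫ y + t.map biprod.snd ≫ z, ?_, ?_⟩
      · rw [Preadditive.add_comp, Category.assoc, Category.assoc, hy, hz, comp_zero, comp_zero,
          add_zero]
      · have h1 : ∀ (b : ω.toFunctor.obj Y) (c : ω.toFunctor.obj Z), ∃ p,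
            hω.map h (t.map biprod.fst ≫ y + t.map biprod.snd ≫ z) p =
              hω.map h y b + hω.map h z c := by
          intro b c
          obtain ⟨p, hp, hp'⟩ := hω.exists_biprod b c
          refine ⟨p, ?_⟩
          rw [map_add, map_comp, map_comp, map_map, map_map]
          change hω.map h y (ω.toFunctor.map _ p) + hω.map h z (ω.toFunctor.map _ p) = _
          rw [hp, hp']
        rw [Finset.coe_insert, Set.insert_subset_iff]
        refine ⟨?_, fun b hb => ?_⟩
        · obtain ⟨p, hp⟩ := h1 w 0
          exact ⟨p, hp.trans (by rw [hw, map_zero, add_zero])⟩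
        · obtain ⟨c, hc⟩ := hzs hb
          obtain ⟨p, hp⟩ := h1 0 c
          exact ⟨p, hp.trans (by rw [map_zero, zero_add]; exact hc)⟩
  obtain ⟨Z, z, hz, hzs⟩ := key s
  refine ⟨Z, z, hz, ?_⟩
  have h2 : LinearMap.range (hω.map h z).hom = ⊤ := by
    rw [eq_top_iff, ← hs, Submodule.span_le]
    exact hzs
  exact LinearMap.range_eq_top.1 h2

/-- If `f - g` becomes zero, all of `ω(gen M)` comes from a single `z` that `genπ ≫ (f - g)` kills.
Surjectivity under `ω` makes `z` an epimorphism, so `f = g`. -/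
lemma faithful_extend (hT : IsPreTannakian F T) : (hω.extend h).Faithful where
  map_injective {M N f g} hfg := by
    rw [← sub_eq_zero]
    obtain ⟨Z, z, hz, hsurj⟩ := hω.exists_surjective_of_toExtend_eq_zero h hT
      (h.genπ M ≫ (f - g)) (fun a => by
        rw [← map_toExtend, Functor.map_sub, hfg, sub_self]
        rfl)
    have := hω.epi_of_map_surjective h hT z hsurj
    rw [← cancel_epi (h.genπ M), ← cancel_epi z, hz, comp_zero, comp_zero]

end

variable [MonoidalCategory C] [SymmetricCategory C] [t.Braided] [MonoidalPreadditive T]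
  [MonoidalLinear F T]

section

variable [MonoidalPreadditive C] [MonoidalLinear F' C]

lemma isIso_extendμ_map (A B : T) : IsIso (hω.extendμ h (t.obj A) (t.obj B)) := by
  have := hω.isIso_μ
  have := hω.isIso_toExtend h (𝟙 (t.obj A))
  have := hω.isIso_toExtend h (𝟙 (t.obj B))
  have : IsIso (tens (𝟙 (t.obj A)) (𝟙 (t.obj B))) := by
    rw [tens]
    infer_instance
  have := hω.isIso_toExtend h (tens (𝟙 (t.obj A)) (𝟙 (t.obj B)))
  have h1 : (hω.toExtend h (𝟙 (t.obj A)) ⊗ₘ hω.toExtend h (𝟙 (t.obj B))) ≫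
      hω.extendμ h (t.obj A) (t.obj B) =
      Functor.LaxMonoidal.μ ω.toFunctor A B ≫
        hω.toExtend h (tens (𝟙 (t.obj A)) (𝟙 (t.obj B))) :=
    ModuleCat.hom_ext (TensorProduct.ext' fun a b => hω.extendμ_tmul h _ _ a b)
  have h2 : IsIso ((hω.toExtend h (𝟙 (t.obj A)) ⊗ₘ hω.toExtend h (𝟙 (t.obj B))) ≫
      hω.extendμ h (t.obj A) (t.obj B)) := by
    rw [h1]
    infer_instance
  exact IsIso.of_isIso_comp_left (hω.toExtend h (𝟙 (t.obj A)) ⊗ₘ hω.toExtend h (𝟙 (t.obj B))) _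

/-- Source and target are right exact in each variable, and on objects of the image the comparison
is that of `ω`. So `isIso_app` applies to the first variable and then to the second. -/
lemma isIso_extendμ (hC : IsTensorCategory F' C) (M N : C) : IsIso (hω.extendμ h M N) := by
  have := hC.rightExact_left
  have := hC.rightExact_right
  have h1 : ∀ A, IsIso (hω.extendμ h M (t.obj A)) := fun A => by
    let α : hω.extend h ⋙ tensorRight ((hω.extend h).obj (t.obj A)) ⟶
        tensorRight (t.obj A) ⋙ hω.extend h :=
      { app := fun M => hω.extendμ h M (t.obj A)
        naturality := fun _ _ f => hω.extendμ_natural_left h f (t.obj A) }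
    exact h.isIso_app α (fun B => hω.isIso_extendμ_map h B A) M
  let α : hω.extend h ⋙ tensorLeft ((hω.extend h).obj M) ⟶ tensorLeft M ⋙ hω.extend h :=
    { app := fun N => hω.extendμ h M N
      naturality := fun _ _ f => hω.extendμ_natural_right h M f }
  exact h.isIso_app α h1 N

/-- The extended fibre functor as a lax braided functor. -/
def extendLaxBraided : LaxBraidedFunctor C (ModuleCat.{v} R) :=
  letI := hω.laxBraidedExtend h
  LaxBraidedFunctor.of (hω.extend h)

end

theorem isFibreFunctor_extend (hT : IsPreTannakian F T) (hC : IsTensorCategory F' C) :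
    haveI := hC.toMonoidalPreadditive
    haveI := hC.toMonoidalLinear
    IsFibreFunctor F' C R (hω.extendLaxBraided h) :=
  haveI := hC.toMonoidalPreadditive
  haveI := hC.toMonoidalLinear
  { isIso_ε := by
      have := hω.isIso_ε
      have := hω.isIso_toExtend h (Functor.OplaxMonoidal.η t)
      exact inferInstanceAs (IsIso (Functor.LaxMonoidal.ε ω.toFunctor ≫
        hω.toExtend h (Functor.OplaxMonoidal.η t)))
    isIso_μ := fun M N => hω.isIso_extendμ h hC M N
    additive := inferInstanceAs (hω.extend h).Additive
    linear := fun {M N} c f => by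
      refine hω.hom_ext_toExtend h fun a => ?_
      change (hω.extend h).map (c • f) (hω.toExtend h _ a) =
        algebraMap F' R c • (hω.extend h).map f (hω.toExtend h _ a)
      rw [map_toExtend, map_toExtend, Linear.comp_smul, toExtend_smul]
    leftExact := hω.preservesFiniteLimits_extend h hT
    rightExact := inferInstanceAs (PreservesFiniteColimits (hω.extend h))
    faithful := hω.faithful_extend h hT
    finite := hω.finite_extend h
    projective := hω.projective_extend h hT }

section

variable [MonoidalPreadditive C] [MonoidalLinear F' C]

/-- The restriction of the extended fibre functor along `t` is the given fibre functor. -/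
def extendRestrictIso : ω ≅ (precomp t).obj (hω.extendLaxBraided h) :=
  letI e : ω.toFunctor ≅ ((precomp t).obj (hω.extendLaxBraided h)).toFunctor :=
    NatIso.ofComponents (fun A => (hω.ext h).extendIso h A) (fun {A B} f => by
      refine ModuleCat.hom_ext (LinearMap.ext fun a => ?_)
      change hω.toExtend h (𝟙 (t.obj B)) (ω.toFunctor.map f a) =
        (hω.extend h).map (t.map f) (hω.toExtend h (𝟙 (t.obj A)) a)
      rw [map_toExtend, Category.id_comp, ← toExtend_map_comp, Category.comp_id])
  haveI : NatTrans.IsMonoidal e.hom :=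
    { unit := by
        refine ModuleCat.hom_ext (LinearMap.ext fun r => ?_)
        change hω.toExtend h (𝟙 (t.obj (𝟙_ T))) (Functor.LaxMonoidal.ε ω.toFunctor r) =
          (hω.extend h).map (Functor.LaxMonoidal.ε t)
            (hω.toExtend h (Functor.OplaxMonoidal.η t) (Functor.LaxMonoidal.ε ω.toFunctor r))
        rw [map_toExtend, Functor.Monoidal.η_ε]
      tensor := fun A B => by
        refine ModuleCat.hom_ext (TensorProduct.ext' fun a b => ?_)
        change hω.toExtend h (𝟙 (t.obj (A ⊗ B))) (mul ω.toFunctor A B a b) =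
          (hω.extend h).map (Functor.LaxMonoidal.μ t A B)
            (hω.extendμ h (t.obj A) (t.obj B)
              (hω.toExtend h (𝟙 (t.obj A)) a ⊗ₜ[R] hω.toExtend h (𝟙 (t.obj B)) b))
        rw [extendμ_tmul, map_toExtend, tens, id_tensorHom_id, Category.comp_id,
          Functor.Monoidal.δ_μ] }
  LaxBraidedFunctor.isoMk e

end

end IsFibreFunctor

end

/-! ### Restriction of fibre functors along the scalar extension -/

section

variable {F F' : Type w} [Field F] [Field F'] [Algebra F F']
  {T : Type*} [Category.{v} T] [Abelian T] [Linear F T] {C : Type*} [Category.{v} C] [Abelian C]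
  [Linear F' C] {t : T ⥤ C}

namespace IsScalarExtension

lemma faithful (h : IsScalarExtension F (F' := F') t) : t.Faithful where
  map_injective {X Y f g} hfg := by
    have := h.additive
    rw [← sub_eq_zero]
    have h1 : LinearIndependent F (fun _ : Fin 1 => (1 : F')) :=
      LinearIndependent.of_subsingleton 0 one_ne_zero
    exact h.eq_zero h1 (fun _ => f - g) (by simp [hfg]) 0

/-- A transformation of functors on the image of the scalar extension functor, natural for all
morphisms between objects of the image, extends to the scalar extension. -/
theorem exists_natTrans (h : IsScalarExtension F (F' := F') t) {D : Type*} [Category* D] [Abelian D] (G G' : C ⥤ D)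
    [PreservesFiniteColimits G] [G'.Additive] (θ : ∀ A, G.obj (t.obj A) ⟶ G'.obj (t.obj A))
    (hθ : ∀ {A B : T} (u : t.obj A ⟶ t.obj B), G.map u ≫ θ B = θ A ≫ G'.map u) :
    ∃ η : G ⟶ G', ∀ A, η.app (t.obj A) = θ A := by
  have := h.preservesFiniteColimits
  have h1 : ∀ M : C, ∃ g : G.obj M ⟶ G'.obj M,
      G.map (h.genπ M) ≫ g = θ (h.gen M) ≫ G'.map (h.genπ M) := fun M => by
    refine exists_desc_of_preservesFiniteColimits G (h.genπ M) _ ?_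
    obtain ⟨Y, k, hk⟩ := h.exists_cover (kernel (h.genπ M))
    rw [← cancel_epi (G.map k), ← Category.assoc, ← G.map_comp, ← Category.assoc, hθ,
      Category.assoc, ← G'.map_comp, Category.assoc, kernel.condition, comp_zero, G'.map_zero,
      comp_zero, comp_zero]
  choose g hg using h1
  have h2 : ∀ {A : T} {M : C} (x : t.obj A ⟶ M), G.map x ≫ g M = θ A ≫ G'.map x := by
    intro A M x
    obtain ⟨A', q, hq, l, hl⟩ := h.exists_lift_of_epi (h.genπ M) x
    rw [← cancel_epi (G.map (t.map q)), ← Category.assoc, ← G.map_comp, ← hl, G.map_comp,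
      Category.assoc, hg, ← Category.assoc, hθ, Category.assoc, ← G'.map_comp, hl,
      G'.map_comp, ← Category.assoc, ← hθ, Category.assoc]
  refine ⟨⟨g, fun M N φ => ?_⟩, fun A => ?_⟩
  · rw [← cancel_epi (G.map (h.genπ M)), ← Category.assoc, ← G.map_comp, h2, ← Category.assoc, h2,
      G'.map_comp, Category.assoc]
  · have := h2 (𝟙 (t.obj A))
    rwa [G.map_id, G'.map_id, Category.id_comp, Category.comp_id] at this

lemma natTrans_ext (h : IsScalarExtension F (F' := F') t) {D : Type*} [Category* D] [Abelian D] {G G' : C ⥤ D}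
    [PreservesFiniteColimits G] {η η' : G ⟶ G'}
    (hη : ∀ A, η.app (t.obj A) = η'.app (t.obj A)) : η = η' := by
  ext M
  rw [← cancel_epi (G.map (h.genπ M)), η.naturality, η'.naturality, hη]

end IsScalarExtension

end

lemma epi_tensorHom {R : Type v} [CommRing R] {M M' N N' : ModuleCat.{v} R} (f : M ⟶ M')
    (g : N ⟶ N') (hf : Epi f) (hg : Epi g) : Epi (f ⊗ₘ g) := by
  rw [ModuleCat.epi_iff_surjective] at hf hg ⊢
  exact TensorProduct.map_surjective hf hg

/-! ### Full faithfulness and essential surjectivity of restriction -/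

section

variable {F F' : Type v} [Field F] [Field F'] [Algebra F F']
  {T : Type u} [Category.{v} T] [Abelian T] [Linear F T] [MonoidalCategory T]
  [SymmetricCategory T] {C : Type*} [Category.{v} C] [Abelian C] [Linear F' C]
  [MonoidalCategory C] [SymmetricCategory C] {t : T ⥤ C} [t.Braided]
  {R : Type v} [CommRing R] [Algebra F R] [Algebra F' R] [IsScalarTower F F' R]

namespace IsScalarExtension

/-- The restriction of a fibre functor to the original category is a fibre functor. -/
theorem isFibreFunctor_precomp (h : IsScalarExtension F (F' := F') t)
    {ω : LaxBraidedFunctor C (ModuleCat.{v} R)} (hω : IsFibreFunctor F' C R ω) :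
    IsFibreFunctor F T R ((precomp t).obj ω) where
  isIso_ε := by
    have := hω.isIso_ε
    exact inferInstanceAs (IsIso (Functor.LaxMonoidal.ε ω.toFunctor ≫
      ω.toFunctor.map (Functor.LaxMonoidal.ε t)))
  isIso_μ A B := by
    have := hω.isIso_μ
    exact inferInstanceAs (IsIso (Functor.LaxMonoidal.μ ω.toFunctor (t.obj A) (t.obj B) ≫
      ω.toFunctor.map (Functor.LaxMonoidal.μ t A B)))
  additive := by
    have := h.additive
    have := hω.additive
    exact inferInstanceAs (t ⋙ ω.toFunctor).Additive
  linear a f := by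
    change ω.toFunctor.map (t.map (a • f)) = _ • ω.toFunctor.map (t.map f)
    rw [h.map_smul, hω.linear, ← IsScalarTower.algebraMap_apply]
    rfl
  leftExact := by
    have := h.preservesFiniteLimits
    have := hω.leftExact
    exact inferInstanceAs (PreservesFiniteLimits (t ⋙ ω.toFunctor))
  rightExact := by
    have := h.preservesFiniteColimits
    have := hω.rightExact
    exact inferInstanceAs (PreservesFiniteColimits (t ⋙ ω.toFunctor))
  faithful := by
    have := h.faithful
    have := hω.faithful
    exact inferInstanceAs (t ⋙ ω.toFunctor).Faithful
  finite A := hω.finite (t.obj A)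
  projective A := hω.projective (t.obj A)

variable {ω ω' : LaxBraidedFunctor C (ModuleCat.{v} R)}

lemma precomp_map_injective (h : IsScalarExtension F (F' := F') t)
    (hω : IsFibreFunctor F' C R ω) {η η' : ω ⟶ ω'}
    (hη : (precomp t).map η = (precomp (E := ModuleCat.{v} R) t).map η') : η = η' := by
  have := hω.rightExact
  refine LaxBraidedFunctor.hom_ext (h.natTrans_ext (G := ω.toFunctor) (G' := ω'.toFunctor)
    fun A => ?_)
  exact congrArg (fun k => k.hom.hom.app A) hη

/-- The morphisms `tA ⟶ tB` are `F'`-combinations of morphisms of `T`, and both functors are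
`F'`-linear, so naturality over `T` suffices. -/
lemma natural_of_precomp_hom (h : IsScalarExtension F (F' := F') t)
    (hω : IsFibreFunctor F' C R ω) (hω' : IsFibreFunctor F' C R ω')
    (ψ : t ⋙ ω.toFunctor ⟶ t ⋙ ω'.toFunctor) {A B : T} (u : t.obj A ⟶ t.obj B) :
    ω.toFunctor.map u ≫ ψ.app B = ψ.app A ≫ ω'.toFunctor.map u := by
  have := hω.additive
  have := hω'.additive
  refine h.hom_induction (fun a f => ?_) (fun f₁ f₂ h₁ h₂ => ?_) u
  · rw [hω.linear, hω'.linear, Linear.smul_comp, Linear.comp_smul]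
    exact congrArg _ (ψ.naturality f)
  · rw [Functor.map_add, Functor.map_add, Preadditive.add_comp, Preadditive.comp_add, h₁, h₂]

/-- On objects of the image the compatibility follows by cancelling the comparison isomorphism of
`t`. It spreads to `M` and `N` along the tensor product of the epimorphisms obtained from `genπ`,
which is surjective. -/
lemma isMonoidal_of_precomp (h : IsScalarExtension F (F' := F') t)
    (hω : IsFibreFunctor F' C R ω) (η : ω.toFunctor ⟶ ω'.toFunctor)
    (hη : NatTrans.IsMonoidal (F₁ := ((precomp t).obj ω).toFunctor)
      (F₂ := ((precomp t).obj ω').toFunctor) (Functor.whiskerLeft t η)) :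
    NatTrans.IsMonoidal η where
  unit := by
    rw [← cancel_mono (ω'.toFunctor.map (Functor.LaxMonoidal.ε t)), Category.assoc,
      ← η.naturality, ← Category.assoc]
    exact hη.unit
  tensor M N := by
    have := hω.rightExact
    have h1 : ∀ A B, Functor.LaxMonoidal.μ ω.toFunctor (t.obj A) (t.obj B) ≫
        η.app (t.obj A ⊗ t.obj B) = (η.app (t.obj A) ⊗ₘ η.app (t.obj B)) ≫
          Functor.LaxMonoidal.μ ω'.toFunctor (t.obj A) (t.obj B) := fun A B => by
      rw [← cancel_mono (ω'.toFunctor.map (Functor.LaxMonoidal.μ t A B)), Category.assoc,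
        ← η.naturality, ← Category.assoc]
      exact (hη.tensor A B).trans (Category.assoc _ _ _).symm
    have := epi_tensorHom (ω.toFunctor.map (h.genπ M)) (ω.toFunctor.map (h.genπ N)) inferInstance
      inferInstance
    rw [← cancel_epi (ω.toFunctor.map (h.genπ M) ⊗ₘ ω.toFunctor.map (h.genπ N)),
      ← Category.assoc, Functor.LaxMonoidal.μ_natural, Category.assoc, η.naturality,
      ← Category.assoc, h1, ← Category.assoc, MonoidalCategory.tensorHom_comp_tensorHom,
      η.naturality, η.naturality, ← MonoidalCategory.tensorHom_comp_tensorHom, Category.assoc,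
      Category.assoc, Functor.LaxMonoidal.μ_natural]

lemma exists_precomp_map_eq (h : IsScalarExtension F (F' := F') t)
    (hω : IsFibreFunctor F' C R ω) (hω' : IsFibreFunctor F' C R ω')
    (ψ : (precomp t).obj ω ⟶ (precomp t).obj ω') :
    ∃ η : ω ⟶ ω', (precomp t).map η = ψ := by
  have := hω.rightExact
  have := hω'.additive
  obtain ⟨η, hη⟩ := h.exists_natTrans ω.toFunctor ω'.toFunctor (fun A => ψ.hom.hom.app A)
    (fun u => h.natural_of_precomp_hom hω hω' ψ.hom.hom u)
  have h1 : Functor.whiskerLeft t η = ψ.hom.hom := NatTrans.ext (funext hη)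
  have h2 := h.isMonoidal_of_precomp hω η (by
    have := ψ.hom.isMonoidal
    rw [h1]
    exact this)
  exact ⟨LaxBraidedFunctor.homMk η, LaxBraidedFunctor.hom_ext h1⟩

variable [MonoidalPreadditive T] [MonoidalLinear F T]

/-- Restriction along the scalar extension functor is an equivalence of the categories of fibre
functors. -/
theorem isEquivalence_restrict (h : IsScalarExtension F (F' := F') t) (hT : IsPreTannakian F T)
    (hC : IsTensorCategory F' C)
    (hres : ∀ ω : FibreFunctor F' C R, IsFibreFunctor F T R ((precomp t).obj ω.obj)) :
    (ObjectProperty.lift (IsFibreFunctor F T R)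
      (ObjectProperty.ι (IsFibreFunctor F' C R) ⋙ precomp t) hres).IsEquivalence where
  faithful := ⟨fun {ω ω' f g} hfg => (ObjectProperty.ι _).map_injective
    (h.precomp_map_injective ω.property (congrArg (ObjectProperty.ι _).map hfg))⟩
  full := ⟨fun {ω ω'} ψ => by
    obtain ⟨η, hη⟩ := h.exists_precomp_map_eq ω.property ω'.property
      ((ObjectProperty.ι _).map ψ)
    exact ⟨ObjectProperty.homMk η,
      (ObjectProperty.ι _).map_injective hη⟩⟩
  essSurj := ⟨fun ω => by
    haveI := hC.toMonoidalPreadditive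
    haveI := hC.toMonoidalLinear
    exact ⟨⟨ω.property.extendLaxBraided h, ω.property.isFibreFunctor_extend h hT hC⟩,
      ⟨(ObjectProperty.ι (IsFibreFunctor F T R)).preimageIso
        (ω.property.extendRestrictIso h).symm⟩⟩⟩

end IsScalarExtension

end

end ScalarExtension
end

/-! ### The proposition -/

open ScalarExtension in
theorem mainTheorem10 {F F' T : Type v} [Field F] [Field F'] [Algebra F F']
    [SmallCategory T] [Abelian T] [Linear F T] [MonoidalCategory T] [SymmetricCategory T]
    (hT : IsPreTannakian F T) :
    ∃ ht : ∀ X : T, finiteLength (LinModule F F' (Ind T)) ((extFunctor F F' T).obj X),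
      (∃ (_ : MonoidalCategory (ScalarExt F F' T)) (_ : SymmetricCategory (ScalarExt F F' T))
        (_ : (scalarExtFunctor ht).Braided), IsTensorCategory F' (ScalarExt F F' T)) ∧
      ∀ [MonoidalCategory (ScalarExt F F' T)] [SymmetricCategory (ScalarExt F F' T)]
        [(scalarExtFunctor ht).Braided], IsTensorCategory F' (ScalarExt F F' T) →
        ∀ (R' : Type v) [CommRing R'] [Algebra F R'] [Algebra F' R'] [IsScalarTower F F' R'],
          ∃ hres : ∀ ω : FibreFunctor F' (ScalarExt F F' T) R',
              IsFibreFunctor F T R' ((precomp (scalarExtFunctor ht)).obj ω.obj),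
            (ObjectProperty.lift (IsFibreFunctor F T R')
              (ObjectProperty.ι (IsFibreFunctor F' (ScalarExt F F' T) R') ⋙
                precomp (scalarExtFunctor ht)) hres).IsEquivalence := by
  have := hT.toMonoidalPreadditive
  have := hT.toMonoidalLinear
  have := hT.rightExact_left
  have := hT.rightExact_right
  let ht := extFunctor_finiteLength (F' := F') hT.toIsFFinite
  have h : IsScalarExtension F (F' := F') (scalarExtFunctor ht) :=
    isScalarExtension_scalarExtFunctor hT.toIsFFinite ht
  refine ⟨ht, ⟨h.monoidalCategory, h.symmetricCategory, h.braided,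
    h.isTensorCategory hT.toIsTensorCategory⟩, fun hC R' => ?_⟩
  intros
  exact ⟨fun ω => h.isFibreFunctor_precomp ω.property,
    h.isEquivalence_restrict hT hC fun ω => h.isFibreFunctor_precomp ω.property⟩
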